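/- Let $\mathring{\mathfrak g}$ be a finite-dimensional simple complex Lie algebra with Cartan subalgebra $\mathring{\mathfrak h}$, a base of simple roots $\alpha_1,\dots,\alpha_r$ and highest root $\theta$, and let $\mathfrak g=\mathring{\mathfrak g}\otimes\mathbb C[t,t^{-1}]\oplus\mathbb Cc\oplus\mathbb Cd$ be the associated untwisted affine Kac-Moody algebra, with Cartan subalgebra $\mathfrak h=\mathring{\mathfrak h}\oplus\mathbb Cc\oplus\mathbb Cd$. Here $c$ is central, $[d,t^kx]=k\,t^kx$ and $[t^kx,t^ly]=t^{k+l}[x,y]+k\,\delta_{k,-l}(x|y)c$, where $(\cdot|\cdot)$ is the invariant form on $\mathring{\mathfrak g}$ normalized by $(\theta|\theta)=2$; the same symbol denotes the normalized invariant form on $\mathfrak h^*$. Let $\alpha_0^\vee=c-\theta^\vee,\alpha_1^\vee,\dots,\alpha_r^\vee$ be the simple coroots, let $\Lambda_0,\dots,\Lambda_r\in\mathfrak h^*$ be the fundamental weights, i.e. $\Lambda_i(\alpha_j^\vee)=\delta_{ij}$ and $\Lambda_i(d)=0$, let $\rho=\sum_i\Lambda_i$, let $h^\vee=\rho(c)$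 be the dual Coxeter number, and let $\delta\in\mathfrak h^*$ be the functional with $\delta(d)=1$ and $\delta|_{\mathring{\mathfrak h}\oplus\mathbb Cc}=0$. A weight $\lambda\in\mathfrak h^*$ is dominant integral if $\lambda(\alpha_i^\vee)\in\mathbb Z_{\ge0}$ for all $i$. Write $V(\lambda)$ for the irreducible highest weight $\mathfrak g$-module of highest weight $\lambda$; $V(\lambda)$ is a component of a module if the module has a submodule isomorphic to $V(\lambda)$. On a $\mathfrak g$-module of level $k$ on which every vector is killed by $t^j\otimes\mathring{\mathfrak g}$ for all large $j$, the Sugawara operator is $$L_0=\frac1{2(k+h^\vee)}\Big(\sum_iu_iu^i+2\sum_{j>0}\sum_i(t^{-j}u_i)(t^ju^i)\Big),$$ where $(u_i)$ and $(u^i)$ are dual bases of $\mathring{\mathfrak g}$ for $(\cdot|\cdot)$. On a tensor product of two such modules $V,V'$, the Goddard-Kent-Olive operator is $L_0^{GKO}=L_0^{V}\otimes1+1\otimes L_0^{V'}-L_0^{V\otimes V'}$. Let $m,n\ge1$ be integers, and for $\lambda\in\mathfrak h^*$ put $$s(\lambda)=\frac1{2h^\vee}\left(\frac{(m\rho|(m+2)\rho)}{m+1}+\frac{(n\rho|(n+2)\rho)}{n+1}-\frac{(\lambda|\lambda+2\rho)}{m+n+1}\right).$$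 Then: 1. If $\lambda=m\rho+\beta$ is dominant integral, where $\beta$ is a weight of $V(n\rho)$, then $s(\lambda)$ is a strictly positive real number. 2. If $W\subseteq V(m\rho)\otimes V(n\rho)$ is a submodule isomorphic to $V(\lambda)$ for some $\lambda\in\mathfrak h^*$, then $L_0^{GKO}$ acts on $W$ by the scalar $s(\lambda)$, and $s(\lambda)>0$. 3. If $V(\lambda)$ is a component of $V(m\rho)\otimes V(n\rho)$, then $V(\lambda-k\delta)$ is a component of $V(m\rho)\otimes V(n\rho)$ for every integer $k\ge0$. -/

import Mathlib

open scoped TensorProduct ComplexOrder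

set_option linter.unusedSectionVars false

noncomputable section

namespace UntwistedAffine

open LieAlgebra LieAlgebra.IsKilling

variable {𝔤 : Type*} [LieRing 𝔤] [LieAlgebra ℂ 𝔤] [FiniteDimensional ℂ 𝔤] [LieAlgebra.IsSimple ℂ 𝔤]
  {H : LieSubalgebra ℂ 𝔤} [H.IsCartanSubalgebra]

/-! ### The finite-dimensional simple Lie algebra -/

/-- `θ` is the highest root with respect to the base `b`: for every root `α`, the difference
`θ - α` is a sum of simple roots. -/
def IsHighestRoot (b : (rootSystem H).Base) (θ : H.root) : Prop :=
  ∀ α : H.root, (rootSystem H).root θ - (rootSystem H).root α ∈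
    AddSubmonoid.closure ((rootSystem H).root '' b.support)

/-- The bilinear form on the dual of the Cartan subalgebra induced by the Killing form. -/
def killingDual (α β : Module.Dual ℂ H) : ℂ := α ((cartanEquivDual H).symm β)

/-- The normalized invariant form on `𝔤`: the multiple of the Killing form whose induced form on
the dual of the Cartan subalgebra satisfies `(θ | θ) = 2`. -/
def normalizedForm (θ : H.root) : LinearMap.BilinForm ℂ 𝔤 :=
  (killingDual (H := H) ((rootSystem H).root θ) ((rootSystem H).root θ) / 2) • killingForm ℂ 𝔤

/-- The form on the dual of the Cartan subalgebra induced by `normalizedForm θ`. -/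
def normalizedDual (θ : H.root) (α β : Module.Dual ℂ H) : ℂ :=
  (2 / killingDual (H := H) ((rootSystem H).root θ) ((rootSystem H).root θ)) * killingDual α β

theorem killingDual_ne_zero (θ : H.root) :
    killingDual (H := H) ((rootSystem H).root θ) ((rootSystem H).root θ) ≠ 0 :=
  root_apply_cartanEquivDual_symm_ne_zero (H.isNonZero_coe_root θ)

theorem normalizedForm_isSymm (θ : H.root) : (normalizedForm θ).IsSymm :=
  ⟨fun x y => by
    simp [normalizedForm, LieModule.traceForm_comm ℂ 𝔤 𝔤 x y]⟩

theorem normalizedForm_invariant (θ : H.root) : (normalizedForm θ).lieInvariant 𝔤 := by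
  intro x y z
  have h : killingForm ℂ 𝔤 ⁅x, y⁆ z = -killingForm ℂ 𝔤 y ⁅x, z⁆ := by
    rw [← lie_skew x y, map_neg, LinearMap.neg_apply]
    exact congrArg Neg.neg (LieModule.traceForm_apply_lie_apply ℂ 𝔤 𝔤 y x z)
  simp only [normalizedForm, LinearMap.smul_apply, smul_eq_mul, h]
  ring

theorem normalizedForm_nondegenerate (θ : H.root) : (normalizedForm θ).Nondegenerate := by
  have hc : killingDual (H := H) ((rootSystem H).root θ) ((rootSystem H).root θ) / 2 ≠ 0 :=
    div_ne_zero (killingDual_ne_zero θ) two_ne_zero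
  refine (normalizedForm_isSymm θ).isRefl.nondegenerate_iff_separatingLeft.mpr fun x hx => ?_
  refine (killingForm_nondegenerate ℂ 𝔤).1 x fun y => ?_
  have h := hx y
  simp only [normalizedForm, LinearMap.smul_apply, smul_eq_mul] at h
  exact (mul_eq_zero.mp h).resolve_left hc

/-- The finite fundamental weights: the basis of the dual of the Cartan subalgebra which is dual to
the basis of simple coroots. -/
def finiteFundamentalWeight (b : (rootSystem H).Base) (i : b.support) : Module.Dual ℂ H :=
  b.toCoweightBasis.coord i

/-! ### The untwisted affine Lie algebra `𝔤 ⊗ ℂ[t, t⁻¹] ⊕ ℂ c ⊕ ℂ d` -/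

section LoopAlgebra

variable {L : Type*} [LieRing L] [LieAlgebra ℂ L]

/-- The bracket of the loop algebra `L ⊗ ℂ[t, t⁻¹]`, whose elements `∑ₙ tⁿ xₙ` are written as the
finitely supported functions `n ↦ xₙ`. It is determined by `[tᵐ x, tⁿ y] = tᵐ⁺ⁿ [x, y]`. -/
def loopLie (f g : ℤ →₀ L) : ℤ →₀ L :=
  f.sum fun m x => g.sum fun n y => Finsupp.single (m + n) ⁅x, y⁆

/-- The derivation `t d/dt` of the loop algebra. -/
def degreeDerivation : (ℤ →₀ L) →ₗ[ℂ] (ℤ →₀ L) :=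
  Finsupp.lsum ℂ fun n : ℤ => (n : ℂ) • Finsupp.lsingle n

/-- The pairing `(f, g) ↦ Res (df/dt | g)` attached to a bilinear form on `L`. It is determined by
`(tᵐ x, tⁿ y) ↦ m δ_{m,-n} (x | y)`. -/
def residue (Φ : LinearMap.BilinForm ℂ L) (f g : ℤ →₀ L) : ℂ :=
  f.sum fun m x => m * Φ x (g (-m))

theorem loopLie_single (m n : ℤ) (x y : L) :
    loopLie (Finsupp.single m x) (Finsupp.single n y) = Finsupp.single (m + n) ⁅x, y⁆ := by
  simp [loopLie]

theorem loopLie_add_left (f f' g : ℤ →₀ L) : loopLie (f + f') g = loopLie f g + loopLie f' g := by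
  refine Finsupp.sum_add_index' (fun m => by simp) fun m x x' => ?_
  simp [add_lie, Finsupp.single_add, Finsupp.sum_add]

theorem loopLie_add_right (f g g' : ℤ →₀ L) : loopLie f (g + g') = loopLie f g + loopLie f g' := by
  simp only [loopLie, ← Finsupp.sum_add]
  refine Finsupp.sum_congr fun m _ => ?_
  exact Finsupp.sum_add_index' (fun n => by simp) fun n y y' => by
    rw [lie_add, Finsupp.single_add]

theorem loopLie_zero_left (g : ℤ →₀ L) : loopLie 0 g = 0 := by simp [loopLie]

theorem loopLie_zero_right (f : ℤ →₀ L) : loopLie f 0 = 0 := by simp [loopLie]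

theorem loopLie_smul_right (r : ℂ) (f g : ℤ →₀ L) : loopLie f (r • g) = r • loopLie f g := by
  simp only [loopLie, Finsupp.smul_sum]
  refine Finsupp.sum_congr fun m _ => ?_
  rw [Finsupp.sum_smul_index' fun n => by simp]
  simp [lie_smul]

theorem loopLie_skew (f g : ℤ →₀ L) : loopLie f g = -loopLie g f := by
  induction f using Finsupp.induction_linear with
  | zero => simp [loopLie_zero_left, loopLie_zero_right]
  | add f f' hf hf' => rw [loopLie_add_left, loopLie_add_right, hf, hf', neg_add]
  | single m x =>
    induction g using Finsupp.induction_linear with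
    | zero => simp [loopLie_zero_left, loopLie_zero_right]
    | add g g' hg hg' => rw [loopLie_add_left, loopLie_add_right, hg, hg', neg_add]
    | single n y =>
      rw [loopLie_single, loopLie_single, add_comm n m, ← Finsupp.single_neg, lie_skew]

theorem loopLie_smul_left (r : ℂ) (f g : ℤ →₀ L) : loopLie (r • f) g = r • loopLie f g := by
  rw [loopLie_skew, loopLie_smul_right, loopLie_skew f g, smul_neg]

theorem loopLie_self (f : ℤ →₀ L) : loopLie f f = 0 := by
  have h : (2 : ℂ) • loopLie f f = 0 := by
    rw [two_smul, add_eq_zero_iff_eq_neg]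
    exact loopLie_skew f f
  exact (smul_eq_zero_iff_right two_ne_zero).mp h

theorem loopLie_neg_right (f g : ℤ →₀ L) : loopLie f (-g) = -loopLie f g := by
  simpa using loopLie_smul_right (-1) f g

theorem loopLie_sub_right (f g g' : ℤ →₀ L) : loopLie f (g - g') = loopLie f g - loopLie f g' := by
  rw [sub_eq_add_neg, loopLie_add_right, loopLie_neg_right, ← sub_eq_add_neg]

theorem loopLie_sub_left (f f' g : ℤ →₀ L) : loopLie (f - f') g = loopLie f g - loopLie f' g := by
  rw [loopLie_skew, loopLie_sub_right, loopLie_skew f g, loopLie_skew f' g]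
  abel

theorem loopLie_jacobi (f g h : ℤ →₀ L) :
    loopLie f (loopLie g h) = loopLie (loopLie f g) h + loopLie g (loopLie f h) := by
  induction f using Finsupp.induction_linear with
  | zero => simp [loopLie_zero_left, loopLie_zero_right]
  | add f f' hf hf' => simp only [loopLie_add_left, loopLie_add_right, hf, hf']; abel
  | single m x =>
    induction g using Finsupp.induction_linear with
    | zero => simp [loopLie_zero_left, loopLie_zero_right]
    | add g g' hg hg' => simp only [loopLie_add_left, loopLie_add_right, hg, hg']; abel
    | single n y =>
      induction h using Finsupp.induction_linear with
      | zero => simp [loopLie_zero_right]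
      | add h h' hh hh' => simp only [loopLie_add_right, hh, hh']; abel
      | single k z =>
        simp only [loopLie_single]
        rw [leibniz_lie x y z, Finsupp.single_add, add_assoc m n k, add_left_comm n m k]

theorem degreeDerivation_single (n : ℤ) (x : L) :
    degreeDerivation (Finsupp.single n x) = (n : ℂ) • Finsupp.single n x := by
  simp [degreeDerivation]

theorem degreeDerivation_loopLie (f g : ℤ →₀ L) :
    degreeDerivation (loopLie f g) =
      loopLie (degreeDerivation f) g + loopLie f (degreeDerivation g) := by
  induction f using Finsupp.induction_linear with
  | zero => simp [loopLie_zero_left]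
  | add f f' hf hf' => simp only [loopLie_add_left, map_add, hf, hf']; abel
  | single m x =>
    induction g using Finsupp.induction_linear with
    | zero => simp [loopLie_zero_right]
    | add g g' hg hg' => simp only [loopLie_add_right, map_add, hg, hg']; abel
    | single n y =>
      simp only [degreeDerivation_single, loopLie_smul_left, loopLie_smul_right, loopLie_single,
        ← add_smul]
      push_cast
      rfl

variable (Φ : LinearMap.BilinForm ℂ L)

theorem residue_single (m n : ℤ) (x y : L) :
    residue Φ (Finsupp.single m x) (Finsupp.single n y) = if m + n = 0 then m * Φ x y else 0 := by
  rw [residue, Finsupp.sum_single_index (by simp)]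
  by_cases h : m + n = 0
  · obtain rfl : n = -m := by omega
    simp
  · have h' : n ≠ -m := by omega
    simp [h, h']

theorem residue_add_left (f f' g : ℤ →₀ L) :
    residue Φ (f + f') g = residue Φ f g + residue Φ f' g :=
  Finsupp.sum_add_index' (fun m => by simp) fun m x x' => by
    rw [map_add, LinearMap.add_apply, mul_add]

theorem residue_add_right (f g g' : ℤ →₀ L) :
    residue Φ f (g + g') = residue Φ f g + residue Φ f g' := by
  simp only [residue, Finsupp.add_apply, map_add, mul_add, Finsupp.sum_add]

theorem residue_smul_left (r : ℂ) (f g : ℤ →₀ L) : residue Φ (r • f) g = r * residue Φ f g := by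
  rw [residue, Finsupp.sum_smul_index' fun n => by simp, residue, Finsupp.sum, Finsupp.sum,
    Finset.mul_sum]
  refine Finset.sum_congr rfl fun m _ => ?_
  rw [map_smul, LinearMap.smul_apply, smul_eq_mul]
  ring

theorem residue_smul_right (r : ℂ) (f g : ℤ →₀ L) : residue Φ f (r • g) = r * residue Φ f g := by
  rw [residue, residue, Finsupp.sum, Finsupp.sum, Finset.mul_sum]
  refine Finset.sum_congr rfl fun m _ => ?_
  rw [Finsupp.smul_apply, map_smul, smul_eq_mul]
  ring

theorem residue_zero_left (g : ℤ →₀ L) : residue Φ 0 g = 0 := by simp [residue]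

theorem residue_zero_right (f : ℤ →₀ L) : residue Φ f 0 = 0 := by simp [residue]

theorem residue_skew (hs : Φ.IsSymm) (f g : ℤ →₀ L) : residue Φ f g = -residue Φ g f := by
  induction f using Finsupp.induction_linear with
  | zero => simp [residue_zero_left, residue_zero_right]
  | add f f' hf hf' => rw [residue_add_left, residue_add_right, hf, hf', neg_add]
  | single m x =>
    induction g using Finsupp.induction_linear with
    | zero => simp [residue_zero_left, residue_zero_right]
    | add g g' hg hg' => rw [residue_add_left, residue_add_right, hg, hg', neg_add]
    | single n y =>
      rw [residue_single, residue_single, add_comm n m, hs.eq y x]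
      split_ifs with h
      · have h' : (n : ℂ) = -m := by
          rw [eq_neg_iff_add_eq_zero, add_comm]
          exact_mod_cast h
        rw [h']
        ring
      · rw [neg_zero]

theorem residue_degreeDerivation (f g : ℤ →₀ L) :
    residue Φ (degreeDerivation f) g = -residue Φ f (degreeDerivation g) := by
  induction f using Finsupp.induction_linear with
  | zero => simp [residue_zero_left]
  | add f f' hf hf' => rw [map_add, residue_add_left, residue_add_left, hf, hf', neg_add]
  | single m x =>
    induction g using Finsupp.induction_linear with
    | zero => simp [residue_zero_right]
    | add g g' hg hg' => rw [map_add, residue_add_right, residue_add_right, hg, hg', neg_add]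
    | single n y =>
      rw [degreeDerivation_single, degreeDerivation_single, residue_smul_left, residue_smul_right,
        residue_single]
      split_ifs with h
      · have h' : (n : ℂ) = -m := by
          rw [eq_neg_iff_add_eq_zero, add_comm]
          exact_mod_cast h
        rw [h']
        ring
      · ring

theorem residue_cocycle (hi : Φ.lieInvariant L) (f g h : ℤ →₀ L) :
    residue Φ f (loopLie g h) = residue Φ (loopLie f g) h + residue Φ g (loopLie f h) := by
  induction f using Finsupp.induction_linear with
  | zero => simp [loopLie_zero_left, residue_zero_left, residue_zero_right]
  | add f f' hf hf' =>
    simp only [loopLie_add_left, residue_add_left, residue_add_right, hf, hf']; ring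
  | single m x =>
    induction g using Finsupp.induction_linear with
    | zero => simp [loopLie_zero_left, loopLie_zero_right, residue_zero_left, residue_zero_right]
    | add g g' hg hg' =>
      simp only [loopLie_add_left, loopLie_add_right, residue_add_left, residue_add_right, hg, hg']
      ring
    | single n y =>
      induction h using Finsupp.induction_linear with
      | zero => simp [loopLie_zero_right, residue_zero_right]
      | add h h' hh hh' => simp only [loopLie_add_right, residue_add_right, hh, hh']; ring
      | single k z =>
        simp only [loopLie_single, residue_single]
        have e : (m + (n + k) = 0 ↔ m + n + k = 0) ∧ (n + (m + k) = 0 ↔ m + n + k = 0) := by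
          omega
        rw [if_congr e.1 rfl rfl, if_congr e.2 rfl rfl]
        split_ifs with h0
        · have h1 : Φ ⁅x, y⁆ z = Φ x ⁅y, z⁆ := by
            rw [← lie_skew x y, LinearMap.BilinForm.neg_left, hi y x z, neg_neg]
          have h2 : Φ y ⁅x, z⁆ = -Φ x ⁅y, z⁆ := by rw [← h1, hi x y z, neg_neg]
          rw [h1, h2]
          push_cast
          ring
        · ring

end LoopAlgebra

/-- The untwisted affine Kac-Moody algebra `𝔤 ⊗ ℂ[t, t⁻¹] ⊕ ℂ c ⊕ ℂ d` of the simple Lie algebra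
`𝔤`, with elements `f + a c + s d`. The highest root `θ` enters through the normalized form in the
bracket. -/
@[ext]
structure Affine (θ : H.root) where
  /-- The component `f` in the loop algebra. -/
  loop : ℤ →₀ 𝔤
  /-- The coefficient `a` of the central element `c`. -/
  central : ℂ
  /-- The coefficient `s` of the degree derivation `d`. -/
  degree : ℂ

variable (θ : H.root)

/-- The components of an element of the affine Lie algebra. -/
def affineEquiv : Affine θ ≃ (ℤ →₀ 𝔤) × ℂ × ℂ where
  toFun X := (X.loop, X.central, X.degree)
  invFun p := ⟨p.1, p.2.1, p.2.2⟩

instance : AddCommGroup (Affine θ) := (affineEquiv θ).addCommGroup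

instance : Module ℂ (Affine θ) := (affineEquiv θ).module ℂ

/-- `[f + a c + s d, g + a' c + s' d] = [f, g] + s t dg/dt - s' t df/dt + Res (df/dt | g) c`. In
particular `[tᵐ x, tⁿ y] = tᵐ⁺ⁿ [x, y] + m δ_{m,-n} (x | y) c`, the element `c` is central, and
`[d, tⁿ x] = n tⁿ x`. -/
instance : Bracket (Affine θ) (Affine θ) where
  bracket X Y :=
    { loop := loopLie X.loop Y.loop + X.degree • degreeDerivation Y.loop
        - Y.degree • degreeDerivation X.loop
      central := residue (normalizedForm θ) X.loop Y.loop
      degree := 0 }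

section Components

variable {θ} (X Y : Affine θ) (r : ℂ)

@[simp] theorem loop_add : (X + Y).loop = X.loop + Y.loop := rfl
@[simp] theorem central_add : (X + Y).central = X.central + Y.central := rfl
@[simp] theorem degree_add : (X + Y).degree = X.degree + Y.degree := rfl
@[simp] theorem loop_smul : (r • X).loop = r • X.loop := rfl
@[simp] theorem central_smul : (r • X).central = r * X.central := rfl
@[simp] theorem degree_smul : (r • X).degree = r * X.degree := rfl
@[simp] theorem loop_zero : (0 : Affine θ).loop = 0 := rfl
@[simp] theorem central_zero : (0 : Affine θ).central = 0 := rfl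
@[simp] theorem degree_zero : (0 : Affine θ).degree = 0 := rfl

theorem loop_lie : ⁅X, Y⁆.loop = loopLie X.loop Y.loop + X.degree • degreeDerivation Y.loop
    - Y.degree • degreeDerivation X.loop := rfl
theorem central_lie : ⁅X, Y⁆.central = residue (normalizedForm θ) X.loop Y.loop := rfl
theorem degree_lie : ⁅X, Y⁆.degree = 0 := rfl

end Components

instance : LieRing (Affine θ) where
  add_lie X Y Z := by
    refine Affine.ext ?_ ?_ ?_
    · simp only [loop_add, loop_lie, degree_add, loopLie_add_left, map_add, add_smul, smul_add]
      abel
    · simp only [central_add, central_lie, loop_add, residue_add_left]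
    · simp only [degree_add, degree_lie, add_zero]
  lie_add X Y Z := by
    refine Affine.ext ?_ ?_ ?_
    · simp only [loop_add, loop_lie, degree_add, loopLie_add_right, map_add, add_smul, smul_add]
      abel
    · simp only [central_add, central_lie, loop_add, residue_add_right]
    · simp only [degree_add, degree_lie, add_zero]
  lie_self X := by
    refine Affine.ext ?_ ?_ rfl
    · rw [loop_lie, loopLie_self, zero_add, sub_self, loop_zero]
    · exact self_eq_neg.mp (residue_skew _ (normalizedForm_isSymm θ) X.loop X.loop)
  leibniz_lie X Y Z := by
    obtain ⟨f, a, s⟩ := X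
    obtain ⟨g, a', s'⟩ := Y
    obtain ⟨h, a'', s''⟩ := Z
    refine Affine.ext ?_ ?_ ?_
    · simp only [loop_add, loop_lie, degree_lie, map_add, map_sub, map_smul, loopLie_add_left,
        loopLie_add_right, loopLie_sub_left, loopLie_sub_right, loopLie_smul_left,
        loopLie_smul_right, degreeDerivation_loopLie, smul_add, smul_sub, zero_smul,
        loopLie_jacobi f g h]
      rw [loopLie_skew g (degreeDerivation f), smul_comm s s', smul_comm s s'', smul_comm s' s'']
      simp only [smul_neg]
      abel
    · have sub_l : ∀ u v w : ℤ →₀ 𝔤, residue (normalizedForm θ) (u - v) w =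
          residue (normalizedForm θ) u w - residue (normalizedForm θ) v w := fun u v w => by
        rw [eq_sub_iff_add_eq, ← residue_add_left, sub_add_cancel]
      have sub_r : ∀ u v w : ℤ →₀ 𝔤, residue (normalizedForm θ) u (v - w) =
          residue (normalizedForm θ) u v - residue (normalizedForm θ) u w := fun u v w => by
        rw [eq_sub_iff_add_eq, ← residue_add_right, sub_add_cancel]
      have e := residue_skew _ (normalizedForm_isSymm θ) g (degreeDerivation f)
      simp only [central_add, central_lie, loop_lie, sub_l, sub_r, residue_add_left,
        residue_add_right, residue_smul_left, residue_smul_right, residue_degreeDerivation,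
        residue_cocycle _ (normalizedForm_invariant θ) f g h] at e ⊢
      rw [e]
      ring
    · simp only [degree_add, degree_lie, add_zero]

instance : LieAlgebra ℂ (Affine θ) where
  lie_smul r X Y := by
    refine Affine.ext ?_ ?_ ?_
    · simp only [loop_smul, loop_lie, degree_smul, loopLie_smul_right, map_smul, smul_sub,
        smul_add, mul_smul, smul_comm r X.degree]
    · simp only [central_smul, central_lie, loop_smul, residue_smul_right]
    · simp only [degree_smul, degree_lie, mul_zero]

/-- The element `tⁿ ⊗ x` of the affine Lie algebra. -/
def current (n : ℤ) (x : 𝔤) : Affine θ := ⟨Finsupp.single n x, 0, 0⟩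

/-- The Cartan subalgebra of the affine Lie algebra, the sum of `H`, `ℂ c` and `ℂ d`; the triple
`(h, a, s)` stands for `h + a c + s d`. -/
abbrev AffineCartan (H : LieSubalgebra ℂ 𝔤) : Type _ := H × ℂ × ℂ

/-- The inclusion of the Cartan subalgebra. -/
def ofCartan (h : AffineCartan H) : Affine θ :=
  ⟨Finsupp.single 0 (h.1 : 𝔤), h.2.1, h.2.2⟩

/-! ### Weights -/

/-- The dual of the Cartan subalgebra of the affine Lie algebra. The triple `(α, k, r)` is the
functional `h + a c + s d ↦ α h + k a + r s`, that is, the weight `α + k Λ₀ + r δ`. -/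
abbrev AffineWeight (H : LieSubalgebra ℂ 𝔤) : Type _ := Module.Dual ℂ H × ℂ × ℂ

/-- The value of a weight on an element of the Cartan subalgebra. -/
def evalWeight (lam : AffineWeight H) (h : AffineCartan H) : ℂ :=
  lam.1 h.1 + lam.2.1 * h.2.1 + lam.2.2 * h.2.2

/-- The basic imaginary root `δ`. -/
def delta (H : LieSubalgebra ℂ 𝔤) : AffineWeight H := (0, 0, 1)

/-- The normalized invariant form on the dual of the Cartan subalgebra: it extends the normalized
form of `𝔤`, and `(Λ₀ | δ) = 1`, `(Λ₀ | Λ₀) = (δ | δ) = 0`. -/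
def weightForm (lam mu : AffineWeight H) : ℂ :=
  normalizedDual θ lam.1 mu.1 + lam.2.1 * mu.2.2 + lam.2.2 * mu.2.1

variable (b : (rootSystem H).Base)

/-- The simple coroots: those of `𝔤`, and `α₀^∨ = c - θ^∨`. -/
def simpleCoroot : Option b.support → AffineCartan H
  | none => (-(rootSystem H).coroot θ, 1, 0)
  | some i => ((rootSystem H).coroot i, 0, 0)

/-- The fundamental weights: `Λ₀`, and `Λᵢ = ωᵢ + ωᵢ(θ^∨) Λ₀` for the other nodes. They are the
weights dual to the simple coroots that vanish on `d`. -/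
def fundamentalWeight : Option b.support → AffineWeight H
  | none => (0, 1, 0)
  | some i =>
    (finiteFundamentalWeight b i, finiteFundamentalWeight b i ((rootSystem H).coroot θ), 0)

theorem fundamentalWeight_simpleCoroot [DecidableEq b.support] (i j : Option b.support) :
    evalWeight (fundamentalWeight θ b i) (simpleCoroot θ b j) = if i = j then 1 else 0 := by
  rcases i with _ | i <;> rcases j with _ | j
  · simp [evalWeight, fundamentalWeight, simpleCoroot]
  · simp [evalWeight, fundamentalWeight, simpleCoroot]
  · simp only [evalWeight, fundamentalWeight, simpleCoroot, map_neg]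
    simp
  · simp only [evalWeight, fundamentalWeight, simpleCoroot, finiteFundamentalWeight,
      Module.Basis.coord_apply, RootPairing.Base.toCoweightBasis_repr_coroot,
      Finsupp.single_apply, Option.some.injEq]
    simp [eq_comm]

/-- `ρ` is the sum of the fundamental weights. -/
def rho : AffineWeight H := ∑ i : Option b.support, fundamentalWeight θ b i

/-- The dual Coxeter number: one plus the sum of the coefficients of `θ^∨` in the basis of simple
coroots. -/
def dualCoxeter : ℂ := 1 + ∑ i : b.support, finiteFundamentalWeight b i ((rootSystem H).coroot θ)

theorem rho_level : (rho θ b).2.1 = dualCoxeter θ b := by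
  simp [rho, dualCoxeter, Fintype.sum_option, fundamentalWeight, Prod.snd_sum, Prod.fst_sum]

/-- Dominant integral weights: those with nonnegative integral values on the simple coroots. -/
def IsDominantIntegral (lam : AffineWeight H) : Prop :=
  ∀ i : Option b.support, ∃ k : ℕ, evalWeight lam (simpleCoroot θ b i) = k

/-! ### Modules over the affine Lie algebra -/

section Modules

variable (V : Type*) [AddCommGroup V] [Module ℂ V] [LieRingModule (Affine θ) V]

variable {V} in
/-- `v` lies in the weight space of weight `lam`. -/
def HasWeight (lam : AffineWeight H) (v : V) : Prop :=
  ∀ h : AffineCartan H, ⁅ofCartan θ h, v⁆ = evalWeight lam h • v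

/-- `lam` is a weight of the module `V`. -/
def IsWeight (lam : AffineWeight H) : Prop := ∃ v : V, v ≠ 0 ∧ HasWeight θ lam v

variable {V} in
/-- `v` is a highest weight vector of weight `lam`: a nonzero vector of this weight which is killed
by the root spaces of the positive roots of `𝔤` and by `tᵏ ⊗ x` for all `k > 0` and `x ∈ 𝔤`. -/
def IsHighestWeightVector (lam : AffineWeight H) (v : V) : Prop :=
  v ≠ 0 ∧ HasWeight θ lam v ∧
    (∀ α : H.root, b.IsPos α → ∀ e ∈ rootSpace H (α : LieModule.Weight ℂ H 𝔤),
      ⁅current θ 0 e, v⁆ = 0) ∧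
    ∀ k : ℤ, 0 < k → ∀ x : 𝔤, ⁅current θ k x, v⁆ = 0

/-- `V` is (a model of) `V(lam)`, the irreducible highest weight module of highest weight `lam`. -/
def IsIrreducibleHighestWeight (lam : AffineWeight H) : Prop :=
  LieModule.IsIrreducible ℂ (Affine θ) V ∧ ∃ v : V, IsHighestWeightVector θ b lam v

/-- `V(lam)` is a component of `V`: some submodule of `V` is a copy of `V(lam)`. -/
def IsComponent [LieModule ℂ (Affine θ) V] (lam : AffineWeight H) : Prop :=
  ∃ W : LieSubmodule ℂ (Affine θ) V, IsIrreducibleHighestWeight θ b W lam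

end Modules

/-! ### The Goddard-Kent-Olive operator `L₀` -/

/-- A basis `uᵢ` of `𝔤`. -/
def basisOf (𝔤 : Type*) [LieRing 𝔤] [LieAlgebra ℂ 𝔤] [FiniteDimensional ℂ 𝔤] :
    Module.Basis (Fin (Module.finrank ℂ 𝔤)) ℂ 𝔤 := Module.finBasis ℂ 𝔤

/-- The basis `uⁱ` of `𝔤` dual to `uᵢ` with respect to the normalized form. -/
def dualBasisOf : Module.Basis (Fin (Module.finrank ℂ 𝔤)) ℂ 𝔤 :=
  (normalizedForm θ).dualBasis (normalizedForm_nondegenerate θ) (basisOf 𝔤)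

/-- The Sugawara operator
`L₀ = 1 / (2 (k + h^∨)) (∑ᵢ uᵢ uⁱ + 2 ∑_{j > 0} ∑ᵢ (t⁻ʲ uᵢ) (tʲ uⁱ))` of level `k`, for an action `φ`
of the affine Lie algebra on `M`. On a module where every vector is killed by `tʲ ⊗ 𝔤` for all
large `j`, the sum has finitely many nonzero terms at each vector. -/
def sugawaraL0 {M : Type*} [AddCommGroup M] [Module ℂ M] (φ : Affine θ → Module.End ℂ M) (k : ℂ)
    (v : M) : M :=
  (1 / (2 * (k + dualCoxeter θ b))) •
    (∑ i, φ (current θ 0 (basisOf 𝔤 i)) (φ (current θ 0 (dualBasisOf θ i)) v) +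
      (2 : ℂ) • ∑ᶠ j : ℕ, ∑ i, φ (current θ (-(j + 1 : ℤ)) (basisOf 𝔤 i))
        (φ (current θ (j + 1 : ℤ) (dualBasisOf θ i)) v))

section GKO

variable (V V' : Type*) [AddCommGroup V] [Module ℂ V] [LieRingModule (Affine θ) V]
  [LieModule ℂ (Affine θ) V] [AddCommGroup V'] [Module ℂ V'] [LieRingModule (Affine θ) V']
  [LieModule ℂ (Affine θ) V']

/-- The Goddard-Kent-Olive operator `L₀` on `V ⊗ V'`, for modules `V` and `V'` of levels `k` and
`k'`: the Sugawara operator of the first factor, plus that of the second factor, minus that of the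
tensor product module, which has level `k + k'`. -/
def gkoL0 (k k' : ℂ) (w : V ⊗[ℂ] V') : V ⊗[ℂ] V' :=
  sugawaraL0 θ b (fun X => (LieModule.toEnd ℂ (Affine θ) V X).rTensor V') k w +
    sugawaraL0 θ b (fun X => (LieModule.toEnd ℂ (Affine θ) V' X).lTensor V) k' w -
      sugawaraL0 θ b (fun X => LieModule.toEnd ℂ (Affine θ) (V ⊗[ℂ] V') X) (k + k') w

end GKO

/-- The expression
`1/(2h^∨) ((mρ | (m+2)ρ)/(m+1) + (nρ | (n+2)ρ)/(n+1) - (lam | lam + 2ρ)/(m+n+1))`. -/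
def gkoScalar (m n : ℕ) (lam : AffineWeight H) : ℂ :=
  1 / (2 * dualCoxeter θ b) *
    (weightForm θ (m • rho θ b) ((m + 2) • rho θ b) / (m + 1) +
      weightForm θ (n • rho θ b) ((n + 2) • rho θ b) / (n + 1) -
        weightForm θ lam (lam + 2 • rho θ b) / (m + n + 1))

end UntwistedAffine

end

/-! The coset (Goddard-Kent-Olive) Virasoro operators `L₋₁`, `L₀`, `L₁` act on `V(mρ) ⊗ V(nρ)` and
commute with the diagonal modes. On the submodule generated by a highest weight vector, `L₀` is a
scalar that can be computed and is positive. The rest is `sl₂`-theory for the coset triple; neither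
unitarity nor the full Virasoro relations with central charge are needed.

Scalar. On a highest weight module of level `k`, the operator `L₀ + d` commutes with the whole
affine algebra. Up to the factor `2(k + h^∨)` it is the Casimir operator, so it equals
`(μ|μ+2ρ)/(2(k+h^∨))` (`degreeCasimir_of_mem_lieSpan`). Since `d` acts on a tensor product as `d ⊗ 1
+ 1 ⊗ d`, it cancels in the coset combination and `s(λ)` remains (`gkoZero_of_mem_lieSpan`).

Positivity. Write `M = m + n` and `μ = Mρ - λ`, a nonnegative combination of simple roots. Then
`(λ|λ+2ρ) = M(M+2)(ρ|ρ) - (μ|λ+(M+2)ρ)`, and the last pairing is nonnegative because `λ` is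
dominant. What is left is `(ρ|ρ)` times a positive rational function of `m` and `n`
(`gkoScalar_pos`). Highest weights in the tensor product are dominant because the simple lowering
operators are locally nilpotent on both factors, hence on the tensor product.

Descent by `δ`. For a highest weight vector `v` of weight `λ`, the vector `L₋₁ v` is zero or a
highest weight vector of weight `λ - δ`. Suppose it is zero. Then `v` generates under `L₁` a string
of highest weight vectors with `L₀`-eigenvalues `s, s-1, s-2, …`. The string stops at some `N`,
since the weights are bounded above, and `[L₁, L₋₁] = 2L₀` then forces `s = N/2`. The last
eigenvalue is `-N/2 ≤ 0`, contrary to positivity (`gko_neg_one_ne_zero`). A highest weight vector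
generates an irreducible submodule by a Casimir comparison (`isComponent_of_isHighestWeightVector`),
so the vector `L₋₁ v` yields a component.

The Sugawara commutators carry the computation. `L₁` and `L₋₁` have odd total degree, so they need
no normal-ordering correction, and `L₀` is recovered as half of their commutator. -/

noncomputable section

namespace UntwistedAffine

open LieAlgebra LieAlgebra.IsKilling

/-! ### Finite root system: positivity of the form, the half sum of positive roots, the dual Coxeter
number. -/

section RootSystem

variable {𝔤 : Type*} [LieRing 𝔤] [LieAlgebra ℂ 𝔤] [FiniteDimensional ℂ 𝔤] [LieAlgebra.IsSimple ℂ 𝔤]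
  {H : LieSubalgebra ℂ 𝔤} [H.IsCartanSubalgebra]

/-! ### The form on the dual of the Cartan subalgebra -/

theorem traceForm_cartanEquivDual_symm (α : Module.Dual ℂ H) (x : H) :
    LieModule.traceForm ℂ H 𝔤 ((cartanEquivDual H).symm α) x = α x := by
  have h : cartanEquivDual H ((cartanEquivDual H).symm α) x = α x := by
    rw [LinearEquiv.apply_symm_apply]
  rwa [cartanEquivDual_apply_apply] at h

theorem killingDual_comm (α β : Module.Dual ℂ H) : killingDual α β = killingDual β α := by
  rw [killingDual, killingDual, ← traceForm_cartanEquivDual_symm, LieModule.traceForm_comm,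
    traceForm_cartanEquivDual_symm]

theorem apply_coroot (α : H.root) (β : Module.Dual ℂ H) :
    β ((rootSystem H).coroot α) =
      2 * killingDual β ((rootSystem H).root α) /
        killingDual ((rootSystem H).root α) ((rootSystem H).root α) := by
  rw [rootSystem_coroot_apply, coroot, killingDual, killingDual]
  simp only [rootSystem_root_apply, map_nsmul, map_smul, smul_eq_mul, nsmul_eq_mul]
  rw [LieModule.Weight.toLinear_apply]
  push_cast
  ring

/-- The coroot form takes the value `4 / (α|α)` at `α^∨`, and this value is also the sum of the
squares of the integers `⟨β, α^∨⟩` over all roots `β`. -/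
theorem exists_killingDual_root_self (α : H.root) : ∃ r : ℝ, 0 < r ∧
    killingDual ((rootSystem H).root α) ((rootSystem H).root α) = r := by
  have h0 := killingDual_ne_zero α
  set c := killingDual ((rootSystem H).root α) ((rootSystem H).root α) with hc
  have h1 : (rootSystem H).CorootForm ((rootSystem H).coroot α) ((rootSystem H).coroot α)
      = 4 / c := by
    rw [corootForm_rootSystem_eq_killing, restrict_killingForm, rootSystem_coroot_apply,
      traceForm_coroot]
    have h2 := apply_coroot α ((rootSystem H).root α)
    rw [← hc, mul_div_assoc, div_self h0] at h2
    have h3 : (α : LieModule.Weight ℂ H 𝔤) (coroot (α : LieModule.Weight ℂ H 𝔤)) = 2 * 1 := h2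
    have h4 : (α : LieModule.Weight ℂ H 𝔤) ((cartanEquivDual H).symm
      (α : LieModule.Weight ℂ H 𝔤).toLinear) = c := rfl
    rw [h3, h4]
    simp only [smul_eq_mul, nsmul_eq_mul]
    push_cast
    field_simp
    norm_num
  have h5 : ∃ N : ℝ, 0 ≤ N ∧
      (rootSystem H).CorootForm ((rootSystem H).coroot α) ((rootSystem H).coroot α) = N := by
    refine ⟨∑ β : H.root, ((rootSystem H).pairingIn ℤ β α : ℝ) ^ 2,
      Finset.sum_nonneg fun _ _ => sq_nonneg _, ?_⟩
    rw [RootPairing.corootForm_apply_apply]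
    push_cast
    refine Finset.sum_congr rfl fun β _ => ?_
    rw [sq]
    have : (rootSystem H).root' β ((rootSystem H).coroot α) =
      (((rootSystem H).pairingIn ℤ β α : ℤ) : ℂ) := ((rootSystem H).algebraMap_pairingIn ℤ β α).symm
    exact congrArg₂ (· * ·) this this
  obtain ⟨N, hN, h6⟩ := h5
  rw [h6] at h1
  have hN0 : N ≠ 0 := by
    rintro rfl
    exact div_ne_zero four_ne_zero h0 (by simpa using h1.symm)
  refine ⟨4 / N, by positivity, ?_⟩
  push_cast
  rw [h1]
  field_simp

variable (θ : H.root)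

theorem normalizedDual_comm (α β : Module.Dual ℂ H) :
    normalizedDual θ α β = normalizedDual θ β α := by
  rw [normalizedDual, normalizedDual, killingDual_comm α β]

theorem normalizedDual_add_left (α β γ : Module.Dual ℂ H) :
    normalizedDual θ (α + β) γ = normalizedDual θ α γ + normalizedDual θ β γ := by
  simp only [normalizedDual, killingDual, LinearMap.add_apply]
  ring

theorem normalizedDual_smul_left (r : ℂ) (α γ : Module.Dual ℂ H) :
    normalizedDual θ (r • α) γ = r * normalizedDual θ α γ := by
  simp only [normalizedDual, killingDual, LinearMap.smul_apply, smul_eq_mul]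
  ring

theorem normalizedDual_root (β : Module.Dual ℂ H) :
    normalizedDual θ β ((rootSystem H).root θ) = β ((rootSystem H).coroot θ) := by
  rw [apply_coroot, normalizedDual]
  ring

/-- The ratio is `(α|α)/(θ|θ)`, independent of `β`. It turns sign conditions on coroots into sign
conditions for the form. -/
theorem exists_normalizedDual_root (α : H.root) : ∃ r : ℝ, 0 < r ∧ ∀ β : Module.Dual ℂ H,
    normalizedDual θ β ((rootSystem H).root α) = r * β ((rootSystem H).coroot α) := by
  obtain ⟨r, hr, h⟩ := exists_killingDual_root_self α
  obtain ⟨s, hs, h'⟩ := exists_killingDual_root_self θ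
  refine ⟨r / s, by positivity, fun β => ?_⟩
  rw [apply_coroot, normalizedDual, h, h']
  have : (r : ℂ) ≠ 0 := by exact_mod_cast hr.ne'
  push_cast
  field_simp

/-! ### Nonnegative combinations of simple roots -/

variable (b : (rootSystem H).Base)

/-- `β` is a combination of simple roots with natural number coefficients. -/
def IsNatComb (β : Module.Dual ℂ H) : Prop :=
  ∀ i : b.support, ∃ n : ℕ, b.toWeightBasis.coord i β = n

variable {b}

theorem IsNatComb.zero : IsNatComb b (0 : Module.Dual ℂ H) := fun i => ⟨0, by simp⟩

theorem IsNatComb.add {β γ : Module.Dual ℂ H} (hβ : IsNatComb b β) (hγ : IsNatComb b γ) :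
    IsNatComb b (β + γ) := fun i => by
  obtain ⟨m, hm⟩ := hβ i
  obtain ⟨n, hn⟩ := hγ i
  exact ⟨m + n, by rw [map_add, hm, hn]; push_cast; rfl⟩

theorem coord_root_support (i j : b.support) [Decidable (i = j)] :
    b.toWeightBasis.coord j ((rootSystem H).root i) = if i = j then 1 else 0 := by
  classical
  rw [Module.Basis.coord_apply, b.toWeightBasis_repr_root, Finsupp.single_apply]

theorem isNatComb_of_mem_closure {β : Module.Dual ℂ H}
    (h : β ∈ AddSubmonoid.closure ((rootSystem H).root '' b.support)) : IsNatComb b β := by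
  classical
  induction h using AddSubmonoid.closure_induction with
  | mem x hx =>
    obtain ⟨i, hi, rfl⟩ := hx
    intro j
    have h := coord_root_support (b := b) ⟨i, hi⟩ j
    exact ⟨if (⟨i, hi⟩ : b.support) = j then 1 else 0, by rw [h]; split_ifs <;> simp⟩
  | zero => exact IsNatComb.zero
  | add x y _ _ hx hy => exact hx.add hy

theorem isNatComb_of_isPos {α : H.root} (h : b.IsPos α) :
    IsNatComb b ((rootSystem H).root α) := by
  obtain ⟨f, hf, hf' | hf'⟩ := b.exists_root_eq_sum_nat_or_neg α
  · refine isNatComb_of_mem_closure ?_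
    rw [hf']
    exact AddSubmonoid.sum_mem _ fun i hi =>
      AddSubmonoid.nsmul_mem _ (AddSubmonoid.subset_closure (Set.mem_image_of_mem _ hi)) _
  · exfalso
    rw [RootPairing.Base.isPos_iff, b.height_eq_sum (f := fun i => -(f i : ℤ))] at h
    · have : 0 ≤ ∑ j ∈ b.support, (f j : ℤ) := Finset.sum_nonneg fun _ _ => by positivity
      rw [Finset.sum_neg_distrib] at h
      omega
    · rw [hf', ← Finset.sum_neg_distrib]
      simp

theorem isNatComb_or_neg (α : H.root) :
    (b.IsPos α ∧ IsNatComb b ((rootSystem H).root α)) ∨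
      (¬ b.IsPos α ∧ IsNatComb b (-(rootSystem H).root α)) := by
  by_cases h : b.IsPos α
  · exact Or.inl ⟨h, isNatComb_of_isPos h⟩
  · refine Or.inr ⟨h, ?_⟩
    have h' := (RootPairing.Base.IsPos.neg_iff_not (b := b) α).mpr h
    let := (rootSystem H).indexNeg
    have := isNatComb_of_isPos h'
    rwa [show (rootSystem H).root (-α) = -(rootSystem H).root α from
      (RootPairing.root_reflectionPerm _ _ _).trans (RootPairing.reflection_apply_self _ _)] at this

theorem IsNatComb.eq_zero {β : Module.Dual ℂ H} (h : IsNatComb b β) (h' : IsNatComb b (-β)) :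
    β = 0 := by
  refine b.toWeightBasis.ext_elem fun i => ?_
  obtain ⟨m, hm⟩ := h i
  obtain ⟨n, hn⟩ := h' i
  rw [map_neg, hm] at hn
  have h0 : ((m + n : ℕ) : ℂ) = 0 := by push_cast; rw [← hn]; ring
  have : m = 0 := by have := Nat.cast_eq_zero.mp h0; omega
  rw [Module.Basis.coord_apply] at hm
  rw [hm, this]
  simp

variable {θ}

theorem IsHighestRoot.isNatComb (hθ : IsHighestRoot b θ) (α : H.root) :
    IsNatComb b ((rootSystem H).root θ - (rootSystem H).root α) :=
  isNatComb_of_mem_closure (hθ α)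

theorem IsHighestRoot.isPos (hθ : IsHighestRoot b θ) : b.IsPos θ := by
  classical
  rcases isNatComb_or_neg (b := b) θ with h | h
  · exact h.1
  · exfalso
    have : Nonempty H.root := ⟨θ⟩
    obtain ⟨i, hi⟩ := b.support_nonempty
    obtain ⟨m, hm⟩ := hθ.isNatComb i ⟨i, hi⟩
    obtain ⟨n, hn⟩ := h.2 ⟨i, hi⟩
    have h1 := coord_root_support (b := b) ⟨i, hi⟩ ⟨i, hi⟩
    rw [if_pos rfl] at h1
    rw [map_neg] at hn
    rw [map_sub, h1] at hm
    have : ((m + n + 1 : ℕ) : ℂ) = 0 := by push_cast; rw [← hm, ← hn]; ring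
    exact absurd (Nat.cast_eq_zero.mp this) (by omega)

/-! ### The half sum of the positive roots -/

variable (b)

/-- The sum of the finite fundamental weights. -/
def finiteRho : Module.Dual ℂ H := ∑ i : b.support, finiteFundamentalWeight b i

theorem finiteRho_coroot (i : b.support) : finiteRho b ((rootSystem H).coroot i) = 1 := by
  classical
  have h : ∀ j : b.support, finiteFundamentalWeight b j ((rootSystem H).coroot i) =
      if i = j then 1 else 0 := fun j => by
    rw [finiteFundamentalWeight, Module.Basis.coord_apply,
      RootPairing.Base.toCoweightBasis_repr_coroot, Finsupp.single_apply]
  simp only [finiteRho, LinearMap.sum_apply, h, Finset.sum_ite_eq, Finset.mem_univ, if_true]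

-- A simple reflection permutes the positive roots other than its own root. The sum of those is
-- therefore fixed and pairs to zero with `αᵢ^∨`, so the full sum pairs to `2` with every simple
-- coroot, as `2ρ` does.
open Classical in
theorem sum_pos_roots : ∑ α : H.root with b.IsPos α, (rootSystem H).root α = 2 • finiteRho b := by
  set σ := ∑ α : H.root with b.IsPos α, (rootSystem H).root α with hσ
  have key : ∀ i : b.support, σ ((rootSystem H).coroot i) = 2 := by
    intro i
    have h1 : σ = (rootSystem H).root i +
        ∑ α : H.root with b.IsPos α ∧ α ≠ i, (rootSystem H).root α := by
      rw [hσ, ← Finset.add_sum_erase _ _ (Finset.mem_filter.mpr ⟨Finset.mem_univ (i : H.root),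
        RootPairing.Base.isPos_of_mem_support i.2⟩)]
      congr 1
      refine Finset.sum_congr ?_ fun _ _ => rfl
      ext α
      simp [and_comm]
    set τ := ∑ α : H.root with b.IsPos α ∧ α ≠ i, (rootSystem H).root α with hτ
    have h2 : (rootSystem H).reflection i τ = τ := by
      conv_lhs => rw [hτ, map_sum]
      refine Finset.sum_bij (fun α _ => (rootSystem H).reflectionPerm i α) ?_ ?_ ?_ ?_
      · intro α hα
        simp only [Finset.mem_filter, Finset.mem_univ, true_and] at hα ⊢
        refine ⟨hα.1.reflectionPerm i.2 hα.2, fun h => ?_⟩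
        have h3 := hα.1.reflectionPerm i.2 hα.2
        have h4 : α = (rootSystem H).reflectionPerm i i :=
          ((rootSystem H).reflectionPerm_self i α).symm.trans
            (congrArg ((rootSystem H).reflectionPerm i) h)
        have h5 := hα.1
        rw [h4] at h5
        exact (RootPairing.Base.IsPos.neg_iff_not (b := b) (i : H.root)).mp h5
          (RootPairing.Base.isPos_of_mem_support i.2)
      · intro α _ β _ h
        exact ((rootSystem H).reflectionPerm i).injective h
      · intro α hα
        simp only [Finset.mem_filter, Finset.mem_univ, true_and] at hα
        refine ⟨(rootSystem H).reflectionPerm i α, ?_, RootPairing.reflectionPerm_self _ _ _⟩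
        simp only [Finset.mem_filter, Finset.mem_univ, true_and]
        refine ⟨hα.1.reflectionPerm i.2 hα.2, fun h => ?_⟩
        have h4 : α = (rootSystem H).reflectionPerm i i :=
          ((rootSystem H).reflectionPerm_self i α).symm.trans
            (congrArg ((rootSystem H).reflectionPerm i) h)
        have h5 := hα.1
        rw [h4] at h5
        exact (RootPairing.Base.IsPos.neg_iff_not (b := b) (i : H.root)).mp h5
          (RootPairing.Base.isPos_of_mem_support i.2)
      · intro α _
        rw [RootPairing.root_reflectionPerm]
    have h3 : τ ((rootSystem H).coroot i) = 0 := by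
      rw [RootPairing.reflection_apply, sub_eq_self, smul_eq_zero] at h2
      exact h2.resolve_right ((rootSystem H).ne_zero _)
    rw [h1, LinearMap.add_apply, h3, add_zero]
    exact (rootSystem H).root_coroot_two i
  refine LinearMap.ext_on_range b.toCoweightBasis.span_eq fun i => ?_
  rw [b.toCoweightBasis_apply, key]
  rw [LinearMap.smul_apply, finiteRho_coroot b i]
  simp

theorem dualCoxeter_eq : dualCoxeter θ b = 1 + finiteRho b ((rootSystem H).coroot θ) := by
  rw [dualCoxeter, finiteRho, LinearMap.sum_apply]

variable {b}

theorem IsNatComb.eq_sum {β : Module.Dual ℂ H} (h : IsNatComb b β) :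
    ∃ f : b.support → ℕ, β = ∑ i, (f i : ℂ) • (rootSystem H).root i := by
  choose f hf using h
  refine ⟨f, ?_⟩
  conv_lhs => rw [← b.toWeightBasis.sum_repr β]
  refine Finset.sum_congr rfl fun i _ => ?_
  rw [b.toWeightBasis_apply, ← hf, Module.Basis.coord_apply]

variable (θ) in
/-- The normalized form pairs a nonnegative combination of simple roots with a weight which is
nonnegative on the simple coroots to a nonnegative real number. -/
theorem normalizedDual_nonneg {β lam : Module.Dual ℂ H} (h : IsNatComb b β)
    (hl : ∀ i : b.support, ∃ r : ℝ, 0 ≤ r ∧ lam ((rootSystem H).coroot i) = r) :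
    ∃ r : ℝ, 0 ≤ r ∧ normalizedDual θ β lam = r := by
  obtain ⟨f, rfl⟩ := h.eq_sum
  choose r hr h using hl
  choose s hs h' using fun i : b.support => exists_normalizedDual_root θ (i : H.root)
  refine ⟨∑ i, f i * (s i * r i), Finset.sum_nonneg fun i _ =>
    mul_nonneg (Nat.cast_nonneg _) (mul_nonneg (hs i).le (hr i)), ?_⟩
  have hsum : normalizedDual θ (∑ i, (f i : ℂ) • (rootSystem H).root i) lam =
      ∑ i, (f i : ℂ) * normalizedDual θ ((rootSystem H).root i) lam := by
    simp only [normalizedDual]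
    rw [show killingDual (∑ i, (f i : ℂ) • (rootSystem H).root i) lam = ∑ i, (f i : ℂ) *
      killingDual ((rootSystem H).root i) lam from LinearMap.sum_apply _ _ _, Finset.mul_sum]
    exact Finset.sum_congr rfl fun i _ => by ring
  rw [hsum]
  push_cast
  refine Finset.sum_congr rfl fun i _ => ?_
  rw [normalizedDual_comm, h', h]

/-- By the normalization `(θ|θ) = 2`, `ρ(θ^∨) = (θ|ρ)`. This is nonnegative because `θ` is a
positive root, and `h^∨ = 1 + (θ|ρ)`. -/
theorem IsHighestRoot.exists_dualCoxeter (hθ : IsHighestRoot b θ) :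
    ∃ r : ℝ, 0 < r ∧ dualCoxeter θ b = r := by
  obtain ⟨r, hr, h⟩ := normalizedDual_nonneg θ (isNatComb_of_isPos hθ.isPos)
    (lam := finiteRho b) fun i => ⟨1, zero_le_one, by rw [finiteRho_coroot]; simp⟩
  refine ⟨1 + r, by positivity, ?_⟩
  rw [dualCoxeter_eq, ← normalizedDual_root, normalizedDual_comm, h]
  push_cast
  rfl

end RootSystem

end UntwistedAffine

namespace UntwistedAffine

open LieAlgebra LieAlgebra.IsKilling

/-! ### The Casimir tensor of the simple Lie algebra and its eigenvalues. -/

section Casimir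

variable {𝔤 : Type*} [LieRing 𝔤] [LieAlgebra ℂ 𝔤] [FiniteDimensional ℂ 𝔤] [LieAlgebra.IsSimple ℂ 𝔤]
  {H : LieSubalgebra ℂ 𝔤} [H.IsCartanSubalgebra] (θ : H.root)
  {M : Type*} [AddCommGroup M] [Module ℂ M]

/-! ### The Casimir tensor -/

theorem normalizedForm_comm (x y : 𝔤) : normalizedForm θ x y = normalizedForm θ y x :=
  (normalizedForm_isSymm θ).eq x y

theorem sum_normalizedForm_smul_dualBasisOf (x : 𝔤) :
    ∑ i, normalizedForm θ (basisOf 𝔤 i) x • dualBasisOf θ i = x := by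
  conv_rhs => rw [← (dualBasisOf θ).sum_repr x]
  refine Finset.sum_congr rfl fun i _ => ?_
  rw [dualBasisOf, LinearMap.BilinForm.dualBasis_repr_apply, normalizedForm_comm]

theorem sum_normalizedForm_smul_basisOf (x : 𝔤) :
    ∑ i, normalizedForm θ (dualBasisOf θ i) x • basisOf 𝔤 i = x := by
  conv_rhs => rw [← (basisOf 𝔤).sum_repr x]
  refine Finset.sum_congr rfl fun i _ => ?_
  congr 1
  conv_lhs => rw [← (basisOf 𝔤).sum_repr x]
  simp only [map_sum, map_smul, smul_eq_mul]
  classical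
  rw [Finset.sum_eq_single i]
  · rw [dualBasisOf, LinearMap.BilinForm.apply_dualBasis_left, if_pos rfl, mul_one]
  · intro j _ hj
    rw [dualBasisOf, LinearMap.BilinForm.apply_dualBasis_left, if_neg hj, mul_zero]
  · simp

/-- The Casimir tensor does not depend on the choice of dual families. -/
theorem sum_eq_sum_dualBasisOf (F : 𝔤 →ₗ[ℂ] 𝔤 →ₗ[ℂ] M) {ι : Type*} [Fintype ι] (a c : ι → 𝔤)
    (h : ∀ x, ∑ k, normalizedForm θ (a k) x • c k = x) :
    ∑ k, F (a k) (c k) = ∑ i, F (basisOf 𝔤 i) (dualBasisOf θ i) := by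
  calc ∑ k, F (a k) (c k)
      = ∑ k, ∑ i, normalizedForm θ (dualBasisOf θ i) (a k) • F (basisOf 𝔤 i) (c k) := by
        refine Finset.sum_congr rfl fun k _ => ?_
        conv_lhs => rw [← sum_normalizedForm_smul_basisOf θ (a k)]
        simp only [map_sum, map_smul, LinearMap.sum_apply, LinearMap.smul_apply]
    _ = ∑ i, F (basisOf 𝔤 i) (dualBasisOf θ i) := by
        rw [Finset.sum_comm]
        refine Finset.sum_congr rfl fun i _ => ?_
        conv_rhs => rw [← h (dualBasisOf θ i)]
        simp only [map_sum, map_smul, normalizedForm_comm θ (dualBasisOf θ i)]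

theorem sum_dualBasisOf_comm (F : 𝔤 →ₗ[ℂ] 𝔤 →ₗ[ℂ] M) :
    ∑ i, F (dualBasisOf θ i) (basisOf 𝔤 i) = ∑ i, F (basisOf 𝔤 i) (dualBasisOf θ i) :=
  sum_eq_sum_dualBasisOf θ F _ _ (sum_normalizedForm_smul_basisOf θ)

/-- The Casimir tensor is invariant. -/
theorem sum_lie_dualBasisOf (F : 𝔤 →ₗ[ℂ] 𝔤 →ₗ[ℂ] M) (x : 𝔤) :
    ∑ i, F ⁅basisOf 𝔤 i, x⁆ (dualBasisOf θ i) =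
      -∑ i, F (basisOf 𝔤 i) ⁅dualBasisOf θ i, x⁆ := by
  calc ∑ i, F ⁅basisOf 𝔤 i, x⁆ (dualBasisOf θ i)
      = ∑ i, ∑ j, normalizedForm θ (dualBasisOf θ j) ⁅basisOf 𝔤 i, x⁆ •
          F (basisOf 𝔤 j) (dualBasisOf θ i) := by
        refine Finset.sum_congr rfl fun i _ => ?_
        conv_lhs => rw [← sum_normalizedForm_smul_basisOf θ ⁅basisOf 𝔤 i, x⁆]
        simp only [map_sum, map_smul, LinearMap.sum_apply, LinearMap.smul_apply]
    _ = -∑ j, F (basisOf 𝔤 j) ⁅dualBasisOf θ j, x⁆ := by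
        rw [Finset.sum_comm, ← Finset.sum_neg_distrib]
        refine Finset.sum_congr rfl fun j _ => ?_
        conv_rhs => rw [← sum_normalizedForm_smul_dualBasisOf θ ⁅dualBasisOf θ j, x⁆]
        simp only [map_sum, map_smul, ← Finset.sum_neg_distrib, ← neg_smul]
        refine Finset.sum_congr rfl fun i _ => ?_
        congr 1
        rw [← lie_skew (basisOf 𝔤 i) x, map_neg, ← lie_skew (dualBasisOf θ j) x, map_neg,
          normalizedForm_comm θ (basisOf 𝔤 i), normalizedForm_invariant θ x, neg_neg]

/-! ### The Casimir operator on singular vectors -/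

theorem normalizedDual_eq (α β : Module.Dual ℂ H) : normalizedDual θ α β =
    2 / killingDual ((rootSystem H).root θ) ((rootSystem H).root θ) * killingDual α β := rfl

theorem normalizedForm_apply (x y : 𝔤) : normalizedForm θ x y =
    killingDual ((rootSystem H).root θ) ((rootSystem H).root θ) / 2 * killingForm ℂ 𝔤 x y := rfl

theorem normalizedForm_eq_zero_of_add_ne_zero {α β : H → ℂ} {x y : 𝔤}
    (hx : x ∈ rootSpace H α) (hy : y ∈ rootSpace H β) (h : α + β ≠ 0) : normalizedForm θ x y = 0 := by
  rw [normalizedForm_apply,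
    killingForm_apply_eq_zero_of_mem_rootSpace_of_add_ne_zero ℂ 𝔤 H hx hy h, mul_zero]

/-- The negative of a root. -/
def negRoot (α : H.root) : H.root :=
  ⟨-(α : LieModule.Weight ℂ H 𝔤), by
    have := H.isNonZero_coe_root α
    simpa [LieSubalgebra.root] using this⟩

theorem root_negRoot (α : H.root) :
    (rootSystem H).root (negRoot α) = -(rootSystem H).root α := rfl

theorem isPos_negRoot {b : (rootSystem H).Base} (α : H.root) :
    b.IsPos (negRoot α) ↔ ¬ b.IsPos α := by
  let := (rootSystem H).indexNeg
  rw [← RootPairing.Base.IsPos.neg_iff_not]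
  have : negRoot α = -α := (rootSystem H).root.injective <| (root_negRoot α).trans
    ((RootPairing.root_reflectionPerm _ _ _).trans (RootPairing.reflection_apply_self _ _)).symm
  rw [this]

theorem mem_rootSpace_zero {x : 𝔤} (hx : x ∈ rootSpace H (0 : H → ℂ)) : x ∈ H := by
  have h : x ∈ zeroRootSubalgebra ℂ 𝔤 H := hx
  rwa [zeroRootSubalgebra_eq_of_is_cartan] at h

theorem coe_mem_rootSpace_zero (h : H) : (h : 𝔤) ∈ rootSpace H (0 : H → ℂ) :=
  toLieSubmodule_le_rootSpace_zero ℂ 𝔤 H h.2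

/-- The root space decomposition as an induction principle. -/
theorem rootSpace_induction {p : 𝔤 → Prop} (hzero : p 0) (hadd : ∀ x y, p x → p y → p (x + y))
    (hcartan : ∀ h : H, p h)
    (hroot : ∀ α : H.root, ∀ e ∈ rootSpace H (α : LieModule.Weight ℂ H 𝔤), p e) (x : 𝔤) : p x := by
  have hx : x ∈ ⨆ χ : LieModule.Weight ℂ H 𝔤, LieModule.genWeightSpace 𝔤 χ := by
    rw [LieModule.iSup_genWeightSpace_eq_top']
    trivial
  induction hx using LieSubmodule.iSup_induction' with
  | zero => exact hzero
  | add x y _ _ hx hy => exact hadd x y hx hy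
  | mem χ x hx =>
    by_cases h : χ.IsZero
    · rw [show (χ : H → ℂ) = 0 from h] at hx
      exact hcartan ⟨x, mem_rootSpace_zero hx⟩
    · exact hroot ⟨χ, by simpa [LieSubalgebra.root] using h⟩ x hx

theorem exists_smul_eq_of_mem_rootSpace (α : H.root) {e x : 𝔤}
    (he : e ∈ rootSpace H (α : LieModule.Weight ℂ H 𝔤))
    (hx : x ∈ rootSpace H (α : LieModule.Weight ℂ H 𝔤)) (h0 : e ≠ 0) : ∃ s : ℂ, s • e = x := by
  have h := finrank_rootSpace_eq_one _ (H.isNonZero_coe_root α)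
  obtain ⟨s, hs⟩ := (finrank_eq_one_iff_of_nonzero' (⟨e, he⟩ : rootSpace H
    (α : LieModule.Weight ℂ H 𝔤)) (fun h => h0 (congrArg Subtype.val h))).mp h ⟨x, hx⟩
  exact ⟨s, congrArg Subtype.val hs⟩

/-- Invariance makes `[e, f]` equal to `(e|f)` times the vector of the Cartan subalgebra
representing `α`. Rescaling `f` makes `(e|f) = 1`. -/
theorem exists_dual_root_vectors (α : H.root) : ∃ e f : 𝔤, e ∈ rootSpace H (α : LieModule.Weight ℂ H 𝔤) ∧
    f ∈ rootSpace H (-(α : LieModule.Weight ℂ H 𝔤)) ∧ normalizedForm θ e f = 1 ∧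
    ∀ lam : Module.Dual ℂ H, ∃ h : H, (h : 𝔤) = ⁅e, f⁆ ∧
      lam h = normalizedDual θ lam ((rootSystem H).root α) := by
  obtain ⟨e, heα, he₀⟩ := (α : LieModule.Weight ℂ H 𝔤).exists_ne_zero
  obtain ⟨f', hfα, hf⟩ : ∃ f ∈ rootSpace H (-(α : LieModule.Weight ℂ H 𝔤)),
      killingForm ℂ 𝔤 e f ≠ 0 := by
    contrapose! he₀
    simpa using mem_ker_killingForm_of_mem_rootSpace_of_forall_rootSpace_neg ℂ 𝔤 H heα he₀
  have hc := killingDual_ne_zero θ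
  have hn : normalizedForm θ e f' ≠ 0 := by
    rw [normalizedForm_apply]
    exact mul_ne_zero (div_ne_zero hc two_ne_zero) hf
  refine ⟨e, (normalizedForm θ e f')⁻¹ • f', heα, Submodule.smul_mem _ _ hfα, ?_, fun lam => ?_⟩
  · rw [map_smul, smul_eq_mul, inv_mul_cancel₀ hn]
  · refine ⟨((normalizedForm θ e f')⁻¹ * killingForm ℂ 𝔤 e f') •
      (cartanEquivDual H).symm (α : LieModule.Weight ℂ H 𝔤).toLinear, ?_, ?_⟩
    · rw [lie_smul, lie_eq_killingForm_smul_of_mem_rootSpace_of_mem_rootSpace_neg heα hfα]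
      simp [mul_smul]
    · rw [map_smul, normalizedDual_eq, normalizedForm_apply, smul_eq_mul]
      refine congrArg (· * _) ?_
      field_simp

theorem exists_cartan_dual_bases : ∃ (n : ℕ) (a c : Fin n → H),
    (∀ x : H, ∑ k, normalizedForm θ (a k) x • c k = x) ∧
    ∀ lam mu : Module.Dual ℂ H, ∑ k, lam (a k) * mu (c k) = normalizedDual θ lam mu := by
  have hc := killingDual_ne_zero θ
  set q := killingDual ((rootSystem H).root θ) ((rootSystem H).root θ) with hq
  have hnd := LieAlgebra.IsKilling.traceForm_cartan_nondegenerate ℂ 𝔤 H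
  let u := Module.finBasis ℂ H
  let w := (LieModule.traceForm ℂ H 𝔤).dualBasis hnd u
  have h1 : ∀ x : H, ∑ k, LieModule.traceForm ℂ H 𝔤 (u k) x • w k = x := fun x => by
    conv_rhs => rw [← w.sum_repr x]
    refine Finset.sum_congr rfl fun i _ => ?_
    rw [LinearMap.BilinForm.dualBasis_repr_apply, LieModule.traceForm_comm]
  have h2 : ∀ x y : H, normalizedForm θ (x : 𝔤) (y : 𝔤) =
      q / 2 * LieModule.traceForm ℂ H 𝔤 x y := fun x y => by
    rw [normalizedForm_apply]
    rfl
  refine ⟨_, u, fun k => (2 / q) • w k, fun x => ?_, fun lam mu => ?_⟩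
  · conv_rhs => rw [← h1 x]
    refine Finset.sum_congr rfl fun k _ => ?_
    rw [h2, smul_smul]
    congr 1
    field_simp
  · have h3 := congrArg mu (h1 ((cartanEquivDual H).symm lam))
    rw [map_sum] at h3
    rw [normalizedDual_comm, normalizedDual_eq, ← hq,
      show killingDual mu lam = mu ((cartanEquivDual H).symm lam) from rfl, ← h3, Finset.mul_sum]
    refine Finset.sum_congr rfl fun k _ => ?_
    rw [map_smul, map_smul, LieModule.traceForm_comm, traceForm_cartanEquivDual_symm]
    simp only [smul_eq_mul]
    ring

variable {θ} (b : (rootSystem H).Base)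

open Classical in
/-- The Casimir operator acts on a singular vector of weight `lam` by `(lam | lam + 2 ρ)`. -/
theorem casimir_singular (φ : 𝔤 →ₗ[ℂ] Module.End ℂ M)
    (hφ : ∀ x y v, φ ⁅x, y⁆ v = φ x (φ y v) - φ y (φ x v)) (lam : Module.Dual ℂ H) (v : M)
    (hv : ∀ h : H, φ h v = lam h • v)
    (hpos : ∀ α : H.root, b.IsPos α → ∀ e ∈ rootSpace H (α : LieModule.Weight ℂ H 𝔤), φ e v = 0) :
    ∑ i, φ (basisOf 𝔤 i) (φ (dualBasisOf θ i) v) =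
      normalizedDual θ lam (lam + 2 • finiteRho b) • v := by
  let F : 𝔤 →ₗ[ℂ] 𝔤 →ₗ[ℂ] M :=
    LinearMap.mk₂ ℂ (fun x y => φ x (φ y v)) (by simp) (by simp) (by simp) (by simp)
  choose e f he hf hef hlam using exists_dual_root_vectors θ
  obtain ⟨n, a, c, hac, hac'⟩ := exists_cartan_dual_bases θ
  -- Root vectors `(e α, f α)` together with dual bases of the Cartan subalgebra are dual families
  -- for the form, so the Casimir operator may be evaluated in them.
  have hexp : ∀ x : 𝔤, ∑ k : H.root ⊕ Fin n,
      normalizedForm θ (Sum.elim e (fun i => (a i : 𝔤)) k) x •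
        Sum.elim f (fun i => (c i : 𝔤)) k = x := by
    have hneg : ∀ α : H.root, f α ∈ rootSpace H (negRoot α : LieModule.Weight ℂ H 𝔤) := hf
    refine fun x => rootSpace_induction (H := H) (p := fun x => ∑ k : H.root ⊕ Fin n,
      normalizedForm θ (Sum.elim e (fun i => (a i : 𝔤)) k) x •
        Sum.elim f (fun i => (c i : 𝔤)) k = x) ?_ ?_ ?_ ?_ x
    · simp
    · intro x y hx hy
      simp only [map_add, add_smul, Finset.sum_add_distrib, hx, hy]
    · intro h
      have h2 : ∀ α, normalizedForm θ (e α) h = 0 := fun α =>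
        normalizedForm_eq_zero_of_add_ne_zero θ (he α) (coe_mem_rootSpace_zero h)
          (by rw [add_zero]; exact H.isNonZero_coe_root α)
      have h3 := congrArg (fun y : H => (y : 𝔤)) (hac h)
      simp only [Fintype.sum_sum_type, Sum.elim_inl, Sum.elim_inr, h2, zero_smul,
        Finset.sum_const_zero, zero_add]
      simpa using h3
    · intro α x hx
      have h2 : ∀ i, normalizedForm θ (a i : 𝔤) x = 0 := fun i =>
        normalizedForm_eq_zero_of_add_ne_zero θ (coe_mem_rootSpace_zero (a i)) hx
          (by rw [zero_add]; exact H.isNonZero_coe_root α)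
      simp only [Fintype.sum_sum_type, Sum.elim_inl, Sum.elim_inr, h2, zero_smul,
        Finset.sum_const_zero, add_zero]
      have h5 : negRoot (negRoot α) = α := Subtype.ext (neg_neg _)
      have h3 : f (negRoot α) ∈ rootSpace H (α : LieModule.Weight ℂ H 𝔤) := by
        have := hneg (negRoot α)
        rwa [h5] at this
      have h4 : f (negRoot α) ≠ 0 := fun h => by
        have := hef (negRoot α)
        rw [h, map_zero] at this
        exact zero_ne_one this
      obtain ⟨s, rfl⟩ := exists_smul_eq_of_mem_rootSpace α h3 hx h4
      rw [Finset.sum_eq_single (negRoot α)]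
      · rw [map_smul, hef, smul_eq_mul, mul_one]
      · intro β _ hβ
        rw [normalizedForm_eq_zero_of_add_ne_zero θ (he β) hx, zero_smul]
        intro h
        apply hβ
        rw [← h5]
        refine Subtype.ext (LieModule.Weight.ext fun h' => ?_)
        rw [h5]
        exact eq_neg_of_add_eq_zero_left (congrFun h h')
      · simp
  have h1 := sum_eq_sum_dualBasisOf θ F _ _ hexp
  have h2 : ∑ i, F (basisOf 𝔤 i) (dualBasisOf θ i) =
    ∑ i, φ (basisOf 𝔤 i) (φ (dualBasisOf θ i) v) := rfl
  rw [← h2, ← h1, Fintype.sum_sum_type]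
  have h3 : ∀ i, F (a i) (c i) = (lam (a i) * lam (c i)) • v := fun i => by
    change φ (a i) (φ (c i) v) = _
    rw [hv, map_smul, hv, smul_smul, mul_comm]
  -- For positive `α`, `e α` kills `v`, so `e f v = [e, f] v` contributes `(lam|α)`. For negative
  -- `α`, `f α` is a positive root vector and kills `v`. Summing gives `(lam|2ρ)`.
  have h4 : ∀ α, F (e α) (f α) =
      (if b.IsPos α then normalizedDual θ lam ((rootSystem H).root α) else 0) • v := fun α => by
    change φ (e α) (φ (f α) v) = _
    split_ifs with h
    · obtain ⟨k, hk, hk'⟩ := hlam α lam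
      rw [← hk', ← hv, hk, hφ, hpos α h _ (he α), map_zero, sub_zero]
    · rw [hpos (negRoot α) ((isPos_negRoot α).mpr h) _ (hf α), map_zero, zero_smul]
  simp only [Sum.elim_inl, Sum.elim_inr, h3, h4, ← Finset.sum_smul, hac', ← add_smul]
  congr 1
  rw [normalizedDual_comm θ lam (_ + _), normalizedDual_add_left, normalizedDual_comm θ _ lam,
    add_comm, ← sum_pos_roots, Finset.sum_filter, normalizedDual_comm θ _ lam]
  congr 1
  rw [normalizedDual_comm, normalizedDual_eq,
    show ∀ β, killingDual lam β = lam ((cartanEquivDual H).symm β) from fun _ => rfl,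
    map_sum, map_sum, Finset.mul_sum]
  refine Finset.sum_congr rfl fun α _ => ?_
  split_ifs
  · rfl
  · simp

variable {b}

/-- A highest root vector is singular for the adjoint action, with eigenvalue `(θ|θ+2ρ) = 2h^∨`. The
eigenspace is an ideal by invariance of the Casimir tensor, and simplicity makes it everything. -/
theorem IsHighestRoot.casimir_adjoint (hθ : IsHighestRoot b θ) (x : 𝔤) :
    ∑ i, ⁅basisOf 𝔤 i, ⁅dualBasisOf θ i, x⁆⁆ = (2 * dualCoxeter θ b) • x := by
  obtain ⟨e, he, he0⟩ := (θ : LieModule.Weight ℂ H 𝔤).exists_ne_zero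
  have h1 := casimir_singular (θ := θ) b (LieAlgebra.ad ℂ 𝔤 : 𝔤 →ₗ[ℂ] Module.End ℂ 𝔤)
    (fun x y v => by simp) ((rootSystem H).root θ) e
    (fun h => by simpa using lie_eq_smul_of_mem_rootSpace he h) (fun α hα x hx => by
      -- A nonzero bracket would make `α + θ` a weight. It is nonzero, since `α` and `θ` are both
      -- positive, so it is a root, and `θ - (α + θ) = -α` contradicts maximality of `θ`.
      by_contra hne
      have hmem : ⁅x, e⁆ ∈ rootSpace H ((α : H → ℂ) + (θ : H → ℂ)) :=
        lie_mem_genWeightSpace_of_mem_genWeightSpace hx he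
      have hbot : rootSpace H ((α : H → ℂ) + (θ : H → ℂ)) ≠ ⊥ := fun h => by
        rw [h] at hmem
        exact hne hmem
      have hα' := isNatComb_of_isPos hα
      have hθ' := isNatComb_of_isPos hθ.isPos
      let χ : LieModule.Weight ℂ H 𝔤 := ⟨_, hbot⟩
      have hχ : χ.toLinear = (rootSystem H).root α + (rootSystem H).root θ := rfl
      have hχ0 : ¬ χ.IsZero := fun h => by
        have h2 : (rootSystem H).root α + (rootSystem H).root θ = 0 := by
          rw [← hχ]
          exact LinearMap.ext fun y => congrFun h y
        rw [add_eq_zero_iff_neg_eq] at h2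
        exact (rootSystem H).ne_zero α (hα'.eq_zero (h2 ▸ hθ'))
      have h3 := hθ.isNatComb ⟨χ, by simpa [LieSubalgebra.root] using hχ0⟩
      have h4 : (rootSystem H).root θ - ((rootSystem H).root α + (rootSystem H).root θ) =
        -(rootSystem H).root α := by abel
      rw [show (rootSystem H).root ⟨χ, _⟩ = _ from hχ, h4] at h3
      exact (rootSystem H).ne_zero α (hα'.eq_zero h3))
  have h2 : normalizedDual θ ((rootSystem H).root θ) ((rootSystem H).root θ + 2 • finiteRho b) =
      2 * dualCoxeter θ b := by
    rw [normalizedDual_comm, normalizedDual_root, dualCoxeter_eq, LinearMap.add_apply,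
      LinearMap.smul_apply, show (rootSystem H).root θ ((rootSystem H).coroot θ) = 2 from
        (rootSystem H).root_coroot_two θ, nsmul_eq_mul]
    push_cast
    ring
  rw [h2] at h1
  let I : LieIdeal ℂ 𝔤 :=
    { carrier := {x | ∑ i, ⁅basisOf 𝔤 i, ⁅dualBasisOf θ i, x⁆⁆ = (2 * dualCoxeter θ b) • x}
      add_mem' := fun {x y} hx hy => by
        simp only [Set.mem_ofPred_eq, lie_add, smul_add, Finset.sum_add_distrib] at hx hy ⊢
        rw [hx, hy]
      zero_mem' := by simp
      smul_mem' := fun r x hx => by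
        simp only [Set.mem_ofPred_eq, lie_smul, ← Finset.smul_sum] at hx ⊢
        rw [hx, smul_comm]
      lie_mem := fun {y x} hx => by
        simp only [Set.mem_ofPred_eq] at hx ⊢
        let F : 𝔤 →ₗ[ℂ] 𝔤 →ₗ[ℂ] 𝔤 :=
          LinearMap.mk₂ ℂ (fun u w => ⁅u, ⁅w, x⁆⁆) (by simp) (by simp) (by simp) (by simp)
        have h3 : ∑ i, ⁅⁅basisOf 𝔤 i, y⁆, ⁅dualBasisOf θ i, x⁆⁆ =
          -∑ i, ⁅basisOf 𝔤 i, ⁅⁅dualBasisOf θ i, y⁆, x⁆⁆ := sum_lie_dualBasisOf θ F y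
        rw [← lie_smul, ← hx, lie_sum, ← sub_eq_zero, ← Finset.sum_sub_distrib]
        rw [eq_neg_iff_add_eq_zero, ← Finset.sum_add_distrib] at h3
        rw [← h3]
        refine Finset.sum_congr rfl fun i _ => ?_
        rw [leibniz_lie (dualBasisOf θ i) y x, lie_add, leibniz_lie (basisOf 𝔤 i) y]
        abel }
  have hI : I = ⊤ := (LieAlgebra.IsSimple.eq_bot_or_eq_top I).resolve_left fun h => by
    have : e ∈ I := h1
    rw [h] at this
    exact he0 this
  have : x ∈ I := by rw [hI]; trivial
  exact this

end Casimir

end UntwistedAffine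

/-! ### Sugawara and coset operators for abstract smooth representations. -/

namespace UntwistedAffine

open LieAlgebra LieAlgebra.IsKilling

/-! ### Locally finite sums of operators -/

section LocallyFinite

variable {M : Type*} [AddCommGroup M] [Module ℂ M]

/-- At each vector only finitely many terms of the sequence of operators are nonzero. -/
def LocallyFiniteSeq (T : ℕ → Module.End ℂ M) : Prop := ∀ v, ∃ N, ∀ j, N ≤ j → T j v = 0

theorem LocallyFiniteSeq.exists_finsum_eq {T : ℕ → Module.End ℂ M} (hT : LocallyFiniteSeq T)
    (v : M) : ∃ N, ∀ n, N ≤ n → ∑ᶠ j, T j v = ∑ j ∈ Finset.range n, T j v := by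
  obtain ⟨N, hN⟩ := hT v
  refine ⟨N, fun n hn => finsum_eq_sum_of_support_subset _ fun j hj => ?_⟩
  simp only [Finset.coe_range, Set.mem_Iio]
  by_contra h
  exact hj (hN j (by omega))

theorem LocallyFiniteSeq.finite_support {T : ℕ → Module.End ℂ M} (hT : LocallyFiniteSeq T)
    (v : M) : (Function.support fun j => T j v).Finite := by
  obtain ⟨N, hN⟩ := hT v
  refine (Set.finite_Iio N).subset fun j hj => ?_
  by_contra h
  exact hj (hN j (not_lt.mp h))

/-- The sum of a locally finite sequence of operators. -/
def locallyFiniteSum (T : ℕ → Module.End ℂ M) (hT : LocallyFiniteSeq T) : Module.End ℂ M where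
  toFun v := ∑ᶠ j, T j v
  map_add' v w := by
    simp only [map_add]
    exact finsum_add_distrib (hT.finite_support v) (hT.finite_support w)
  map_smul' r v := by
    simp only [map_smul, RingHom.id_apply]
    exact (smul_finsum' r (hT.finite_support v)).symm

theorem exists_locallyFiniteSum_eq (T : ℕ → Module.End ℂ M) (hT : LocallyFiniteSeq T) (v : M) :
    ∃ N, ∀ n, N ≤ n → locallyFiniteSum T hT v = ∑ j ∈ Finset.range n, T j v :=
  hT.exists_finsum_eq v

end LocallyFinite

/-! ### Smooth representations of the current algebra -/

section Current

variable {𝔤 : Type*} [LieRing 𝔤] [LieAlgebra ℂ 𝔤] [FiniteDimensional ℂ 𝔤] [LieAlgebra.IsSimple ℂ 𝔤]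
  {H : LieSubalgebra ℂ 𝔤} [H.IsCartanSubalgebra]

/-- A projective representation of the loop algebra of the given level in which every vector is
killed by the modes of large degree. -/
structure SmoothRep (θ : H.root) (M : Type*) [AddCommGroup M] [Module ℂ M] where
  /-- The modes. -/
  mode : ℤ → 𝔤 →ₗ[ℂ] Module.End ℂ M
  /-- The level. -/
  level : ℂ
  mode_mode : ∀ a c x y v, mode a x (mode c y v) = mode c y (mode a x v) + mode (a + c) ⁅x, y⁆ v +
    (if a + c = 0 then a * level * normalizedForm θ x y else 0) • v
  smooth : ∀ v, ∃ N : ℕ, ∀ j : ℤ, N ≤ j → ∀ x, mode j x v = 0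

namespace SmoothRep

variable {θ : H.root} {M : Type*} [AddCommGroup M] [Module ℂ M] (R : SmoothRep θ M)

/-- The composition of two modes, contracted with the Casimir tensor. -/
def pair (a c : ℤ) : Module.End ℂ M :=
  ∑ i, R.mode a (basisOf 𝔤 i) ∘ₗ R.mode c (dualBasisOf θ i)

theorem pair_apply (a c : ℤ) (v : M) :
    R.pair a c v = ∑ i, R.mode a (basisOf 𝔤 i) (R.mode c (dualBasisOf θ i) v) := by
  simp [pair]

theorem locallyFiniteSeq_pair (p q : ℤ) :
    LocallyFiniteSeq fun j : ℕ => R.pair (p - j) (q + j) := fun v => by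
  obtain ⟨N, hN⟩ := R.smooth v
  refine ⟨(N - q).toNat, fun j hj => ?_⟩
  rw [pair_apply]
  refine Finset.sum_eq_zero fun i _ => ?_
  rw [hN _ (by omega), map_zero]

/-- The operator `∑_{j ≥ 0} ∑ᵢ (t^{p-j} uᵢ) (t^{p+1+j} uⁱ)`. -/
def modeSum (p : ℤ) : Module.End ℂ M :=
  locallyFiniteSum (fun j : ℕ => R.pair (p - j) (p + 1 + j)) (R.locallyFiniteSeq_pair p (p + 1))

theorem exists_modeSum_eq (p : ℤ) (v : M) : ∃ N, ∀ n, N ≤ n → R.modeSum p v =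
    ∑ j ∈ Finset.range n, R.pair (p - j) (p + 1 + j) v :=
  exists_locallyFiniteSum_eq _ _ v

/-- An operator which acts on the modes as a multiple of the degree acts likewise on `modeSum`. -/
theorem map_modeSum {X : Module.End ℂ M} {c : ℂ}
    (hX : ∀ k x v, X (R.mode k x v) = R.mode k x (X v) + (c * k) • R.mode k x v) (p : ℤ) (v : M) :
    X (R.modeSum p v) = R.modeSum p (X v) + (c * (2 * p + 1)) • R.modeSum p v := by
  obtain ⟨N, hN⟩ := R.exists_modeSum_eq p v
  obtain ⟨N', hN'⟩ := R.exists_modeSum_eq p (X v)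
  rw [hN _ (le_max_left N N'), hN' _ (le_max_right N N'), map_sum, Finset.smul_sum,
    ← Finset.sum_add_distrib]
  refine Finset.sum_congr rfl fun j _ => ?_
  simp only [pair_apply, map_sum, Finset.smul_sum, ← Finset.sum_add_distrib]
  refine Finset.sum_congr rfl fun i _ => ?_
  rw [hX, hX, map_add, map_smul, add_assoc, ← add_smul]
  congr 2
  push_cast
  ring

theorem map_modeSum_of_commute {X : Module.End ℂ M}
    (hX : ∀ k x v, X (R.mode k x v) = R.mode k x (X v)) (p : ℤ) (v : M) :
    X (R.modeSum p v) = R.modeSum p (X v) := by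
  have h := R.map_modeSum (X := X) (c := 0) (fun k x v => by rw [hX]; simp) p v
  simpa using h

theorem map_mode_modeSum (p k : ℤ) (x : 𝔤) (v : M) : ∃ N, ∀ n, N ≤ n →
    R.modeSum p (R.mode k x v) - R.mode k x (R.modeSum p v) =
      ∑ j ∈ Finset.range n,
        (R.pair (p - j) (p + 1 + j) (R.mode k x v) - R.mode k x (R.pair (p - j) (p + 1 + j) v)) := by
  obtain ⟨N, hN⟩ := R.exists_modeSum_eq p v
  obtain ⟨N', hN'⟩ := R.exists_modeSum_eq p (R.mode k x v)
  refine ⟨max N N', fun n hn => ?_⟩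
  rw [hN _ ((le_max_left _ _).trans hn), hN' _ ((le_max_right _ _).trans hn), map_sum,
    Finset.sum_sub_distrib]

/-- The contraction which occurs in the commutator of `pair` with a mode. -/
def twisted (x : 𝔤) (v : M) (a c : ℤ) : M :=
  ∑ i, R.mode a (basisOf 𝔤 i) (R.mode c ⁅dualBasisOf θ i, x⁆ v)

/-- The bilinear map `(y, z) ↦ (tᵃ y) (tᶜ z) v`. -/
def bilin (a c : ℤ) (v : M) : 𝔤 →ₗ[ℂ] 𝔤 →ₗ[ℂ] M :=
  LinearMap.mk₂ ℂ (fun y z => R.mode a y (R.mode c z v)) (by simp) (by simp) (by simp) (by simp)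

/-- Invariance of the Casimir tensor moves the bracket with `x` onto the second factor in both
terms. The noncentral part becomes a difference of one contraction at two pairs of indices, prepared
for telescoping. -/
theorem pair_mode_sub (a c k : ℤ) (x : 𝔤) (v : M) :
    R.pair a c (R.mode k x v) - R.mode k x (R.pair a c v) =
      R.twisted x v a (c + k) - R.twisted x v (a + k) c +
        ((if a + k = 0 then a * R.level else 0) • R.mode c x v +
          (if c + k = 0 then c * R.level else 0) • R.mode a x v) := by
  have h1 : ∀ i, R.mode a (basisOf 𝔤 i) (R.mode c (dualBasisOf θ i) (R.mode k x v)) -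
      R.mode k x (R.mode a (basisOf 𝔤 i) (R.mode c (dualBasisOf θ i) v)) =
      R.mode a (basisOf 𝔤 i) (R.mode (c + k) ⁅dualBasisOf θ i, x⁆ v) +
      R.mode (a + k) ⁅basisOf 𝔤 i, x⁆ (R.mode c (dualBasisOf θ i) v) +
      ((if a + k = 0 then a * R.level else 0) •
        R.mode c (normalizedForm θ (basisOf 𝔤 i) x • dualBasisOf θ i) v +
        (if c + k = 0 then c * R.level else 0) •
          R.mode a (normalizedForm θ (dualBasisOf θ i) x • basisOf 𝔤 i) v) := fun i => by
    rw [R.mode_mode c k, map_add, map_add, R.mode_mode a k]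
    simp only [map_smul, LinearMap.smul_apply, smul_smul, ite_mul, zero_mul]
    abel
  have h2 : ∑ i, R.mode (a + k) ⁅basisOf 𝔤 i, x⁆ (R.mode c (dualBasisOf θ i) v) =
      -R.twisted x v (a + k) c := sum_lie_dualBasisOf θ (R.bilin (a + k) c v) x
  rw [pair_apply, pair_apply, map_sum, ← Finset.sum_sub_distrib]
  simp only [h1, Finset.sum_add_distrib, ← Finset.smul_sum, h2, ← LinearMap.sum_apply, ← map_sum,
    sum_normalizedForm_smul_dualBasisOf, sum_normalizedForm_smul_basisOf]
  rw [sub_eq_add_neg]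
  rfl

/-- As `j` runs over the naturals, the indices `p - j` and `p + 1 + j` together cover every integer
exactly once. Precisely one term therefore has mode index `-k`. -/
theorem exists_sum_central (p k : ℤ) (z : ℂ) : ∃ N, ∀ n, N ≤ n → ∑ j ∈ Finset.range n,
    ((if p - j + k = 0 then ((p - j : ℤ) : ℂ) * z else 0) +
      (if p + 1 + j + k = 0 then ((p + 1 + j : ℤ) : ℂ) * z else 0)) = -(k * z) := by
  by_cases h : 0 ≤ p + k
  · refine ⟨(p + k).toNat + 1, fun n hn => ?_⟩
    rw [Finset.sum_eq_single (p + k).toNat]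
    · rw [if_pos (by omega), if_neg (by omega), add_zero, ← neg_mul]
      congr 1
      rw [show p - ((p + k).toNat : ℤ) = -k by omega]
      push_cast
      rfl
    · intro j _ hj
      rw [if_neg (by omega), if_neg (by omega), add_zero]
    · intro h'
      exact absurd (Finset.mem_range.mpr (by omega)) h'
  · refine ⟨(-p - 1 - k).toNat + 1, fun n hn => ?_⟩
    rw [Finset.sum_eq_single (-p - 1 - k).toNat]
    · rw [if_neg (by omega), if_pos (by omega), zero_add, ← neg_mul]
      congr 1
      rw [show p + 1 + ((-p - 1 - k).toNat : ℤ) = -k by omega]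
      push_cast
      rfl
    · intro j _ hj
      rw [if_neg (by omega), if_neg (by omega), add_zero]
    · intro h'
      exact absurd (Finset.mem_range.mpr (by omega)) h'

theorem exists_modeSum_mode_sub (p k : ℤ) (x : 𝔤) (v : M) : ∃ N, ∀ n, N ≤ n →
    R.modeSum p (R.mode k x v) - R.mode k x (R.modeSum p v) =
      ∑ j ∈ Finset.range n, (R.twisted x v (p - j) (p + 1 + j + k) -
        R.twisted x v (p - j + k) (p + 1 + j)) -
          (k * R.level) • R.mode (2 * p + 1 + k) x v := by
  obtain ⟨N, hN⟩ := R.map_mode_modeSum p k x v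
  obtain ⟨N', hN'⟩ := exists_sum_central p k R.level
  refine ⟨max N N', fun n hn => ?_⟩
  rw [hN _ ((le_max_left _ _).trans hn)]
  simp only [pair_mode_sub]
  rw [Finset.sum_add_distrib, sub_eq_add_neg, ← neg_smul, ← hN' _ ((le_max_right _ _).trans hn),
    Finset.sum_smul]
  congr 1
  refine Finset.sum_congr rfl fun j _ => ?_
  rw [add_smul]
  congr 1
  · split_ifs with h
    · rw [show 2 * p + 1 + k = p + 1 + j by omega]
    · simp
  · split_ifs with h
    · rw [show 2 * p + 1 + k = p - j by omega]
    · simp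

variable {b : (rootSystem H).Base}

/-- With equal indices, invariance and symmetry of the Casimir tensor exhibit the contraction as
half of a sum of commutators. That sum is the adjoint Casimir applied to `x`, namely `2h^∨ x`. A
central term could occur only for `a = 0`, where its coefficient `a` vanishes. -/
theorem twisted_self (hθ : IsHighestRoot b θ) (x : 𝔤) (v : M) (a : ℤ) :
    R.twisted x v a a = dualCoxeter θ b • R.mode (a + a) x v := by
  let F : 𝔤 →ₗ[ℂ] 𝔤 →ₗ[ℂ] M :=
    LinearMap.mk₂ ℂ (fun y z => R.mode a ⁅y, x⁆ (R.mode a z v)) (by simp) (by simp) (by simp)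
      (by simp)
  have h1 : R.twisted x v a a =
      -∑ i, R.mode a ⁅dualBasisOf θ i, x⁆ (R.mode a (basisOf 𝔤 i) v) := by
    have h := sum_lie_dualBasisOf θ (R.bilin a a v) x
    have h' : ∑ i, R.mode a ⁅dualBasisOf θ i, x⁆ (R.mode a (basisOf 𝔤 i) v) =
      ∑ i, R.mode a ⁅basisOf 𝔤 i, x⁆ (R.mode a (dualBasisOf θ i) v) := sum_dualBasisOf_comm θ F
    rw [h', twisted, eq_neg_iff_add_eq_zero, add_comm]
    exact eq_neg_iff_add_eq_zero.mp h
  have h2 : R.twisted x v a a + R.twisted x v a a =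
      (2 * dualCoxeter θ b) • R.mode (a + a) x v := by
    nth_rewrite 1 [h1]
    rw [neg_add_eq_sub, twisted, ← Finset.sum_sub_distrib, ← LinearMap.smul_apply, ← map_smul,
      ← hθ.casimir_adjoint, map_sum, LinearMap.sum_apply]
    refine Finset.sum_congr rfl fun i _ => ?_
    rw [R.mode_mode a a]
    have : (if a + a = 0 then (a : ℂ) * R.level *
        normalizedForm θ (basisOf 𝔤 i) ⁅dualBasisOf θ i, x⁆ else 0) = 0 := by
      split_ifs with h
      · rw [show a = 0 by omega]
        simp
      · rfl
    rw [this, zero_smul, add_zero, add_sub_cancel_left]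
  rw [mul_smul, ← two_smul ℂ] at h2
  exact smul_right_injective M (two_ne_zero (α := ℂ)) h2

theorem twisted_eq_zero {v : M} {N : ℕ} (hN : ∀ j : ℤ, N ≤ j → ∀ x, R.mode j x v = 0) (x : 𝔤)
    (a c : ℤ) (h : N ≤ c) : R.twisted x v a c = 0 :=
  Finset.sum_eq_zero fun i _ => by rw [hN c h, map_zero]

/-- For `k = ±1` the contractions telescope to one diagonal boundary term, which supplies `h^∨`; for
`k = 0` they cancel. All other `k` follow by commutators, because `𝔤` is spanned by brackets. The
central terms supply the level. -/
theorem modeSum_mode (hθ : IsHighestRoot b θ) (p k : ℤ) (x : 𝔤) (v : M) :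
    R.modeSum p (R.mode k x v) = R.mode k x (R.modeSum p v) -
      (k * (R.level + dualCoxeter θ b)) • R.mode (2 * p + 1 + k) x v := by
  obtain ⟨h, hh0, hh⟩ := hθ.exists_dualCoxeter
  have hh' : dualCoxeter θ b ≠ 0 := by
    rw [hh]
    exact_mod_cast hh0.ne'
  have hone : ∀ x v, R.modeSum p (R.mode 1 x v) = R.mode 1 x (R.modeSum p v) -
      ((1 : ℤ) * (R.level + dualCoxeter θ b)) • R.mode (2 * p + 1 + 1) x v := fun x v => by
    obtain ⟨N, hN⟩ := R.exists_modeSum_mode_sub p 1 x v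
    obtain ⟨N', hN'⟩ := R.smooth v
    have h1 := hN (max N (N' - p - 1).toNat) (le_max_left _ _)
    have h2 := Finset.sum_range_sub
      (fun j : ℕ => R.twisted x v (p + 1 - j) (p + 1 + j)) (max N (N' - p - 1).toNat)
    -- For `k = 1` the summand is a forward difference in `j`. The far end vanishes by smoothness
    -- and the near end is the contraction at `(p+1, p+1)`.
    have h3 : ∀ j : ℕ, R.twisted x v (p - j) (p + 1 + j + 1) - R.twisted x v (p - j + 1) (p + 1 + j)
        = R.twisted x v (p + 1 - (j + 1 : ℕ)) (p + 1 + (j + 1 : ℕ)) -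
          R.twisted x v (p + 1 - j) (p + 1 + j) := fun j => by
      congr 2 <;> push_cast <;> ring
    simp only [h3] at h1
    rw [h2, R.twisted_eq_zero hN' x _ _ (by omega), Nat.cast_zero, sub_zero, add_zero,
      R.twisted_self hθ, sub_eq_iff_eq_add] at h1
    rw [h1, show p + 1 + (p + 1) = 2 * p + 1 + 1 by ring]
    push_cast
    module
  have hneg : ∀ x v, R.modeSum p (R.mode (-1) x v) = R.mode (-1) x (R.modeSum p v) -
      ((-1 : ℤ) * (R.level + dualCoxeter θ b)) • R.mode (2 * p + 1 + -1) x v := fun x v => by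
    obtain ⟨N, hN⟩ := R.exists_modeSum_mode_sub p (-1) x v
    obtain ⟨N', hN'⟩ := R.smooth v
    have h1 := hN (max N (N' - p).toNat) (le_max_left _ _)
    have h2 := Finset.sum_range_sub'
      (fun j : ℕ => R.twisted x v (p - j) (p + j)) (max N (N' - p).toNat)
    have h3 : ∀ j : ℕ, R.twisted x v (p - j) (p + 1 + j + -1) -
        R.twisted x v (p - j + -1) (p + 1 + j) = R.twisted x v (p - j) (p + j) -
          R.twisted x v (p - (j + 1 : ℕ)) (p + (j + 1 : ℕ)) := fun j => by
      congr 2 <;> push_cast <;> ring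
    simp only [h3] at h1
    rw [h2, R.twisted_eq_zero hN' x _ (p + (max N (N' - p).toNat : ℕ)) (by omega), Nat.cast_zero,
      sub_zero, sub_zero, add_zero, R.twisted_self hθ, sub_eq_iff_eq_add] at h1
    rw [h1, show p + p = 2 * p + 1 + -1 by ring]
    push_cast
    module
  have hzero : ∀ x v, R.modeSum p (R.mode 0 x v) = R.mode 0 x (R.modeSum p v) -
      ((0 : ℤ) * (R.level + dualCoxeter θ b)) • R.mode (2 * p + 1 + 0) x v := fun x v => by
    obtain ⟨N, hN⟩ := R.exists_modeSum_mode_sub p 0 x v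
    have h1 := hN N le_rfl
    simp only [add_zero, sub_self, Finset.sum_const_zero] at h1
    rw [sub_eq_iff_eq_add] at h1
    rw [h1]
    simp
  -- Away from `k + l = 0`, `[tᵏ y, tˡ z]` is `tᵏ⁺ˡ [y, z]` without central term, so the relation
  -- propagates from `k` and `l` to `k + l`.
  have hstep : ∀ k l : ℤ, k + l ≠ 0 →
      (∀ x v, R.modeSum p (R.mode k x v) = R.mode k x (R.modeSum p v) -
        (k * (R.level + dualCoxeter θ b)) • R.mode (2 * p + 1 + k) x v) →
      (∀ x v, R.modeSum p (R.mode l x v) = R.mode l x (R.modeSum p v) -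
        (l * (R.level + dualCoxeter θ b)) • R.mode (2 * p + 1 + l) x v) →
      ∀ x v, R.modeSum p (R.mode (k + l) x v) = R.mode (k + l) x (R.modeSum p v) -
        (((k + l : ℤ) : ℂ) * (R.level + dualCoxeter θ b)) • R.mode (2 * p + 1 + (k + l)) x v := by
    intro k l hkl hk hl x v
    have hb : ∀ y z : 𝔤, R.modeSum p (R.mode (k + l) ⁅y, z⁆ v) =
        R.mode (k + l) ⁅y, z⁆ (R.modeSum p v) -
        (((k + l : ℤ) : ℂ) * (R.level + dualCoxeter θ b)) •
          R.mode (2 * p + 1 + (k + l)) ⁅y, z⁆ v := fun y z => by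
      have e1 : ∀ w, R.mode (k + l) ⁅y, z⁆ w =
          R.mode k y (R.mode l z w) - R.mode l z (R.mode k y w) := fun w => by
        rw [R.mode_mode k l, if_neg hkl]
        simp
      have e2 := R.mode_mode k (2 * p + 1 + l) y z v
      have e3 := R.mode_mode (2 * p + 1 + k) l y z v
      rw [show k + (2 * p + 1 + l) = 2 * p + 1 + (k + l) by ring] at e2
      rw [show 2 * p + 1 + k + l = 2 * p + 1 + (k + l) by ring] at e3
      rw [e1, e1, map_sub, hk, hl, hl, hk]
      simp only [map_sub, map_smul]
      rw [e2, e3]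
      -- Central terms now appear in both brackets, with total coefficient proportional to `l k + k
      -- (2p + 1 + k)`. This vanishes because `2p + 1 + k = -l`.
      by_cases h0 : 2 * p + 1 + (k + l) = 0
      · have h0' : (2 * p + 1 : ℂ) = -(k + l) := by
          have : ((2 * p + 1 + (k + l) : ℤ) : ℂ) = 0 := by rw [h0]; simp
          push_cast at this
          linear_combination this
        simp only [if_pos h0]
        push_cast
        rw [h0']
        module
      · simp only [if_neg h0]
        push_cast
        module
    -- The adjoint Casimir is the nonzero scalar `2h^∨`, which writes `x` explicitly as a sum of
    -- brackets.
    have hx : x = ∑ i, ⁅basisOf 𝔤 i, (2 * dualCoxeter θ b)⁻¹ • ⁅dualBasisOf θ i, x⁆⁆ := by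
      simp only [lie_smul, ← Finset.smul_sum]
      rw [hθ.casimir_adjoint, smul_smul, inv_mul_cancel₀ (mul_ne_zero two_ne_zero hh'), one_smul]
    rw [hx]
    simp only [map_sum, LinearMap.sum_apply, hb, Finset.sum_sub_distrib, Finset.smul_sum]
  have hpos : ∀ (n : ℕ) x v, R.modeSum p (R.mode n x v) = R.mode n x (R.modeSum p v) -
      (((n : ℤ) : ℂ) * (R.level + dualCoxeter θ b)) • R.mode (2 * p + 1 + n) x v := by
    intro n
    induction n with
    | zero => exact hzero
    | succ n ih => exact_mod_cast hstep n 1 (by omega) ih hone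
  have hnegn : ∀ (n : ℕ) x v, R.modeSum p (R.mode (-n) x v) = R.mode (-n) x (R.modeSum p v) -
      (((-n : ℤ) : ℂ) * (R.level + dualCoxeter θ b)) • R.mode (2 * p + 1 + -n) x v := by
    intro n
    induction n with
    | zero => simpa using hzero
    | succ n ih =>
      have := hstep (-n) (-1) (by omega) ih hneg
      rwa [show -(n : ℤ) + -1 = -((n + 1 : ℕ) : ℤ) by push_cast; ring] at this
  obtain ⟨n, rfl | rfl⟩ := Int.eq_nat_or_neg k
  · exact hpos n x v
  · exact hnegn n x v

/-- The operator `∑ᵢ uᵢ uⁱ + 2 ∑_{j > 0} ∑ᵢ (t⁻ʲ uᵢ) (tʲ uⁱ)`. -/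
def casimirSum : Module.End ℂ M :=
  R.pair 0 0 + (2 : ℂ) • locallyFiniteSum (fun j : ℕ => R.pair (-1 - j) (1 + j))
    (R.locallyFiniteSeq_pair (-1) 1)

/-- Only the commutation of `A` with the modes matters, not its construction. So the formula can be
applied later to an `A` that is not the Sugawara `L₁` of this representation. -/
theorem commutator_modeSum_neg_one {A : Module.End ℂ M}
    (hA : ∀ k x v, A (R.mode k x v) = R.mode k x (A v) - (k : ℂ) • R.mode (k + 1) x v) (v : M) :
    A (R.modeSum (-1) v) - R.modeSum (-1) (A v) = R.casimirSum v := by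
  obtain ⟨N, hN⟩ := R.exists_modeSum_eq (-1) v
  obtain ⟨N', hN'⟩ := R.exists_modeSum_eq (-1) (A v)
  obtain ⟨N₁, hN₁⟩ := exists_locallyFiniteSum_eq _ (R.locallyFiniteSeq_pair (-1) 1) v
  obtain ⟨N₂, hN₂⟩ := R.smooth v
  set n := max (max N N') (max N₁ N₂) with hn
  have h1 : ∀ j : ℕ, A (R.pair (-1 - j) (-1 + 1 + j) v) - R.pair (-1 - j) (-1 + 1 + j) (A v) =
      ((1 : ℂ) + j) • R.pair (-j) j v - (j : ℂ) • R.pair (-1 - j) (1 + j) v := fun j => by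
    simp only [pair_apply, map_sum, Finset.smul_sum, ← Finset.sum_sub_distrib]
    refine Finset.sum_congr rfl fun i _ => ?_
    rw [hA, hA, map_sub, map_smul, show (-1 : ℤ) - j + 1 = -j by ring,
      show (-1 : ℤ) + 1 + j = j by ring, add_comm (j : ℤ) 1]
    push_cast
    module
  -- The pair at `(-j, j)` enters with `1 + j` from step `j` and with `-(j - 1)` from step `j - 1`.
  -- It thus keeps coefficient `2`, or `1` for `j = 0`, apart from a boundary term killed by
  -- smoothness.
  have h2 : ∀ n : ℕ, ∑ j ∈ Finset.range n, (((1 : ℂ) + j) • R.pair (-j) j v -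
      (j : ℂ) • R.pair (-1 - j) (1 + j) v) = R.pair 0 0 v +
        (2 : ℂ) • ∑ j ∈ Finset.range n, R.pair (-1 - j) (1 + j) v -
          ((n : ℂ) + 1) • R.pair (-n) n v := fun n => by
    induction n with
    | zero => simp
    | succ n ih =>
      rw [Finset.sum_range_succ, ih, Finset.sum_range_succ,
        show -((n + 1 : ℕ) : ℤ) = -1 - n by push_cast; ring,
        show ((n + 1 : ℕ) : ℤ) = 1 + n by push_cast; ring]
      push_cast
      module
  have h3 : R.pair (-n) n v = 0 := by
    rw [pair_apply]
    refine Finset.sum_eq_zero fun i _ => ?_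
    rw [hN₂ n (by omega), map_zero]
  rw [hN n (by omega), hN' n (by omega), map_sum, ← Finset.sum_sub_distrib]
  simp only [h1]
  rw [h2, h3, casimirSum, LinearMap.add_apply, LinearMap.smul_apply, hN₁ n (by omega)]
  simp

/-- Singular vectors: on a vector killed by the modes of positive degree, only the finite part of
`casimirSum` survives. -/
theorem casimirSum_eq_pair {v : M} (hv : ∀ k : ℤ, 0 < k → ∀ x, R.mode k x v = 0) :
    R.casimirSum v = R.pair 0 0 v := by
  obtain ⟨N, hN⟩ := exists_locallyFiniteSum_eq _ (R.locallyFiniteSeq_pair (-1) 1) v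
  rw [casimirSum, LinearMap.add_apply, LinearMap.smul_apply, hN N le_rfl, Finset.sum_eq_zero]
  · simp
  · intro j _
    rw [pair_apply]
    refine Finset.sum_eq_zero fun i _ => ?_
    rw [hv _ (by omega), map_zero]

/-! ### The Sugawara operators -/

variable (b)

/-- The Sugawara operator `L₁` for `p = 0`, and `L₋₁` for `p = -1`. -/
def sugawara (p : ℤ) : Module.End ℂ M := (R.level + dualCoxeter θ b)⁻¹ • R.modeSum p

/-- The Sugawara operator `L₀`. -/
def sugawaraZero : Module.End ℂ M := (1 / (2 * (R.level + dualCoxeter θ b))) • R.casimirSum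

variable {b}

theorem sugawara_mode (hθ : IsHighestRoot b θ) (hκ : R.level + dualCoxeter θ b ≠ 0) (p k : ℤ)
    (x : 𝔤) (v : M) : R.sugawara b p (R.mode k x v) =
      R.mode k x (R.sugawara b p v) - (k : ℂ) • R.mode (2 * p + 1 + k) x v := by
  simp only [sugawara, LinearMap.smul_apply, map_smul]
  rw [R.modeSum_mode hθ, smul_sub, smul_smul, mul_comm (k : ℂ), ← mul_assoc, inv_mul_cancel₀ hκ,
    one_mul]

theorem map_sugawara {X : Module.End ℂ M} {c : ℂ}
    (hX : ∀ k x v, X (R.mode k x v) = R.mode k x (X v) + (c * k) • R.mode k x v) (p : ℤ) (v : M) :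
    X (R.sugawara b p v) = R.sugawara b p (X v) + (c * (2 * p + 1)) • R.sugawara b p v := by
  simp only [sugawara, LinearMap.smul_apply, map_smul]
  rw [R.map_modeSum hX, smul_add, smul_comm]

theorem map_sugawara_of_commute {X : Module.End ℂ M}
    (hX : ∀ k x v, X (R.mode k x v) = R.mode k x (X v)) (p : ℤ) (v : M) :
    X (R.sugawara b p v) = R.sugawara b p (X v) := by
  simp only [sugawara, LinearMap.smul_apply, map_smul]
  rw [R.map_modeSum_of_commute hX]

theorem commutator_sugawara {A : Module.End ℂ M}
    (hA : ∀ k x v, A (R.mode k x v) = R.mode k x (A v) - (k : ℂ) • R.mode (k + 1) x v) (v : M) :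
    A (R.sugawara b (-1) v) - R.sugawara b (-1) (A v) = (2 : ℂ) • R.sugawaraZero b v := by
  simp only [sugawara, sugawaraZero, LinearMap.smul_apply, map_smul]
  rw [← smul_sub, R.commutator_modeSum_neg_one hA, smul_smul]
  congr 1
  field_simp

/-- Since `2 L₀ = [L₁, L₋₁]`, the Jacobi identity reduces the claim to the known commutators of `L₁`
and `L₋₁` with the modes. -/
theorem sugawaraZero_mode (hθ : IsHighestRoot b θ) (hκ : R.level + dualCoxeter θ b ≠ 0) (k : ℤ)
    (x : 𝔤) (v : M) : R.sugawaraZero b (R.mode k x v) =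
      R.mode k x (R.sugawaraZero b v) - (k : ℂ) • R.mode k x v := by
  have hA : ∀ k x v, R.sugawara b 0 (R.mode k x v) =
      R.mode k x (R.sugawara b 0 v) - (k : ℂ) • R.mode (k + 1) x v := fun k x v => by
    rw [R.sugawara_mode hθ hκ, show 2 * 0 + 1 + k = k + 1 by ring]
  have hB : ∀ k x v, R.sugawara b (-1) (R.mode k x v) =
      R.mode k x (R.sugawara b (-1) v) - (k : ℂ) • R.mode (k - 1) x v := fun k x v => by
    rw [R.sugawara_mode hθ hκ, show 2 * -1 + 1 + k = k - 1 by ring]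
  refine smul_right_injective M (two_ne_zero (α := ℂ)) ?_
  change (2 : ℂ) • _ = (2 : ℂ) • _
  rw [smul_sub, ← map_smul (R.mode k x), ← R.commutator_sugawara hA, ← R.commutator_sugawara hA]
  simp only [hA, hB, map_sub, map_smul, show k - 1 + 1 = k by ring, show k + 1 - 1 = k by ring]
  push_cast
  module

end SmoothRep

/-! ### The Goddard-Kent-Olive operators -/

open SmoothRep

variable {θ : H.root} {b : (rootSystem H).Base} {M : Type*} [AddCommGroup M] [Module ℂ M]

/-- Two commuting smooth representations together with their sum. -/
structure GKOData (θ : H.root) (b : (rootSystem H).Base) (M : Type*) [AddCommGroup M]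
    [Module ℂ M] where
  /-- The first representation. -/
  fst : SmoothRep θ M
  /-- The second representation. -/
  snd : SmoothRep θ M
  /-- The diagonal representation. -/
  diag : SmoothRep θ M
  comm : ∀ k l x y v, fst.mode k x (snd.mode l y v) = snd.mode l y (fst.mode k x v)
  mode_eq : ∀ k x v, diag.mode k x v = fst.mode k x v + snd.mode k x v
  isHighestRoot : IsHighestRoot b θ
  fst_ne : fst.level + dualCoxeter θ b ≠ 0
  snd_ne : snd.level + dualCoxeter θ b ≠ 0
  diag_ne : diag.level + dualCoxeter θ b ≠ 0

namespace GKOData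

variable (D : GKOData θ b M)

/-- The sum of the Sugawara operators of the two factors. -/
def factors (p : ℤ) : Module.End ℂ M := D.fst.sugawara b p + D.snd.sugawara b p

/-- The Goddard-Kent-Olive operator `L₁` for `p = 0`, and `L₋₁` for `p = -1`. -/
def gko (p : ℤ) : Module.End ℂ M := D.factors p - D.diag.sugawara b p

/-- The Goddard-Kent-Olive operator `L₀`. -/
def gkoZero : Module.End ℂ M :=
  D.fst.sugawaraZero b + D.snd.sugawaraZero b - D.diag.sugawaraZero b

theorem factors_fst_mode (p k : ℤ) (x : 𝔤) (v : M) : D.factors p (D.fst.mode k x v) =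
    D.fst.mode k x (D.factors p v) - (k : ℂ) • D.fst.mode (2 * p + 1 + k) x v := by
  rw [factors, LinearMap.add_apply, LinearMap.add_apply,
    D.fst.sugawara_mode D.isHighestRoot D.fst_ne, map_add,
    ← D.snd.map_sugawara_of_commute (X := D.fst.mode k x) fun l y w => D.comm k l x y w]
  abel

theorem factors_snd_mode (p k : ℤ) (x : 𝔤) (v : M) : D.factors p (D.snd.mode k x v) =
    D.snd.mode k x (D.factors p v) - (k : ℂ) • D.snd.mode (2 * p + 1 + k) x v := by
  rw [factors, LinearMap.add_apply, LinearMap.add_apply,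
    D.snd.sugawara_mode D.isHighestRoot D.snd_ne, map_add,
    ← D.fst.map_sugawara_of_commute (X := D.snd.mode k x) fun l y w => (D.comm l k y x w).symm]
  abel

theorem factors_diag_mode (p k : ℤ) (x : 𝔤) (v : M) : D.factors p (D.diag.mode k x v) =
    D.diag.mode k x (D.factors p v) - (k : ℂ) • D.diag.mode (2 * p + 1 + k) x v := by
  rw [D.mode_eq, D.mode_eq, D.mode_eq, map_add, factors_fst_mode, factors_snd_mode]
  module

/-- The Goddard-Kent-Olive operators commute with the diagonal action. -/
theorem gko_diag_mode (p k : ℤ) (x : 𝔤) (v : M) :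
    D.gko p (D.diag.mode k x v) = D.diag.mode k x (D.gko p v) := by
  rw [gko, LinearMap.sub_apply, LinearMap.sub_apply, factors_diag_mode,
    D.diag.sugawara_mode D.isHighestRoot D.diag_ne, map_sub]
  abel

/-- The coset `L₋₁` commutes with the diagonal modes, hence with the diagonal `L₁`, so the coset
`L₁` may be replaced by `factors 0`. That operator acts as `L₁` on the modes of all three
representations, so its commutator with each of the three `L₋₁` is twice the corresponding `L₀`. -/
theorem commutator_gko (v : M) :
    D.gko 0 (D.gko (-1) v) - D.gko (-1) (D.gko 0 v) = (2 : ℂ) • D.gkoZero v := by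
  have h0 : D.gko (-1) (D.diag.sugawara b 0 v) = D.diag.sugawara b 0 (D.gko (-1) v) :=
    D.diag.map_sugawara_of_commute (X := D.gko (-1)) (D.gko_diag_mode (-1)) 0 v
  have h1 : D.gko 0 (D.gko (-1) v) - D.gko (-1) (D.gko 0 v) =
      D.factors 0 (D.gko (-1) v) - D.gko (-1) (D.factors 0 v) := by
    rw [show D.gko 0 = D.factors 0 - D.diag.sugawara b 0 from rfl, LinearMap.sub_apply,
      LinearMap.sub_apply, map_sub, h0]
    abel
  have hA1 := D.fst.commutator_sugawara (b := b) (A := D.factors 0) (fun k x v => by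
    rw [factors_fst_mode, show 2 * 0 + 1 + k = k + 1 by ring]) v
  have hA2 := D.snd.commutator_sugawara (b := b) (A := D.factors 0) (fun k x v => by
    rw [factors_snd_mode, show 2 * 0 + 1 + k = k + 1 by ring]) v
  have hA3 := D.diag.commutator_sugawara (b := b) (A := D.factors 0) (fun k x v => by
    rw [factors_diag_mode, show 2 * 0 + 1 + k = k + 1 by ring]) v
  have h2 : ∀ w, D.gko (-1) w =
    D.fst.sugawara b (-1) w + D.snd.sugawara b (-1) w - D.diag.sugawara b (-1) w := fun _ => rfl
  rw [h1, h2, h2, map_sub, map_add, gkoZero, LinearMap.sub_apply, LinearMap.add_apply, smul_sub,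
    smul_add, ← hA1, ← hA2, ← hA3]
  abel

theorem map_gko {X : Module.End ℂ M} {c : ℂ}
    (h1 : ∀ k x v, X (D.fst.mode k x v) = D.fst.mode k x (X v) + (c * k) • D.fst.mode k x v)
    (h2 : ∀ k x v, X (D.snd.mode k x v) = D.snd.mode k x (X v) + (c * k) • D.snd.mode k x v)
    (p : ℤ) (v : M) : X (D.gko p v) = D.gko p (X v) + (c * (2 * p + 1)) • D.gko p v := by
  have h3 : ∀ k x v, X (D.diag.mode k x v) =
      D.diag.mode k x (X v) + (c * k) • D.diag.mode k x v := fun k x v => by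
    rw [D.mode_eq, D.mode_eq, map_add, h1, h2]
    module
  simp only [gko, factors, LinearMap.sub_apply, LinearMap.add_apply, map_sub, map_add,
    D.fst.map_sugawara h1, D.snd.map_sugawara h2, D.diag.map_sugawara h3]
  module

end GKOData

end Current

end UntwistedAffine

/-! ### Affine weights: the root cone, dominance, and positivity of the coset scalar. -/

namespace UntwistedAffine

open LieAlgebra LieAlgebra.IsKilling

/-! ### Nonnegative combinations of affine simple roots -/

section AffineWeights

variable {𝔤 : Type*} [LieRing 𝔤] [LieAlgebra ℂ 𝔤] [FiniteDimensional ℂ 𝔤] [LieAlgebra.IsSimple ℂ 𝔤]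
  {H : LieSubalgebra ℂ 𝔤} [H.IsCartanSubalgebra] (θ : H.root) (b : (rootSystem H).Base)

/-- `γ` is a combination of the affine simple roots `α₀ = δ - θ, α₁, …, αᵣ` with natural number
coefficients. -/
def IsAffineNatComb (γ : AffineWeight H) : Prop :=
  γ.2.1 = 0 ∧ (∃ n : ℕ, γ.2.2 = n) ∧ IsNatComb b (γ.1 + γ.2.2 • (rootSystem H).root θ)

/-- The affine simple roots. -/
def simpleRoot : Option b.support → AffineWeight H
  | none => (-(rootSystem H).root θ, 0, 1)
  | some i => ((rootSystem H).root i, 0, 0)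

/-- The sum of the coefficients of the affine simple roots. -/
def affineHeight : AffineWeight H →ₗ[ℂ] ℂ where
  toFun γ := γ.2.2 + ∑ i, b.toWeightBasis.coord i (γ.1 + γ.2.2 • (rootSystem H).root θ)
  map_add' γ γ' := by
    rw [add_add_add_comm, ← Finset.sum_add_distrib]
    congr 1
    refine Finset.sum_congr rfl fun i _ => ?_
    rw [← map_add]
    congr 1
    simp only [Prod.fst_add, Prod.snd_add]
    module
  map_smul' r γ := by
    simp only [Prod.smul_fst, Prod.smul_snd, RingHom.id_apply, smul_eq_mul, mul_add,
      Finset.mul_sum]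
    congr 1
    refine Finset.sum_congr rfl fun i _ => ?_
    rw [← smul_eq_mul r (b.toWeightBasis.coord i _), ← (b.toWeightBasis.coord i).map_smul, smul_add,
      mul_smul]

variable {θ b}

theorem IsNatComb.smul {β : Module.Dual ℂ H} (h : IsNatComb b β) (n : ℕ) :
    IsNatComb b ((n : ℂ) • β) := fun i => by
  obtain ⟨k, hk⟩ := h i
  exact ⟨n * k, by rw [map_smul, hk]; push_cast; rfl⟩

theorem IsAffineNatComb.zero : IsAffineNatComb θ b 0 :=
  ⟨rfl, ⟨0, by simp⟩, by simpa using IsNatComb.zero⟩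

theorem IsAffineNatComb.add {γ γ' : AffineWeight H} (h : IsAffineNatComb θ b γ)
    (h' : IsAffineNatComb θ b γ') : IsAffineNatComb θ b (γ + γ') := by
  obtain ⟨h1, ⟨n, hn⟩, h2⟩ := h
  obtain ⟨h1', ⟨n', hn'⟩, h2'⟩ := h'
  refine ⟨by simp [h1, h1'], ⟨n + n', by simp [hn, hn']⟩, ?_⟩
  have := h2.add h2'
  rwa [show γ.1 + γ.2.2 • (rootSystem H).root θ + (γ'.1 + γ'.2.2 • (rootSystem H).root θ) =
    (γ + γ').1 + (γ + γ').2.2 • (rootSystem H).root θ by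
      simp only [Prod.fst_add, Prod.snd_add]; module] at this

theorem IsAffineNatComb.nsmul {γ : AffineWeight H} (h : IsAffineNatComb θ b γ) (n : ℕ) :
    IsAffineNatComb θ b (n • γ) := by
  induction n with
  | zero => simpa using IsAffineNatComb.zero
  | succ n ih => rw [succ_nsmul]; exact ih.add h

theorem IsAffineNatComb.eq_zero {γ : AffineWeight H} (h : IsAffineNatComb θ b γ)
    (h' : IsAffineNatComb θ b (-γ)) : γ = 0 := by
  obtain ⟨h1, ⟨n, hn⟩, h2⟩ := h
  obtain ⟨-, ⟨n', hn'⟩, h2'⟩ := h'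
  have h3 : γ.2.2 = 0 := by
    rw [Prod.snd_neg, Prod.snd_neg, hn] at hn'
    have : ((n + n' : ℕ) : ℂ) = 0 := by push_cast; rw [← hn']; ring
    have : n = 0 := by have := Nat.cast_eq_zero.mp this; omega
    rw [hn, this]
    simp
  simp only [Prod.snd_neg, Prod.fst_neg, h3, neg_zero, zero_smul, add_zero] at h2 h2'
  exact Prod.ext (h2.eq_zero h2') (Prod.ext h1 h3)

theorem IsAffineNatComb.exists_height {γ : AffineWeight H} (h : IsAffineNatComb θ b γ) :
    ∃ n : ℕ, affineHeight θ b γ = n ∧ (γ ≠ 0 → 0 < n) := by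
  obtain ⟨h1, ⟨n, hn⟩, h2⟩ := h
  choose f hf using h2
  refine ⟨n + ∑ i, f i, ?_, fun h => ?_⟩
  · change γ.2.2 + ∑ i, b.toWeightBasis.coord i (γ.1 + γ.2.2 • (rootSystem H).root θ) = _
    rw [hn] at hf ⊢
    simp only [hf]
    push_cast
    rfl
  · by_contra hz
    have hn0 : n = 0 := by omega
    have hs : ∑ i, f i = 0 := by omega
    rw [Finset.sum_eq_zero_iff] at hs
    refine h (Prod.ext ?_ (Prod.ext h1 (by rw [hn, hn0]; simp)))
    refine b.toWeightBasis.ext_elem fun i => ?_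
    have := hf i
    rw [hn, hn0, hs i (Finset.mem_univ _)] at this
    rw [Module.Basis.coord_apply] at this
    simpa using this

theorem simpleRoot_ne_zero (i : Option b.support) : simpleRoot θ b i ≠ 0 := by
  rcases i with _ | i
  · intro h
    exact one_ne_zero (congrArg (fun γ : AffineWeight H => γ.2.2) h)
  · intro h
    exact (rootSystem H).ne_zero (i : H.root) (congrArg (fun γ : AffineWeight H => γ.1) h)

theorem isAffineNatComb_simpleRoot (i : Option b.support) :
    IsAffineNatComb θ b (simpleRoot θ b i) := by
  rcases i with _ | i
  · refine ⟨rfl, ⟨1, by simp [simpleRoot]⟩, ?_⟩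
    rw [simpleRoot, one_smul, neg_add_cancel]
    exact IsNatComb.zero
  · refine ⟨rfl, ⟨0, by simp [simpleRoot]⟩, ?_⟩
    rw [simpleRoot, zero_smul, add_zero]
    exact isNatComb_of_isPos (RootPairing.Base.isPos_of_mem_support i.2)

/-- One copy of `θ` absorbs `α`, since `θ - (-α)` is a sum of simple roots and `-α` is a root. Thus
`α + nδ` with `n > 0` is a positive affine root. -/
theorem IsHighestRoot.isNatComb_add_smul (hθ : IsHighestRoot b θ) (α : H.root) {n : ℕ}
    (hn : 0 < n) : IsNatComb b ((rootSystem H).root α + (n : ℂ) • (rootSystem H).root θ) := by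
  obtain ⟨n, rfl⟩ : ∃ l, n = l + 1 := ⟨n - 1, by omega⟩
  have h := (hθ.isNatComb (negRoot α)).add ((isNatComb_of_isPos hθ.isPos).smul n)
  rw [root_negRoot] at h
  convert h using 1
  push_cast
  module

/-! ### Positivity of the form -/

theorem weightForm_comm (lam mu : AffineWeight H) : weightForm θ lam mu = weightForm θ mu lam := by
  rw [weightForm, weightForm, normalizedDual_comm]
  ring

theorem weightForm_add_left (lam mu nu : AffineWeight H) :
    weightForm θ (lam + mu) nu = weightForm θ lam nu + weightForm θ mu nu := by
  simp only [weightForm, Prod.fst_add, Prod.snd_add, normalizedDual_add_left]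
  ring

theorem weightForm_smul_left (r : ℂ) (lam nu : AffineWeight H) :
    weightForm θ (r • lam) nu = r * weightForm θ lam nu := by
  simp only [weightForm, Prod.smul_fst, Prod.smul_snd, normalizedDual_smul_left, smul_eq_mul]
  ring

theorem weightForm_add_right (lam mu nu : AffineWeight H) :
    weightForm θ nu (lam + mu) = weightForm θ nu lam + weightForm θ nu mu := by
  rw [weightForm_comm, weightForm_add_left, weightForm_comm lam, weightForm_comm mu]

theorem weightForm_smul_right (r : ℂ) (lam nu : AffineWeight H) :
    weightForm θ nu (r • lam) = r * weightForm θ nu lam := by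
  rw [weightForm_comm, weightForm_smul_left, weightForm_comm]

/-- Splitting off the multiple `γ.2.2` of `α₀ = δ - θ` leaves a finite part. The pairing of `α₀`
with `lam` is `lam(c) - lam(θ^∨)`, its value on `α₀^∨`. -/
theorem weightForm_eq_add (γ lam : AffineWeight H) (h : γ.2.1 = 0) :
    weightForm θ γ lam = normalizedDual θ (γ.1 + γ.2.2 • (rootSystem H).root θ) lam.1 +
      γ.2.2 * (lam.2.1 - lam.1 ((rootSystem H).coroot θ)) := by
  rw [weightForm, h, normalizedDual_add_left, normalizedDual_smul_left,
    normalizedDual_comm θ ((rootSystem H).root θ), normalizedDual_root]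
  ring

/-- Nonnegative combinations of affine simple roots pair to nonnegative real numbers with
dominant weights. -/
theorem IsAffineNatComb.weightForm_nonneg {γ lam : AffineWeight H} (h : IsAffineNatComb θ b γ)
    (hl : IsDominantIntegral θ b lam) : ∃ r : ℝ, 0 ≤ r ∧ weightForm θ γ lam = r := by
  obtain ⟨h1, ⟨n, hn⟩, h2⟩ := h
  obtain ⟨r, hr, hr'⟩ := normalizedDual_nonneg θ (lam := lam.1) h2 fun i => by
    obtain ⟨k, hk⟩ := hl (some i)
    refine ⟨k, Nat.cast_nonneg _, ?_⟩
    simpa [evalWeight, simpleCoroot] using hk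
  obtain ⟨k, hk⟩ := hl none
  refine ⟨r + n * k, by positivity, ?_⟩
  rw [weightForm_eq_add _ _ h1, hr', hn]
  simp only [evalWeight, simpleCoroot, map_neg, mul_one, mul_zero, add_zero] at hk
  push_cast
  rw [← hk]
  ring

theorem rho_fst : (rho θ b).1 = finiteRho b := by
  simp [rho, finiteRho, Fintype.sum_option, fundamentalWeight, Prod.fst_sum]

theorem rho_snd_snd : (rho θ b).2.2 = 0 := by
  simp [rho, Fintype.sum_option, fundamentalWeight, Prod.snd_sum]

theorem evalWeight_rho (i : Option b.support) : evalWeight (rho θ b) (simpleCoroot θ b i) = 1 := by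
  rcases i with _ | i
  · simp only [evalWeight, simpleCoroot, rho_fst, rho_level, dualCoxeter_eq, map_neg]
    ring
  · simp only [evalWeight, simpleCoroot, rho_fst, finiteRho_coroot]
    ring

theorem evalWeight_add (lam mu : AffineWeight H) (h : AffineCartan H) :
    evalWeight (lam + mu) h = evalWeight lam h + evalWeight mu h := by
  simp only [evalWeight, Prod.fst_add, Prod.snd_add, LinearMap.add_apply]
  ring

theorem evalWeight_smul (r : ℂ) (lam : AffineWeight H) (h : AffineCartan H) :
    evalWeight (r • lam) h = r * evalWeight lam h := by
  simp only [evalWeight, Prod.smul_fst, Prod.smul_snd, LinearMap.smul_apply, smul_eq_mul]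
  ring

theorem isDominantIntegral_nsmul_rho (n : ℕ) : IsDominantIntegral θ b (n • rho θ b) := fun i =>
  ⟨n, by rw [← Nat.cast_smul_eq_nsmul ℂ, evalWeight_smul, evalWeight_rho, mul_one]⟩

theorem IsDominantIntegral.add {lam mu : AffineWeight H} (h : IsDominantIntegral θ b lam)
    (h' : IsDominantIntegral θ b mu) : IsDominantIntegral θ b (lam + mu) := fun i => by
  obtain ⟨k, hk⟩ := h i
  obtain ⟨l, hl⟩ := h' i
  exact ⟨k + l, by rw [evalWeight_add, hk, hl]; push_cast; rfl⟩

theorem normalizedDual_finiteRho_pos {β : Module.Dual ℂ H} (h : IsNatComb b β) (h0 : β ≠ 0) :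
    ∃ r : ℝ, 0 < r ∧ normalizedDual θ β (finiteRho b) = r := by
  obtain ⟨r, hr, hr'⟩ := normalizedDual_nonneg θ (lam := finiteRho b) h
    fun i => ⟨1, zero_le_one, by rw [finiteRho_coroot]; simp⟩
  refine ⟨r, lt_of_le_of_ne hr fun hr0 => ?_, hr'⟩
  obtain ⟨i, hi⟩ : ∃ i, b.toWeightBasis.coord i β ≠ 0 := by
    by_contra! hall
    exact h0 (b.toWeightBasis.ext_elem fun i => by
      have := hall i
      rw [Module.Basis.coord_apply] at this
      rw [this]
      simp)
  classical
  -- One simple root that occurs in `β` is removed. The remainder still pairs nonnegatively with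
  -- `ρ`, and the removed root pairs strictly positively.
  have h1 : IsNatComb b (β - (rootSystem H).root i) := fun j => by
    obtain ⟨n, hn⟩ := h j
    rw [map_sub, coord_root_support, hn]
    split_ifs with hij
    · subst hij
      rw [hn, Nat.cast_ne_zero] at hi
      exact ⟨n - 1, by rw [Nat.cast_sub (by omega)]; simp⟩
    · exact ⟨n, by simp⟩
  obtain ⟨s, hs, hs'⟩ := normalizedDual_nonneg θ (lam := finiteRho b) h1
    fun i => ⟨1, zero_le_one, by rw [finiteRho_coroot]; simp⟩
  obtain ⟨t, ht, ht'⟩ := exists_normalizedDual_root θ (i : H.root)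
  have h2 : normalizedDual θ β (finiteRho b) = s + t := by
    rw [show β = (β - (rootSystem H).root i) + (rootSystem H).root i by abel,
      normalizedDual_add_left, hs', normalizedDual_comm θ _ (finiteRho b), ht', finiteRho_coroot,
      mul_one]
  rw [hr', ← hr0] at h2
  have h3 : s + t = 0 := by exact_mod_cast h2.symm
  linarith

theorem IsAffineNatComb.weightForm_rho_pos {γ : AffineWeight H} (h : IsAffineNatComb θ b γ)
    (h0 : γ ≠ 0) : ∃ r : ℝ, 0 < r ∧ weightForm θ γ (rho θ b) = r := by
  obtain ⟨h1, ⟨n, hn⟩, h2⟩ := h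
  have h3 : weightForm θ γ (rho θ b) =
      normalizedDual θ (γ.1 + γ.2.2 • (rootSystem H).root θ) (finiteRho b) + n := by
    rw [weightForm_eq_add _ _ h1, rho_fst, rho_level, dualCoxeter_eq, hn]
    ring
  rw [h3]
  by_cases hz : γ.1 + γ.2.2 • (rootSystem H).root θ = 0
  · refine ⟨n, ?_, by rw [hz, normalizedDual_comm]; simp [normalizedDual, killingDual]⟩
    rcases Nat.eq_zero_or_pos n with rfl | hn'
    · exfalso
      rw [hn] at hz
      refine h0 (Prod.ext (by simpa using hz) (Prod.ext h1 (by simpa using hn)))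
    · exact_mod_cast hn'
  · obtain ⟨r, hr, hr'⟩ := normalizedDual_finiteRho_pos (θ := θ) h2 hz
    exact ⟨r + n, by positivity, by rw [hr']; push_cast; rfl⟩

theorem exists_weightForm_rho_rho :
    ∃ r : ℝ, 0 < r ∧ weightForm θ (rho θ b) (rho θ b) = r := by
  classical
  have h1 : IsNatComb b (2 • finiteRho b) := by
    rw [← sum_pos_roots]
    refine Finset.sum_induction _ (IsNatComb b) (fun _ _ => IsNatComb.add) IsNatComb.zero ?_
    intro α hα
    exact isNatComb_of_isPos (Finset.mem_filter.mp hα).2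
  have h2 : (2 • finiteRho b) ≠ 0 := fun h => by
    have : Nonempty H.root := ⟨θ⟩
    obtain ⟨i, hi⟩ := b.support_nonempty
    have h3 := finiteRho_coroot b ⟨i, hi⟩
    rw [(smul_eq_zero.mp h).resolve_left two_ne_zero] at h3
    simp at h3
  obtain ⟨r, hr, hr'⟩ := normalizedDual_finiteRho_pos (θ := θ) h1 h2
  refine ⟨r / 2, by positivity, ?_⟩
  rw [← Nat.cast_smul_eq_nsmul ℂ, normalizedDual_smul_left] at hr'
  rw [weightForm, rho_fst, rho_snd_snd]
  push_cast at hr' ⊢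
  rw [← hr']
  ring

/-- Two dominant weights which differ by a nonnegative combination of simple roots and on which
the Casimir operator takes the same value are equal. -/
theorem eq_of_weightForm_eq {lam mu : AffineWeight H} (hl : IsDominantIntegral θ b lam)
    (hm : IsDominantIntegral θ b mu) (h : IsAffineNatComb θ b (lam - mu))
    (heq : weightForm θ lam (lam + 2 • rho θ b) = weightForm θ mu (mu + 2 • rho θ b)) :
    lam = mu := by
  by_contra hne
  obtain ⟨r, hr, hr'⟩ := h.weightForm_nonneg (hl.add hm)
  obtain ⟨s, hs, hs'⟩ := h.weightForm_rho_pos (sub_ne_zero.mpr hne)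
  -- The first term on the right is nonnegative by dominance of both weights, the second strictly
  -- positive if they differ.
  have h1 : weightForm θ lam (lam + 2 • rho θ b) - weightForm θ mu (mu + 2 • rho θ b) =
      weightForm θ (lam - mu) (lam + mu) + 2 * weightForm θ (lam - mu) (rho θ b) := by
    rw [← Nat.cast_smul_eq_nsmul ℂ, sub_eq_add_neg lam, ← neg_one_smul ℂ mu]
    simp only [weightForm_add_left, weightForm_add_right, weightForm_smul_left,
      weightForm_smul_right, weightForm_comm mu lam]
    push_cast
    ring
  rw [heq, sub_self, hr', hs'] at h1
  have h2 : r + 2 * s = 0 := by exact_mod_cast h1.symm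
  linarith

/-- The key estimate: the Goddard-Kent-Olive scalar is positive at dominant weights below
`(m + n) ρ`. -/
theorem gkoScalar_pos (hθ : IsHighestRoot b θ) {m n : ℕ} (hm : 0 < m) (hn : 0 < n)
    {lam : AffineWeight H} (hl : IsDominantIntegral θ b lam)
    (h : IsAffineNatComb θ b (m • rho θ b + n • rho θ b - lam)) : 0 < gkoScalar θ b m n lam := by
  obtain ⟨c, hc, hc'⟩ := hθ.exists_dualCoxeter
  obtain ⟨r, hr, hr'⟩ := exists_weightForm_rho_rho (θ := θ) (b := b)
  obtain ⟨s, hs, hs'⟩ := h.weightForm_nonneg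
    (hl.add (isDominantIntegral_nsmul_rho (m + n + 2)))
  -- With `μ = (m+n)ρ - lam`, the difference of the two Casimir values factors as `(μ | lam +
  -- (m+n+2)ρ)`, which is `s`.
  have h1 : weightForm θ lam (lam + 2 • rho θ b) = (m + n) * (m + n + 2) * r - s := by
    rw [← hr', ← hs']
    simp only [← Nat.cast_smul_eq_nsmul ℂ]
    rw [sub_eq_add_neg _ lam, ← neg_one_smul ℂ lam]
    simp only [weightForm_add_left, weightForm_add_right, weightForm_smul_left,
      weightForm_smul_right, weightForm_comm (rho θ b) lam]
    push_cast
    ring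
  have h2 : gkoScalar θ b m n lam = ((1 / (2 * c) * (m * (m + 2) * r / (m + 1) +
      n * (n + 2) * r / (n + 1) - ((m + n) * (m + n + 2) * r - s) / (m + n + 1)) : ℝ) : ℂ) := by
    rw [gkoScalar, h1, hc']
    simp only [← Nat.cast_smul_eq_nsmul ℂ, weightForm_smul_left, weightForm_smul_right, hr']
    push_cast
    ring
  rw [h2, Complex.zero_lt_real]
  refine mul_pos (by positivity) ?_
  have hm' : (1 : ℝ) ≤ m := by exact_mod_cast hm
  have hn' : (1 : ℝ) ≤ n := by exact_mod_cast hn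
  -- By `x(x+2)/(x+1) = x + 1 - 1/(x+1)`, the coefficient of `r` is `1 - 1/(m+1) - 1/(n+1) +
  -- 1/(m+n+1)`, which is positive for `m, n ≥ 1`.
  have h3 : m * (m + 2) * r / (m + 1) + n * (n + 2) * r / (n + 1) -
      ((m + n) * (m + n + 2) * r - s) / (m + n + 1 : ℝ) =
      r * ((m * n * (m + n + 2)) / ((m + 1) * (n + 1) * (m + n + 1))) + s / (m + n + 1) := by
    field_simp
    ring
  rw [h3]
  positivity

end AffineWeights

end UntwistedAffine

namespace UntwistedAffine

open LieAlgebra LieAlgebra.IsKilling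

/-! ### Root vectors, weight vectors and highest weight modules of the affine algebra. -/

section AffineModules

variable {𝔤 : Type*} [LieRing 𝔤] [LieAlgebra ℂ 𝔤] [FiniteDimensional ℂ 𝔤] [LieAlgebra.IsSimple ℂ 𝔤]
  {H : LieSubalgebra ℂ 𝔤} [H.IsCartanSubalgebra] {θ : H.root} {b : (rootSystem H).Base}

/-! ### Root vectors of the affine Lie algebra -/

theorem current_add (n : ℤ) (x y : 𝔤) :
    current θ n (x + y) = current θ n x + current θ n y :=
  Affine.ext (Finsupp.single_add _ _ _) (by simp [current]) (by simp [current])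

theorem current_smul (n : ℤ) (r : ℂ) (x : 𝔤) : current θ n (r • x) = r • current θ n x :=
  Affine.ext (by simp [current]) (by simp [current]) (by simp [current])

theorem current_zero (n : ℤ) : current θ n (0 : 𝔤) = 0 :=
  Affine.ext (by simp [current]) rfl rfl

theorem lie_current_current (m n : ℤ) (x y : 𝔤) : ⁅current θ m x, current θ n y⁆ =
    current θ (m + n) ⁅x, y⁆ + ofCartan θ ((0 : H),
      (if m + n = 0 then m * normalizedForm θ x y else 0), 0) := by
  refine Affine.ext ?_ ?_ ?_
  · rw [loop_lie]
    simp [current, ofCartan, loopLie_single]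
  · rw [central_lie]
    simp [current, ofCartan, residue_single]
  · rw [degree_lie]
    simp [current, ofCartan]

theorem lie_ofCartan_current (h : AffineCartan H) (n : ℤ) (x : 𝔤) : ⁅ofCartan θ h, current θ n x⁆ =
    current θ n ⁅(h.1 : 𝔤), x⁆ + (h.2.2 * n) • current θ n x := by
  refine Affine.ext ?_ ?_ ?_
  · rw [loop_lie]
    simp [current, ofCartan, loopLie_single, degreeDerivation_single, mul_smul]
  · rw [central_lie]
    simp [current, ofCartan, residue_single]
  · rw [degree_lie]
    simp [current]

/-- `X` is of the form `tᵏ e` for an element `e` of a root space, or `tᵏ h` for `k ≠ 0` and an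
element `h` of the Cartan subalgebra, and `γ` is the corresponding root. -/
def IsRootVector (X : Affine θ) (γ : AffineWeight H) : Prop :=
  (∃ (k : ℤ) (α : H.root) (e : 𝔤), e ∈ rootSpace H (α : LieModule.Weight ℂ H 𝔤) ∧
    X = current θ k e ∧ γ = ((rootSystem H).root α, 0, (k : ℂ))) ∨
  ∃ (k : ℤ) (h : H), k ≠ 0 ∧ X = current θ k (h : 𝔤) ∧ γ = (0, 0, (k : ℂ))

theorem lie_coe_coe_eq_zero (h h' : H) : ⁅(h : 𝔤), (h' : 𝔤)⁆ = 0 := by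
  have := congrArg (fun x : H => (x : 𝔤)) (trivial_lie_zero H H h h')
  simpa using this

theorem IsRootVector.lie_ofCartan {X : Affine θ} {γ : AffineWeight H} (hX : IsRootVector X γ)
    (h : AffineCartan H) : ⁅ofCartan θ h, X⁆ = evalWeight γ h • X := by
  rcases hX with ⟨k, α, e, he, rfl, rfl⟩ | ⟨k, y, hk, rfl, rfl⟩
  · have h1 : ⁅(h.1 : 𝔤), e⁆ = (rootSystem H).root α h.1 • e := lie_eq_smul_of_mem_rootSpace he h.1
    rw [lie_ofCartan_current, h1, current_smul, ← add_smul]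
    simp [evalWeight, mul_comm]
  · rw [lie_ofCartan_current, lie_coe_coe_eq_zero, current_zero]
    simp [evalWeight, mul_comm]

theorem IsRootVector.nonneg_or_neg (hθ : IsHighestRoot b θ) {X : Affine θ} {γ : AffineWeight H}
    (hX : IsRootVector X γ) :
    γ ≠ 0 ∧ (IsAffineNatComb θ b γ ∨ IsAffineNatComb θ b (-γ)) := by
  rcases hX with ⟨k, α, e, he, rfl, rfl⟩ | ⟨k, y, hk, rfl, rfl⟩
  · refine ⟨fun h => (rootSystem H).ne_zero α (congrArg (fun γ : AffineWeight H => γ.1) h), ?_⟩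
    rcases lt_trichotomy k 0 with hk | rfl | hk
    · obtain ⟨n, rfl⟩ : ∃ n : ℕ, k = -n := ⟨(-k).toNat, by omega⟩
      refine Or.inr ⟨by simp, ⟨n, by simp⟩, ?_⟩
      have := hθ.isNatComb_add_smul (negRoot α) (n := n) (by omega)
      rw [root_negRoot] at this
      simpa using this
    · rcases isNatComb_or_neg (b := b) α with h | h
      · exact Or.inl ⟨rfl, ⟨0, by simp⟩, by simpa using h.2⟩
      · exact Or.inr ⟨by simp, ⟨0, by simp⟩, by simpa using h.2⟩
    · obtain ⟨n, rfl⟩ : ∃ n : ℕ, k = n := ⟨k.toNat, by omega⟩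
      refine Or.inl ⟨rfl, ⟨n, by simp⟩, ?_⟩
      simpa using hθ.isNatComb_add_smul α (n := n) (by omega)
  · refine ⟨fun h => hk (by simpa using congrArg (fun γ : AffineWeight H => γ.2.2) h), ?_⟩
    have hpos := isNatComb_of_isPos hθ.isPos
    rcases lt_or_gt_of_ne hk with hk | hk
    · obtain ⟨n, rfl⟩ : ∃ n : ℕ, k = -n := ⟨(-k).toNat, by omega⟩
      exact Or.inr ⟨by simp, ⟨n, by simp⟩, by simpa using hpos.smul n⟩
    · obtain ⟨n, rfl⟩ : ∃ n : ℕ, k = n := ⟨k.toNat, by omega⟩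
      exact Or.inl ⟨rfl, ⟨n, by simp⟩, by simpa using hpos.smul n⟩

/-- The root space decomposition of the affine Lie algebra as an induction principle. -/
theorem affine_induction {p : Affine θ → Prop} (hadd : ∀ X Y, p X → p Y → p (X + Y))
    (hcartan : ∀ h : AffineCartan H, p (ofCartan θ h))
    (hroot : ∀ (X : Affine θ) γ, IsRootVector X γ → p X) (X : Affine θ) : p X := by
  have hzero : p 0 := by
    have := hcartan 0
    rwa [show ofCartan θ (0 : AffineCartan H) = 0 from Affine.ext (by simp [ofCartan]) rfl rfl]
      at this
  have hcur : ∀ (k : ℤ) (x : 𝔤), p (current θ k x) := fun k x => by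
    refine rootSpace_induction (H := H) (p := fun x => p (current θ k x)) ?_ ?_ ?_ ?_ x
    · rwa [current_zero]
    · intro x y hx hy
      rw [current_add]
      exact hadd _ _ hx hy
    · intro h
      by_cases hk : k = 0
      · subst hk
        exact hcartan (h, 0, 0)
      · exact hroot _ _ (Or.inr ⟨k, h, hk, rfl, rfl⟩)
    · intro α e he
      exact hroot _ _ (Or.inl ⟨k, α, e, he, rfl, rfl⟩)
  obtain ⟨f, a, s⟩ := X
  have h1 : (⟨f, a, s⟩ : Affine θ) = ⟨f, 0, 0⟩ + ofCartan θ ((0 : H), a, s) :=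
    Affine.ext (by simp [ofCartan]) (by simp [ofCartan]) (by simp [ofCartan])
  rw [h1]
  refine hadd _ _ ?_ (hcartan _)
  induction f using Finsupp.induction_linear with
  | zero => exact hzero
  | add f g hf hg =>
    have h2 : (⟨f + g, 0, 0⟩ : Affine θ) = ⟨f, 0, 0⟩ + ⟨g, 0, 0⟩ :=
      Affine.ext rfl (by simp) (by simp)
    rw [h2]
    exact hadd _ _ (hf (by
      refine Affine.ext ?_ ?_ ?_ <;> simp [ofCartan])) (hg (by
      refine Affine.ext ?_ ?_ ?_ <;> simp [ofCartan]))
  | single k x => exact hcur k x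

/-! ### Weight vectors -/

variable {V : Type*} [AddCommGroup V] [Module ℂ V] [LieRingModule (Affine θ) V]

theorem HasWeight.zero (mu : AffineWeight H) : HasWeight θ mu (0 : V) := fun h => by simp

theorem HasWeight.add {mu : AffineWeight H} {v w : V} (hv : HasWeight θ mu v)
    (hw : HasWeight θ mu w) : HasWeight θ mu (v + w) := fun h => by
  rw [lie_add, hv, hw, smul_add]

variable [LieModule ℂ (Affine θ) V]

theorem HasWeight.smul {mu : AffineWeight H} {v : V} (hv : HasWeight θ mu v) (r : ℂ) :
    HasWeight θ mu (r • v) := fun h => by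
  rw [lie_smul, hv, smul_comm]

theorem HasWeight.sub {mu : AffineWeight H} {v w : V} (hv : HasWeight θ mu v)
    (hw : HasWeight θ mu w) : HasWeight θ mu (v - w) := fun h => by
  rw [lie_sub, hv, hw, smul_sub]

theorem HasWeight.lie {mu γ : AffineWeight H} {v : V} (hv : HasWeight θ mu v) {X : Affine θ}
    (hX : IsRootVector X γ) : HasWeight θ (mu + γ) ⁅X, v⁆ := fun h => by
  rw [leibniz_lie, hX.lie_ofCartan, hv, smul_lie, lie_smul, ← add_smul, evalWeight_add, add_comm]

/-- A highest weight vector is a nonzero weight vector which is killed by the positive root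
vectors. -/
theorem isHighestWeightVector_iff (hθ : IsHighestRoot b θ) (lam : AffineWeight H) (v : V) :
    IsHighestWeightVector θ b lam v ↔ v ≠ 0 ∧ HasWeight θ lam v ∧
      ∀ (X : Affine θ) γ, IsRootVector X γ → IsAffineNatComb θ b γ → ⁅X, v⁆ = 0 := by
  constructor
  · rintro ⟨h0, h1, h2, h3⟩
    refine ⟨h0, h1, ?_⟩
    rintro X γ (⟨k, α, e, he, rfl, rfl⟩ | ⟨k, y, hk, rfl, rfl⟩) ⟨-, ⟨n, hn⟩, hγ⟩
    · obtain rfl : k = n := by exact_mod_cast (show (k : ℂ) = n from hn)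
      rcases Nat.eq_zero_or_pos n with rfl | hn'
      · rcases isNatComb_or_neg (b := b) α with h | h
        · exact h2 α h.1 e he
        · exfalso
          refine (rootSystem H).ne_zero α (IsNatComb.eq_zero (b := b) ?_ h.2)
          simpa using hγ
      · exact h3 _ (by exact_mod_cast hn') e
    · obtain rfl : k = n := by exact_mod_cast (show (k : ℂ) = n from hn)
      exact h3 _ (by omega) _
  · rintro ⟨h0, h1, h2⟩
    refine ⟨h0, h1, fun α hα e he => ?_, fun k hk x => ?_⟩
    · refine h2 _ _ (Or.inl ⟨0, α, e, he, rfl, rfl⟩) ⟨rfl, ⟨0, by simp⟩, ?_⟩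
      simpa using isNatComb_of_isPos hα
    · obtain ⟨n, rfl⟩ : ∃ n : ℕ, k = n := ⟨k.toNat, by omega⟩
      refine rootSpace_induction (H := H) (p := fun x => ⁅current θ n x, v⁆ = 0) ?_ ?_ ?_ ?_ x
      · rw [current_zero, zero_lie]
      · intro x y hx hy
        rw [current_add, add_lie, hx, hy, add_zero]
      · intro h
        refine h2 _ _ (Or.inr ⟨n, h, hk.ne', rfl, rfl⟩) ⟨rfl, ⟨n, by simp⟩, ?_⟩
        simpa using (isNatComb_of_isPos hθ.isPos).smul n
      · intro α e he
        refine h2 _ _ (Or.inl ⟨n, α, e, he, rfl, rfl⟩) ⟨rfl, ⟨n, by simp⟩, ?_⟩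
        simpa using hθ.isNatComb_add_smul α (n := n) (by omega)

theorem exists_evalWeight_ne {mu nu : AffineWeight H} (h : mu ≠ nu) :
    ∃ x, evalWeight mu x ≠ evalWeight nu x := by
  by_contra! hall
  refine h (Prod.ext (LinearMap.ext fun y => ?_) (Prod.ext ?_ ?_))
  · simpa [evalWeight] using hall (y, 0, 0)
  · simpa [evalWeight] using hall (0, 1, 0)
  · simpa [evalWeight] using hall (0, 0, 1)

/-- The weight components of an element of a submodule lie in the submodule. -/
theorem LieSubmodule.mem_of_sum_hasWeight_mem (N : LieSubmodule ℂ (Affine θ) V)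
    (s : Finset (AffineWeight H)) : ∀ x : AffineWeight H → V, (∀ mu, HasWeight θ mu (x mu)) →
      ∑ mu ∈ s, x mu ∈ N → ∀ mu ∈ s, x mu ∈ N := by
  classical
  induction s using Finset.induction_on with
  | empty => simp
  | insert nu s hnu ih =>
    intro x hx hsum
    rw [Finset.sum_insert hnu] at hsum
    have h1 : ∀ mu ∈ s, x mu ∈ N := fun mu hmu => by
      obtain ⟨h, hh⟩ := exists_evalWeight_ne (show mu ≠ nu by rintro rfl; exact hnu hmu)
      -- Applying `h - nu(h)` removes the `nu`-component and rescales the others. The scalar is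
      -- nonzero for the chosen `mu`.
      have h2 := ih (fun mu => (evalWeight mu h - evalWeight nu h) • x mu)
        (fun mu => (hx mu).smul _) (by
          have h3 := N.sub_mem (N.lie_mem (x := ofCartan θ h) hsum)
            (N.smul_mem (evalWeight nu h) hsum)
          rw [lie_add, lie_sum, hx nu h, smul_add, Finset.smul_sum, add_sub_add_left_eq_sub,
            ← Finset.sum_sub_distrib] at h3
          rw [Finset.sum_congr rfl fun mu _ => sub_smul (evalWeight mu h) (evalWeight nu h) (x mu)]
          rwa [Finset.sum_congr rfl fun mu _ =>
            congrArg (· - evalWeight nu h • x mu) (hx mu h)] at h3) mu hmu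
      exact (N.smul_mem_iff (sub_ne_zero.mpr hh)).mp h2
    intro mu hmu
    rcases Finset.mem_insert.mp hmu with rfl | hmu
    · have := N.sub_mem hsum (N.sum_mem h1)
      rwa [add_sub_cancel_right] at this
    · exact h1 mu hmu

variable (θ V) in
/-- The span of the weight vectors whose weights satisfy `Q`. -/
def weightSpan (Q : AffineWeight H → Prop) : Submodule ℂ V :=
  Submodule.span ℂ {v | ∃ mu, Q mu ∧ HasWeight θ mu v}

theorem exists_sum_of_mem_weightSpan {Q : AffineWeight H → Prop} {v : V}
    (hv : v ∈ weightSpan θ V Q) : ∃ f : AffineWeight H →₀ V, (∀ mu, HasWeight θ mu (f mu)) ∧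
      (∀ mu, f mu ≠ 0 → Q mu) ∧ f.sum (fun _ w => w) = v := by
  classical
  induction hv using Submodule.span_induction with
  | mem v hv =>
    obtain ⟨mu, hmu, h⟩ := hv
    refine ⟨Finsupp.single mu v, fun nu => ?_, fun nu hnu => ?_, by simp⟩
    · rw [Finsupp.single_apply]
      split_ifs with he
      · exact he ▸ h
      · exact HasWeight.zero nu
    · rw [Finsupp.single_apply] at hnu
      by_cases he : mu = nu
      · exact he ▸ hmu
      · simp [he] at hnu
  | zero => exact ⟨0, fun mu => HasWeight.zero mu, by simp, by simp⟩
  | add v w _ _ hv hw =>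
    obtain ⟨f, hf, hf', rfl⟩ := hv
    obtain ⟨g, hg, hg', rfl⟩ := hw
    refine ⟨f + g, fun mu => (hf mu).add (hg mu), fun mu hmu => ?_,
      Finsupp.sum_add_index' (fun _ => rfl) fun _ _ _ => rfl⟩
    by_cases h : f mu = 0
    · refine hg' mu fun h' => hmu ?_
      simp [h, h']
    · exact hf' mu h
  | smul r v _ hv =>
    obtain ⟨f, hf, hf', rfl⟩ := hv
    refine ⟨r • f, fun mu => (hf mu).smul r, fun mu hmu => hf' mu fun h => hmu ?_, ?_⟩
    · simp [h]
    · rw [Finsupp.sum_smul_index' fun _ => rfl, Finsupp.smul_sum]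

/-- The weight of a nonzero weight vector in `weightSpan θ V Q` satisfies `Q`. -/
theorem HasWeight.of_mem_weightSpan {Q : AffineWeight H → Prop} {v : V} {mu : AffineWeight H}
    (hv : HasWeight θ mu v) (h : v ∈ weightSpan θ V Q) (h0 : v ≠ 0) : Q mu := by
  classical
  obtain ⟨f, hf, hf', hsum⟩ := exists_sum_of_mem_weightSpan h
  refine hf' mu fun hz => h0 ?_
  -- The decomposition of `v` minus `v` itself is a sum of weight vectors equal to zero.
  -- Independence, the case of the zero submodule, makes each component vanish.
  let g : AffineWeight H →₀ V := f - Finsupp.single mu v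
  have hg : ∀ nu, HasWeight θ nu (g nu) := fun nu => by
    change HasWeight θ nu (f nu - Finsupp.single mu v nu)
    refine (hf nu).sub ?_
    rw [Finsupp.single_apply]
    split_ifs with he
    · exact he ▸ hv
    · exact HasWeight.zero nu
  have hgsum : ∑ nu ∈ g.support, g nu = 0 := by
    have h1 : g.sum (fun _ w => w) = f.sum (fun _ w => w) - v := by
      rw [Finsupp.sum_sub_index (fun _ _ _ => rfl), Finsupp.sum_single_index rfl]
    rw [hsum, sub_self] at h1
    exact h1
  have hg0 : g mu = 0 := by
    by_contra hne
    have := LieSubmodule.mem_of_sum_hasWeight_mem (⊥ : LieSubmodule ℂ (Affine θ) V) g.support g hg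
      (by rw [hgsum]; exact zero_mem _) mu (Finsupp.mem_support_iff.mpr hne)
    exact hne (by simpa using this)
  have h2 : g mu = f mu - v := by simp [g]
  rw [hg0, hz, zero_sub, eq_comm, neg_eq_zero] at h2
  exact h2

theorem weightSpan_mono {Q Q' : AffineWeight H → Prop} (h : ∀ mu, Q mu → Q' mu) :
    weightSpan θ V Q ≤ weightSpan θ V Q' :=
  Submodule.span_mono fun _ ⟨mu, hmu, hv⟩ => ⟨mu, h mu hmu, hv⟩

/-! ### Highest weight modules -/

/-- The vectors obtained from `w` by repeatedly applying negative root vectors. -/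
inductive Descendant (b : (rootSystem H).Base) (w : V) : V → Prop
  | refl : Descendant b w w
  | step (X : Affine θ) (γ : AffineWeight H) (y : V) (hX : IsRootVector X γ)
      (hγ : IsAffineNatComb θ b (-γ)) (hy : Descendant b w y) : Descendant b w ⁅X, y⁆

/-- The submodule generated by a highest weight vector is spanned by this vector and by weight
vectors of strictly lower weights. -/
theorem lieSpan_le_of_isHighestWeightVector (hθ : IsHighestRoot b θ) {lam : AffineWeight H} {w : V}
    (hw : IsHighestWeightVector θ b lam w) :
    (LieSubmodule.lieSpan ℂ (Affine θ) {w} : LieSubmodule ℂ (Affine θ) V).toSubmodule ≤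
      Submodule.span ℂ {w} ⊔ weightSpan θ V
        (fun mu => IsAffineNatComb θ b (lam - mu) ∧ mu ≠ lam) := by
  rw [isHighestWeightVector_iff hθ] at hw
  obtain ⟨-, hw1, hw2⟩ := hw
  have hstep : ∀ (X : Affine θ) γ, IsRootVector X γ → IsAffineNatComb θ b (-γ) →
      ∀ y ∈ Submodule.span ℂ {y : V | Descendant (θ := θ) b w y},
        ⁅X, y⁆ ∈ Submodule.span ℂ {y : V | Descendant (θ := θ) b w y} := by
    intro X γ hX hγ y hy
    induction hy using Submodule.span_induction with
    | mem y hy => exact Submodule.subset_span (Descendant.step X γ y hX hγ hy)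
    | zero => simp
    | add y z _ _ hy hz => rw [lie_add]; exact Submodule.add_mem _ hy hz
    | smul r y _ hy => rw [lie_smul]; exact Submodule.smul_mem _ r hy
  -- This replaces the Poincaré-Birkhoff-Witt theorem. Since `Z X y = [Z, X] y + X Z y` and `[Z, X]`
  -- is an arbitrary element, the induction must quantify over all `Z`.
  have hall : ∀ y, Descendant (θ := θ) b w y → ∀ Z : Affine θ,
      ⁅Z, y⁆ ∈ Submodule.span ℂ {y : V | Descendant (θ := θ) b w y} := by
    intro y hy
    induction hy with
    | refl =>
      refine affine_induction ?_ ?_ ?_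
      · intro X Y hX hY
        rw [add_lie]
        exact Submodule.add_mem _ hX hY
      · intro h
        rw [hw1]
        exact Submodule.smul_mem _ _ (Submodule.subset_span Descendant.refl)
      · intro X γ hX
        rcases (hX.nonneg_or_neg hθ).2 with h | h
        · rw [hw2 X γ hX h]
          exact Submodule.zero_mem _
        · exact hstep X γ hX h w (Submodule.subset_span Descendant.refl)
    | step X γ y hX hγ _ ih =>
      intro Z
      rw [leibniz_lie]
      exact Submodule.add_mem _ (ih _) (hstep X γ hX hγ _ (ih Z))
  let P : LieSubmodule ℂ (Affine θ) V :=
    { Submodule.span ℂ {y : V | Descendant (θ := θ) b w y} with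
      lie_mem := fun {Z y} hy => by
        induction hy using Submodule.span_induction with
        | mem y hy => exact hall y hy Z
        | zero => simp
        | add y z _ _ hy hz => rw [lie_add]; exact Submodule.add_mem _ hy hz
        | smul r y _ hy => rw [lie_smul]; exact Submodule.smul_mem _ r hy }
  have hP : LieSubmodule.lieSpan ℂ (Affine θ) {w} ≤ P := by
    rw [LieSubmodule.lieSpan_le, Set.singleton_subset_iff]
    exact Submodule.subset_span Descendant.refl
  refine le_trans (show _ ≤ P.toSubmodule from hP) (Submodule.span_le.mpr fun y hy => ?_)
  have hy' : y = w ∨ ∃ mu, (IsAffineNatComb θ b (lam - mu) ∧ mu ≠ lam) ∧ HasWeight θ mu y := by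
    induction hy with
    | refl => exact Or.inl rfl
    | step X γ y hX hγ _ ih =>
      have hγ0 := (hX.nonneg_or_neg hθ).1
      rcases ih with rfl | ⟨mu, ⟨h1, h2⟩, h3⟩
      · refine Or.inr ⟨lam + γ, ⟨?_, fun h => hγ0 (by simpa using h)⟩, hw1.lie hX⟩
        rwa [show lam - (lam + γ) = -γ by abel]
      · refine Or.inr ⟨mu + γ, ⟨?_, fun h => h2 ?_⟩, h3.lie hX⟩
        · rw [show lam - (mu + γ) = (lam - mu) + -γ by abel]
          exact h1.add hγ
        · have h4 : IsAffineNatComb θ b (-(lam - mu)) := by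
            rwa [show -(lam - mu) = -γ by rw [← h]; abel]
          exact (sub_eq_zero.mp (h1.eq_zero h4)).symm
  rcases hy' with rfl | ⟨mu, h1, h2⟩
  · exact Submodule.mem_sup_left (Submodule.mem_span_singleton_self _)
  · exact Submodule.mem_sup_right (Submodule.subset_span ⟨mu, h1, h2⟩)

theorem lieSpan_le_weightSpan (hθ : IsHighestRoot b θ) {lam : AffineWeight H} {w : V}
    (hw : IsHighestWeightVector θ b lam w) :
    (LieSubmodule.lieSpan ℂ (Affine θ) {w} : LieSubmodule ℂ (Affine θ) V).toSubmodule ≤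
      weightSpan θ V (fun mu => IsAffineNatComb θ b (lam - mu)) := by
  refine (lieSpan_le_of_isHighestWeightVector hθ hw).trans (sup_le ?_ ?_)
  · rw [Submodule.span_singleton_le_iff_mem]
    refine Submodule.subset_span ⟨lam, ?_, hw.2.1⟩
    change IsAffineNatComb θ b (lam - lam)
    rw [sub_self]
    exact IsAffineNatComb.zero
  · exact weightSpan_mono fun mu h => h.1

/-- The highest weight space of the submodule generated by a highest weight vector is a line. -/
theorem exists_smul_eq_of_mem_lieSpan (hθ : IsHighestRoot b θ) {lam : AffineWeight H} {w v : V}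
    (hw : IsHighestWeightVector θ b lam w) (hv : HasWeight θ lam v)
    (hmem : v ∈ LieSubmodule.lieSpan ℂ (Affine θ) {w}) : ∃ r : ℂ, r • w = v := by
  obtain ⟨y, hy, z, hz, rfl⟩ := Submodule.mem_sup.mp
    (lieSpan_le_of_isHighestWeightVector hθ hw hmem)
  obtain ⟨r, rfl⟩ := Submodule.mem_span_singleton.mp hy
  refine ⟨r, ?_⟩
  have hz' : HasWeight θ lam z := by
    have := hv.sub (hw.2.1.smul r)
    rwa [add_sub_cancel_left] at this
  by_cases h0 : z = 0
  · rw [h0, add_zero]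
  · exact absurd rfl (hz'.of_mem_weightSpan hz h0).2

theorem lieSpan_eq_top_of_isIrreducible [LieModule.IsIrreducible ℂ (Affine θ) V] {w : V}
    (hw : w ≠ 0) : LieSubmodule.lieSpan ℂ (Affine θ) {w} = (⊤ : LieSubmodule ℂ (Affine θ) V) := by
  refine (IsSimpleOrder.eq_bot_or_eq_top _).resolve_left fun h => hw ?_
  have : w ∈ LieSubmodule.lieSpan ℂ (Affine θ) {w} := LieSubmodule.subset_lieSpan rfl
  rw [h] at this
  simpa using this

theorem weightSpan_eq_top_of_isIrreducible (hθ : IsHighestRoot b θ)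
    [LieModule.IsIrreducible ℂ (Affine θ) V] {lam : AffineWeight H} {w : V}
    (hw : IsHighestWeightVector θ b lam w) :
    weightSpan θ V (fun mu => IsAffineNatComb θ b (lam - mu)) = ⊤ := by
  rw [eq_top_iff]
  refine le_trans ?_ (lieSpan_le_weightSpan hθ hw)
  rw [lieSpan_eq_top_of_isIrreducible hw.1]
  exact le_rfl

/-- In a module whose weights are bounded above, every nonzero submodule contains a highest weight
vector. -/
theorem exists_isHighestWeightVector_mem (hθ : IsHighestRoot b θ) {L : AffineWeight H}
    (hV : weightSpan θ V (fun mu => IsAffineNatComb θ b (L - mu)) = ⊤)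
    (N : LieSubmodule ℂ (Affine θ) V) (hN : N ≠ ⊥) :
    ∃ mu, ∃ v ∈ N, IsHighestWeightVector θ b mu v := by
  have hle : ∀ (mu : AffineWeight H) (v : V), HasWeight θ mu v → v ≠ 0 →
      IsAffineNatComb θ b (L - mu) := fun mu v hv h0 =>
    hv.of_mem_weightSpan (by rw [hV]; trivial) h0
  -- The depth below `L` is a natural number on weight vectors. A weight vector of `N` at minimal
  -- depth is killed by positive root vectors, which would reduce the depth.
  have hex : ∃ k : ℕ, ∃ mu, ∃ v ∈ N, v ≠ 0 ∧ HasWeight θ mu v ∧ affineHeight θ b (L - mu) = k := by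
    obtain ⟨y, hy, hy0⟩ : ∃ y ∈ N, y ≠ 0 := by
      by_contra! h
      exact hN ((LieSubmodule.eq_bot_iff N).mpr h)
    have hmem : y ∈ weightSpan θ V (fun mu => IsAffineNatComb θ b (L - mu)) := by rw [hV]; trivial
    obtain ⟨f, hf, hf', rfl⟩ := exists_sum_of_mem_weightSpan hmem
    have hall := LieSubmodule.mem_of_sum_hasWeight_mem N f.support f hf hy
    obtain ⟨mu, hmu⟩ : ∃ mu, f mu ≠ 0 := by
      by_contra! h
      exact hy0 (by simp [Finsupp.sum, h])
    obtain ⟨k, hk, -⟩ := (hf' mu hmu).exists_height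
    exact ⟨k, mu, f mu, hall mu (Finsupp.mem_support_iff.mpr hmu), hmu, hf mu, hk⟩
  classical
  obtain ⟨mu, v, hvN, hv0, hv, hk⟩ := Nat.find_spec hex
  refine ⟨mu, v, hvN, (isHighestWeightVector_iff hθ mu v).mpr ⟨hv0, hv, fun X γ hX hγ => ?_⟩⟩
  by_contra hne
  have h1 := hv.lie hX
  obtain ⟨k, hk', -⟩ := (hle _ _ h1 hne).exists_height
  obtain ⟨l, hl, hl'⟩ := hγ.exists_height
  have hlpos := hl' (hX.nonneg_or_neg hθ).1
  have h2 := Nat.find_min' hex ⟨mu + γ, ⁅X, v⁆, N.lie_mem hvN, hne, h1, hk'⟩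
  rw [show L - (mu + γ) = (L - mu) - γ by abel, map_sub, hk, hl] at hk'
  have h3 : Nat.find hex = k + l := by
    have : ((Nat.find hex : ℕ) : ℂ) = ((k + l : ℕ) : ℂ) := by push_cast; rw [← hk']; ring
    exact_mod_cast this
  omega

end AffineModules

end UntwistedAffine

namespace UntwistedAffine

open LieAlgebra LieAlgebra.IsKilling

/-! ### Simple `sl₂`-triples, local nilpotency and dominance of highest weights. -/

section Integrability

variable {𝔤 : Type*} [LieRing 𝔤] [LieAlgebra ℂ 𝔤] [FiniteDimensional ℂ 𝔤] [LieAlgebra.IsSimple ℂ 𝔤]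
  {H : LieSubalgebra ℂ 𝔤} [H.IsCartanSubalgebra] {θ : H.root} {b : (rootSystem H).Base}

/-! ### The `sl₂`-triples of the simple roots -/

theorem cartan_ext {x y : H} (h : ∀ lam : Module.Dual ℂ H, lam x = lam y) : x = y := by
  rw [← sub_eq_zero, ← Module.forall_dual_apply_eq_zero_iff ℂ]
  exact fun lam => by rw [map_sub, h, sub_self]

theorem lie_ofCartan_mid (a : ℂ) (X : Affine θ) : ⁅ofCartan θ ((0 : H), a, 0), X⁆ = 0 := by
  refine affine_induction (p := fun X => ⁅ofCartan θ ((0 : H), a, 0), X⁆ = 0) ?_ ?_ ?_ X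
  · intro X Y hX hY
    rw [lie_add, hX, hY, add_zero]
  · intro h
    refine Affine.ext ?_ ?_ rfl
    · rw [loop_lie]
      simp [ofCartan, degreeDerivation_single, loopLie_zero_left]
    · rw [central_lie]
      simp [ofCartan, residue_zero_left]
  · intro X γ hX
    have h : γ.2.1 = 0 := by
      rcases hX with ⟨k, α, e, he, rfl, rfl⟩ | ⟨k, h, hk, rfl, rfl⟩ <;> rfl
    rw [hX.lie_ofCartan]
    simp [evalWeight, h]

/-- If `(e|f) = 1`, then `[e, f] = r h`, so `f` is divided by `r`. The cocycle then adds `k (e|f) /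
r = k / r` copies of `c`, which gives `α₀^∨ = c - θ^∨` for `α = -θ` and `k = r = 1`. -/
theorem exists_isSl2Triple_current (α : H.root) (k : ℤ) (r : ℂ) (hr : r ≠ 0) (h : H)
    (hα : (rootSystem H).root α h = 2)
    (hnd : ∀ lam, normalizedDual θ lam ((rootSystem H).root α) = r * lam h) :
    ∃ e f : 𝔤, e ∈ rootSpace H (α : LieModule.Weight ℂ H 𝔤) ∧
      f ∈ rootSpace H (negRoot α : LieModule.Weight ℂ H 𝔤) ∧
      IsSl2Triple (ofCartan θ (h, k * r⁻¹, 0)) (current θ k e) (current θ (-k) f) := by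
  obtain ⟨e, f, he, hf, hef, hlam⟩ := exists_dual_root_vectors θ α
  obtain ⟨h', hh', -⟩ := hlam 0
  have h1 : h' = r • h := cartan_ext fun lam => by
    obtain ⟨h'', hh'', h2⟩ := hlam lam
    rw [show h' = h'' from Subtype.ext (hh'.trans hh''.symm), h2, hnd, map_smul, smul_eq_mul]
  have hf' : f ∈ rootSpace H (negRoot α : LieModule.Weight ℂ H 𝔤) := hf
  have hf2 := Submodule.smul_mem (rootSpace H (negRoot α : LieModule.Weight ℂ H 𝔤)).toSubmodule
    r⁻¹ hf'
  have e1 : IsRootVector (current θ k e) ((rootSystem H).root α, 0, (k : ℂ)) :=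
    Or.inl ⟨k, α, e, he, rfl, rfl⟩
  have e2 : IsRootVector (current θ (-k) (r⁻¹ • f))
      ((rootSystem H).root (negRoot α), 0, ((-k : ℤ) : ℂ)) :=
    Or.inl ⟨-k, negRoot α, _, hf2, rfl, rfl⟩
  refine ⟨e, r⁻¹ • f, he, hf2, ⟨fun h0 => ?_, ?_, ?_, ?_⟩⟩
  · have h2 := congrArg (fun X : Affine θ => X.loop 0) h0
    have h3 : h = 0 := by simpa [ofCartan] using h2
    rw [h3, map_zero] at hα
    exact two_ne_zero hα.symm
  · rw [lie_current_current, lie_smul, ← hh', h1, map_smul, hef, add_neg_cancel, if_pos rfl]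
    refine Affine.ext ?_ ?_ ?_ <;> simp [current, ofCartan, smul_smul, hr]
  · rw [e1.lie_ofCartan, ← Nat.cast_smul_eq_nsmul ℂ, evalWeight, hα]
    simp
  · rw [e2.lie_ofCartan, root_negRoot, ← Nat.cast_smul_eq_nsmul ℂ, ← neg_smul, evalWeight,
      LinearMap.neg_apply, hα]
    simp

/-- On a current, repeated brackets with `tᵃ y` are currents of powers of `ad y`, up to a central
term. A bracket with a Cartan element gives a current, so one further step covers that case. -/
theorem maxGenEigenspace_toEnd_current_eq_top {y : 𝔤} (hy : IsNilpotent (LieAlgebra.ad ℂ 𝔤 y))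
    (a : ℤ) : (LieModule.toEnd ℂ (Affine θ) (Affine θ) (current θ a y)).maxGenEigenspace 0 = ⊤ := by
  obtain ⟨N, hN⟩ := hy
  have hcur : ∀ (k : ℤ) (x : 𝔤), current θ k x ∈
      (LieModule.toEnd ℂ (Affine θ) (Affine θ) (current θ a y)).maxGenEigenspace 0 := by
    intro k x
    have h : ∀ n : ℕ, ∃ c : ℂ,
        ((LieModule.toEnd ℂ (Affine θ) (Affine θ) (current θ a y)) ^ n) (current θ k x) =
          current θ (n * a + k) (((LieAlgebra.ad ℂ 𝔤 y) ^ n) x) + ofCartan θ ((0 : H), c, 0) := by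
      intro n
      induction n with
      | zero =>
        refine ⟨0, ?_⟩
        have : ofCartan θ ((0 : H), 0, 0) = 0 :=
          Affine.ext (by simp [ofCartan]) rfl rfl
        simp [this]
      | succ n ih =>
        obtain ⟨c, hc⟩ := ih
        refine ⟨if a + (n * a + k) = 0 then
          a * normalizedForm θ y (((LieAlgebra.ad ℂ 𝔤 y) ^ n) x) else 0, ?_⟩
        rw [pow_succ', Module.End.mul_apply, hc, LieModule.toEnd_apply_apply, lie_add,
          ← lie_skew _ (ofCartan θ _), lie_ofCartan_mid, neg_zero, add_zero, lie_current_current,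
          pow_succ', Module.End.mul_apply, LieAlgebra.ad_apply,
          show a + (n * a + k) = ((n + 1 : ℕ) : ℤ) * a + k by push_cast; ring]
    obtain ⟨c, hc⟩ := h N
    rw [Module.End.mem_maxGenEigenspace]
    -- After `N` steps only a multiple of `c` can remain, and the extra step kills it.
    refine ⟨N + 1, ?_⟩
    rw [zero_smul, sub_zero, pow_succ', Module.End.mul_apply, hc, hN, LinearMap.zero_apply,
      current_zero, zero_add, LieModule.toEnd_apply_apply, ← lie_skew, lie_ofCartan_mid, neg_zero]
  rw [eq_top_iff]
  rintro X -
  refine affine_induction (p := fun X => X ∈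
    (LieModule.toEnd ℂ (Affine θ) (Affine θ) (current θ a y)).maxGenEigenspace 0) ?_ ?_ ?_ X
  · exact fun X Y hX hY => Submodule.add_mem _ hX hY
  · intro h
    have h1 := Submodule.add_mem _ (hcur a ⁅(h.1 : 𝔤), y⁆)
      (Submodule.smul_mem _ (h.2.2 * a) (hcur a y))
    rw [← lie_ofCartan_current, Module.End.mem_maxGenEigenspace] at h1
    obtain ⟨n, hn⟩ := h1
    rw [Module.End.mem_maxGenEigenspace]
    refine ⟨n + 1, ?_⟩
    rw [zero_smul, sub_zero] at hn ⊢
    rw [pow_succ, Module.End.mul_apply, LieModule.toEnd_apply_apply, ← lie_skew, map_neg, hn,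
      neg_zero]
  · rintro X γ (⟨k, α, e, he, rfl, rfl⟩ | ⟨k, h, hk, rfl, rfl⟩)
    exacts [hcur _ _, hcur _ _]

variable (θ b) in
/-- `e` and `f` are root vectors that form an `sl₂`-triple with the `i`-th simple coroot. -/
structure IsSimpleTriple (i : Option b.support) (e f : Affine θ) : Prop where
  sl2 : IsSl2Triple (ofCartan θ (simpleCoroot θ b i)) e f
  root_e : IsRootVector e (simpleRoot θ b i)
  root_f : IsRootVector f (-simpleRoot θ b i)
  nilpotent : (LieModule.toEnd ℂ (Affine θ) (Affine θ) f).maxGenEigenspace 0 = ⊤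
  exists_smul_eq : ∀ (X : Affine θ) (c : ℂ), IsRootVector X (c • simpleRoot θ b i) →
    IsAffineNatComb θ b (c • simpleRoot θ b i) → ∃ s : ℂ, X = s • e

/-- A simple root is real, so its finite part is a root. A root proportional to it is therefore plus
or minus itself, since imaginary roots have zero finite part. Positivity excludes the minus sign,
and root spaces are lines. -/
theorem exists_isSimpleTriple_aux {i : Option b.support} (α : H.root) (k : ℤ) {e f : 𝔤}
    (hi : simpleRoot θ b i = ((rootSystem H).root α, 0, (k : ℂ)))
    (he : e ∈ rootSpace H (α : LieModule.Weight ℂ H 𝔤))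
    (hf : f ∈ rootSpace H (negRoot α : LieModule.Weight ℂ H 𝔤))
    (h : IsSl2Triple (ofCartan θ (simpleCoroot θ b i)) (current θ k e) (current θ (-k) f)) :
    IsSimpleTriple θ b i (current θ k e) (current θ (-k) f) where
  sl2 := h
  root_e := Or.inl ⟨k, α, e, he, rfl, hi⟩
  root_f := Or.inl ⟨-k, negRoot α, f, hf, rfl, by rw [hi, root_negRoot]; simp⟩
  nilpotent := maxGenEigenspace_toEnd_current_eq_top
    (LieAlgebra.isNilpotent_ad_of_mem_rootSpace H (H.isNonZero_coe_root (negRoot α)) hf) _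
  exists_smul_eq := by
    intro X c hX hc
    have he0 : e ≠ 0 := fun h0 => h.e_ne_zero (by rw [h0, current_zero])
    have hpos := isAffineNatComb_simpleRoot (θ := θ) i
    have hne := simpleRoot_ne_zero (θ := θ) i
    rw [hi] at hX hc hpos hne
    rcases hX with ⟨l, β, x, hx, rfl, hγ⟩ | ⟨l, y, hl, rfl, hγ⟩
    · have h1 : c • (rootSystem H).root α = (rootSystem H).root β :=
        congrArg (fun γ : AffineWeight H => γ.1) hγ
      have h2 : c * k = l := congrArg (fun γ : AffineWeight H => γ.2.2) hγ
      rcases eq_neg_or_eq_of_eq_smul (α : LieModule.Weight ℂ H 𝔤) (β : LieModule.Weight ℂ H 𝔤)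
        (H.isNonZero_coe_root β) c (funext fun y => (DFunLike.congr_fun h1 y).symm) with h3 | h3
      · exfalso
        obtain rfl : β = negRoot α := Subtype.ext h3
        rw [root_negRoot] at h1
        have h4 : c = -1 := by
          have : (c + 1) • (rootSystem H).root α = 0 := by rw [add_smul, h1]; simp
          rcases smul_eq_zero.mp this with h | h
          · exact eq_neg_of_add_eq_zero_left h
          · exact absurd h ((rootSystem H).ne_zero α)
        rw [h4, neg_one_smul] at hc
        exact hne (hpos.eq_zero hc)
      · obtain rfl : β = α := Subtype.ext h3
        have h4 : c = 1 := by
          have : (c - 1) • (rootSystem H).root β = 0 := by rw [sub_smul, h1]; simp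
          rcases smul_eq_zero.mp this with h | h
          · exact sub_eq_zero.mp h
          · exact absurd h ((rootSystem H).ne_zero β)
        rw [h4, one_mul] at h2
        obtain rfl : k = l := by exact_mod_cast h2
        obtain ⟨s, rfl⟩ := exists_smul_eq_of_mem_rootSpace β he hx he0
        exact ⟨s, current_smul _ _ _⟩
    · exfalso
      have h1 : c • (rootSystem H).root α = 0 := congrArg (fun γ : AffineWeight H => γ.1) hγ
      have h2 : c * k = l := congrArg (fun γ : AffineWeight H => γ.2.2) hγ
      rcases smul_eq_zero.mp h1 with h | h
      · rw [h, zero_mul] at h2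
        exact hl (by exact_mod_cast h2.symm)
      · exact (rootSystem H).ne_zero α h

variable (θ) in
theorem exists_isSimpleTriple (i : Option b.support) : ∃ e f, IsSimpleTriple θ b i e f := by
  rcases i with _ | i
  · obtain ⟨e, f, he, hf, h⟩ := exists_isSl2Triple_current (θ := θ) (negRoot θ) 1 1 one_ne_zero
      (-(rootSystem H).coroot θ) 
      (by rw [root_negRoot]; simpa using root_apply_coroot (H.isNonZero_coe_root θ)) (fun lam => by
        rw [root_negRoot, ← neg_one_smul ℂ, normalizedDual_comm, normalizedDual_smul_left,
          normalizedDual_comm, normalizedDual_root]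
        simp)
    refine ⟨_, _, exists_isSimpleTriple_aux (negRoot θ) 1 ?_ he hf ?_⟩
    · rw [root_negRoot]
      simp [simpleRoot]
    · simpa [simpleCoroot] using h
  · obtain ⟨r, hr, hr'⟩ := exists_normalizedDual_root θ (i : H.root)
    obtain ⟨e, f, he, hf, h⟩ := exists_isSl2Triple_current (θ := θ) (i : H.root) 0 (r : ℂ)
      (by exact_mod_cast hr.ne') ((rootSystem H).coroot i)
      (root_apply_coroot (H.isNonZero_coe_root (i : H.root))) hr'
    refine ⟨_, _, exists_isSimpleTriple_aux (i : H.root) 0 ?_ he hf ?_⟩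
    · simp [simpleRoot]
    · simpa [simpleCoroot] using h

/-- A root between zero and a multiple of a simple root is a multiple of this simple root. -/
theorem exists_eq_smul_simpleRoot {i : Option b.support} {γ : AffineWeight H} {N : ℕ}
    (h : IsAffineNatComb θ b γ) (h' : IsAffineNatComb θ b (N • simpleRoot θ b i - γ)) :
    ∃ c : ℂ, γ = c • simpleRoot θ b i := by
  classical
  obtain ⟨h1, ⟨n, hn⟩, h2⟩ := h
  obtain ⟨-, ⟨n', hn'⟩, h2'⟩ := h'
  rcases i with _ | i
  · have h3 : γ.1 + γ.2.2 • (rootSystem H).root θ = 0 := by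
      refine h2.eq_zero ?_
      convert h2' using 1
      simp only [simpleRoot, Prod.fst_sub, Prod.snd_sub, Prod.smul_fst, Prod.smul_snd, smul_neg]
      rw [sub_smul, nsmul_eq_mul, mul_one, Nat.cast_smul_eq_nsmul]
      abel
    refine ⟨γ.2.2, Prod.ext ?_ (Prod.ext ?_ ?_)⟩
    · simpa [simpleRoot] using eq_neg_of_add_eq_zero_left h3
    · simpa [simpleRoot] using h1
    · simp [simpleRoot]
  · have h3 : γ.2.2 = 0 := by
      simp only [simpleRoot, Prod.snd_sub, Prod.smul_snd, hn] at hn'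
      have : ((n + n' : ℕ) : ℂ) = 0 := by push_cast; rw [← hn']; simp
      have : n = 0 := by have := Nat.cast_eq_zero.mp this; omega
      rw [hn, this, Nat.cast_zero]
    refine ⟨b.toWeightBasis.coord i γ.1, Prod.ext ?_ (Prod.ext ?_ ?_)⟩
    · refine b.toWeightBasis.ext_elem fun j => ?_
      obtain ⟨k, hk⟩ := h2 j
      obtain ⟨k', hk'⟩ := h2' j
      simp only [simpleRoot, Prod.fst_sub, Prod.snd_sub, Prod.smul_fst, Prod.smul_snd, h3, zero_smul,
        smul_zero, add_zero, sub_zero, map_sub, map_nsmul, coord_root_support] at hk hk' ⊢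
      rw [← Module.Basis.coord_apply, ← Module.Basis.coord_apply, map_smul, coord_root_support]
      by_cases hij : i = j
      · rw [if_pos hij, hij]
        simp
      · rw [if_neg hij, hk] at hk'
        have : ((k + k' : ℕ) : ℂ) = 0 := by push_cast; rw [← hk']; simp
        have : k = 0 := by have := Nat.cast_eq_zero.mp this; omega
        rw [hk, this, if_neg hij]
        simp
    · simpa [simpleRoot] using h1
    · simpa [simpleRoot] using h3

/-! ### Integrable modules -/

variable {V : Type*} [AddCommGroup V] [Module ℂ V] [LieRingModule (Affine θ) V]
  [LieModule ℂ (Affine θ) V]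

theorem HasWeight.toEnd_pow {mu γ : AffineWeight H} {v : V} (hv : HasWeight θ mu v) {X : Affine θ}
    (hX : IsRootVector X γ) (n : ℕ) :
    HasWeight θ (mu + n • γ) ((LieModule.toEnd ℂ (Affine θ) V X ^ n) v) := by
  induction n with
  | zero => simpa using hv
  | succ n ih =>
    rw [pow_succ', Module.End.mul_apply, succ_nsmul, ← add_assoc]
    exact ih.lie hX

theorem IsSimpleTriple.hasPrimitiveVectorWith (hθ : IsHighestRoot b θ) {i : Option b.support}
    {e f : Affine θ} (h : IsSimpleTriple θ b i e f) {lam : AffineWeight H} {v : V}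
    (hv : IsHighestWeightVector θ b lam v) :
    h.sl2.HasPrimitiveVectorWith v (evalWeight lam (simpleCoroot θ b i)) where
  ne_zero := hv.1
  lie_h := hv.2.1 _
  lie_e := ((isHighestWeightVector_iff hθ lam v).mp hv).2.2 e _ h.root_e
    (isAffineNatComb_simpleRoot i)

/-- The simple lowering operators are locally nilpotent on the irreducible modules with dominant
integral highest weight. -/
theorem IsSimpleTriple.maxGenEigenspace_eq_top (hθ : IsHighestRoot b θ) {i : Option b.support}
    {e f : Affine θ} (h : IsSimpleTriple θ b i e f) {lam : AffineWeight H}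
    (hlam : IsDominantIntegral θ b lam) (hV : IsIrreducibleHighestWeight θ b V lam) :
    (LieModule.toEnd ℂ (Affine θ) V f).maxGenEigenspace 0 = ⊤ := by
  obtain ⟨hirr, v, hv⟩ := hV
  obtain ⟨N, hN⟩ := hlam i
  have hprim := h.hasPrimitiveVectorWith hθ hv
  rw [hN] at hprim
  have htop := weightSpan_eq_top_of_isIrreducible hθ hv
  have hv' := (isHighestWeightVector_iff hθ lam v).mp hv
  set u := (LieModule.toEnd ℂ (Affine θ) V f ^ (N + 1)) v with hu
  have hwt : HasWeight θ (lam + (N + 1) • -simpleRoot θ b i) u := hv'.2.1.toEnd_pow h.root_f _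
  -- A nonzero `u` would be a highest weight vector: weights at most `lam` leave only multiples of
  -- `e` to check, and `e u = 0` since the factor `N - N` vanishes. By irreducibility `lam` would
  -- then lie below the weight of `u`, which is impossible.
  have hu0 : u = 0 := by
    by_contra hne
    have hsing : IsHighestWeightVector θ b (lam + (N + 1) • -simpleRoot θ b i) u := by
      refine (isHighestWeightVector_iff hθ _ u).mpr ⟨hne, hwt, fun X γ hX hγ => ?_⟩
      by_contra hX0
      have h1 := (hwt.lie hX).of_mem_weightSpan (by rw [htop]; trivial) hX0
      rw [show lam - (lam + (N + 1) • -simpleRoot θ b i + γ) = (N + 1) • simpleRoot θ b i - γ by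
        rw [smul_neg]; abel] at h1
      obtain ⟨c, rfl⟩ := exists_eq_smul_simpleRoot hγ h1
      obtain ⟨s, rfl⟩ := h.exists_smul_eq X c hX hγ
      refine hX0 ?_
      rw [smul_lie, hprim.lie_e_pow_succ_toEnd_f, sub_self, mul_zero, zero_smul, smul_zero]
    have h1 := hv'.2.1.of_mem_weightSpan
      (by rw [weightSpan_eq_top_of_isIrreducible hθ hsing]; trivial) hv.1
    rw [show lam + (N + 1) • -simpleRoot θ b i - lam = -((N + 1) • simpleRoot θ b i) by
      rw [smul_neg]; abel] at h1
    have h2 := ((isAffineNatComb_simpleRoot (θ := θ) i).nsmul (N + 1)).eq_zero h1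
    rw [← Nat.cast_smul_eq_nsmul ℂ] at h2
    rcases smul_eq_zero.mp h2 with h3 | h3
    · exact absurd (Nat.cast_eq_zero.mp h3) (by omega)
    · exact simpleRoot_ne_zero i h3
  -- Because `ad f` is locally nilpotent, the vectors killed by some power of `f` form a submodule.
  -- It contains `v`, so it is all of `V`.
  let P : LieSubmodule ℂ (Affine θ) V :=
    { (LieModule.toEnd ℂ (Affine θ) V f).maxGenEigenspace 0 with
      lie_mem := fun {X m} hm => by
        have h1 := LieModule.lie_mem_maxGenEigenspace_toEnd (R := ℂ) (χ₁ := 0) (χ₂ := 0) (x := f)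
          (y := X) (m := m) (by rw [h.nilpotent]; trivial) hm
        rw [add_zero] at h1
        exact h1 }
  have hP : (⊤ : LieSubmodule ℂ (Affine θ) V) ≤ P := by
    rw [← lieSpan_eq_top_of_isIrreducible hv.1, LieSubmodule.lieSpan_le, Set.singleton_subset_iff]
    change v ∈ (LieModule.toEnd ℂ (Affine θ) V f).maxGenEigenspace 0
    rw [Module.End.mem_maxGenEigenspace]
    exact ⟨N + 1, by rw [zero_smul, sub_zero]; exact hu0⟩
  exact eq_top_iff.mpr hP

theorem maxGenEigenspace_tensor_eq_top {V' : Type*} [AddCommGroup V'] [Module ℂ V']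
    [LieRingModule (Affine θ) V'] [LieModule ℂ (Affine θ) V'] {X : Affine θ}
    (h : (LieModule.toEnd ℂ (Affine θ) V X).maxGenEigenspace 0 = ⊤)
    (h' : (LieModule.toEnd ℂ (Affine θ) V' X).maxGenEigenspace 0 = ⊤) :
    (LieModule.toEnd ℂ (Affine θ) (V ⊗[ℂ] V') X).maxGenEigenspace 0 = ⊤ := by
  have h1 := LieModule.weight_vector_multiplication V V' (V ⊗[ℂ] V')
    (LieModuleHom.id : V ⊗[ℂ] V' →ₗ⁅ℂ, Affine θ⁆ V ⊗[ℂ] V') (0 : ℂ) 0 X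
  rw [add_zero] at h1
  rw [eq_top_iff]
  rintro x -
  induction x using TensorProduct.induction_on with
  | zero => exact zero_mem _
  | add x y hx hy => exact add_mem hx hy
  | tmul v v' =>
    exact h1 ⟨⟨v, by rw [h]; trivial⟩ ⊗ₜ ⟨v', by rw [h']; trivial⟩, rfl⟩

/-- If the simple lowering operators are locally nilpotent, the weights of highest weight vectors
are dominant integral. -/
theorem isDominantIntegral_of_isHighestWeightVector (hθ : IsHighestRoot b θ)
    (hV : ∀ i e f, IsSimpleTriple θ b i e f →
      (LieModule.toEnd ℂ (Affine θ) V f).maxGenEigenspace 0 = ⊤) {lam : AffineWeight H} {v : V}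
    (hv : IsHighestWeightVector θ b lam v) : IsDominantIntegral θ b lam := by
  intro i
  obtain ⟨e, f, h⟩ := exists_isSimpleTriple θ i
  have hprim := h.hasPrimitiveVectorWith hθ hv
  have hmem : v ∈ (LieModule.toEnd ℂ (Affine θ) V f).maxGenEigenspace 0 := by
    rw [hV i e f h]; trivial
  rw [Module.End.mem_maxGenEigenspace] at hmem
  rw [zero_smul, sub_zero] at hmem
  obtain ⟨n, hn₁, hn₂⟩ := Nat.exists_not_and_succ_of_not_zero_of_exists
    (p := fun n => (LieModule.toEnd ℂ (Affine θ) V f ^ n) v = 0) hprim.ne_zero hmem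
  refine ⟨n, ?_⟩
  -- At the last nonzero power of `f`, the `sl₂`-relation gives `(n + 1)(lam(αᵢ^∨) - n) = 0`.
  have := hprim.lie_e_pow_succ_toEnd_f n
  rw [hn₂, lie_zero, eq_comm, smul_eq_zero_iff_left hn₁, mul_eq_zero, sub_eq_zero] at this
  exact this.resolve_left <| Nat.cast_add_one_ne_zero n

theorem HasWeight.tmul {V' : Type*} [AddCommGroup V'] [Module ℂ V']
    [LieRingModule (Affine θ) V'] [LieModule ℂ (Affine θ) V'] {mu mu' : AffineWeight H} {v : V}
    {v' : V'} (h : HasWeight θ mu v) (h' : HasWeight θ mu' v') :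
    HasWeight θ (mu + mu') (v ⊗ₜ[ℂ] v') := fun x => by
  rw [TensorProduct.LieModule.lie_tmul_right, h, h', evalWeight_add, add_smul,
    TensorProduct.smul_tmul', TensorProduct.tmul_smul]

theorem weightSpan_tensor_eq_top {V' : Type*} [AddCommGroup V'] [Module ℂ V']
    [LieRingModule (Affine θ) V'] [LieModule ℂ (Affine θ) V'] {L L' : AffineWeight H}
    (h : weightSpan θ V (fun mu => IsAffineNatComb θ b (L - mu)) = ⊤)
    (h' : weightSpan θ V' (fun mu => IsAffineNatComb θ b (L' - mu)) = ⊤) :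
    weightSpan θ (V ⊗[ℂ] V') (fun mu => IsAffineNatComb θ b (L + L' - mu)) = ⊤ := by
  rw [eq_top_iff]
  rintro x -
  induction x using TensorProduct.induction_on with
  | zero => exact zero_mem _
  | add x y hx hy => exact add_mem hx hy
  | tmul v v' =>
    have hv : v ∈ weightSpan θ V (fun mu => IsAffineNatComb θ b (L - mu)) := by rw [h]; trivial
    have hv' : v' ∈ weightSpan θ V' (fun mu => IsAffineNatComb θ b (L' - mu)) := by rw [h']; trivial
    induction hv using Submodule.span_induction with
    | zero => rw [TensorProduct.zero_tmul]; exact zero_mem _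
    | add v w _ _ hv hw => rw [TensorProduct.add_tmul]; exact add_mem hv hw
    | smul r v _ hv => rw [← TensorProduct.smul_tmul']; exact Submodule.smul_mem _ r hv
    | mem v hv =>
      obtain ⟨mu, hmu, hv⟩ := hv
      induction hv' using Submodule.span_induction with
      | zero => rw [TensorProduct.tmul_zero]; exact zero_mem _
      | add v w _ _ hv hw => rw [TensorProduct.tmul_add]; exact add_mem hv hw
      | smul r v _ hv => rw [TensorProduct.tmul_smul]; exact Submodule.smul_mem _ r hv
      | mem v' hv' =>
        obtain ⟨mu', hmu', hv'⟩ := hv'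
        refine Submodule.subset_span ⟨mu + mu', ?_, hv.tmul hv'⟩
        change IsAffineNatComb θ b (L + L' - (mu + mu'))
        rw [show L + L' - (mu + mu') = (L - mu) + (L' - mu') by abel]
        exact hmu.add hmu'

end Integrability

end UntwistedAffine

namespace UntwistedAffine

open LieAlgebra LieAlgebra.IsKilling

/-! ### The operator `L₀ + d` on modules with weights bounded above, and modes on tensor factors. -/

section SugawaraModules

variable {𝔤 : Type*} [LieRing 𝔤] [LieAlgebra ℂ 𝔤] [FiniteDimensional ℂ 𝔤] [LieAlgebra.IsSimple ℂ 𝔤]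
  {H : LieSubalgebra ℂ 𝔤} [H.IsCartanSubalgebra] {θ : H.root} {b : (rootSystem H).Base}

/-! ### Smooth representations attached to modules -/

theorem SmoothRep.sugawaraL0_eq {M : Type*} [AddCommGroup M] [Module ℂ M] (R : SmoothRep θ M)
    (φ : Affine θ → Module.End ℂ M) (hφ : ∀ k x, φ (current θ k x) = R.mode k x) (v : M) :
    sugawaraL0 θ b φ R.level v = R.sugawaraZero b v := by
  have h : ∀ j : ℕ, (-(1 + j : ℤ)) = -1 - j := fun j => by ring
  have h' : ∀ j : ℕ, (j + 1 : ℤ) = 1 + j := fun j => by ring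
  simp only [sugawaraL0, hφ, SmoothRep.sugawaraZero, SmoothRep.casimirSum, LinearMap.smul_apply,
    LinearMap.add_apply, SmoothRep.pair_apply, locallyFiniteSum, LinearMap.coe_mk, AddHom.coe_mk,
    h, h']

section Module

variable {V : Type*} [AddCommGroup V] [Module ℂ V] [LieRingModule (Affine θ) V]
  [LieModule ℂ (Affine θ) V]

/-- The eigenvalue of `d` is bounded above by that of `L`. On a weight vector `n` steps below this
bound, every mode of degree greater than `n` must vanish. -/
theorem exists_lie_current_eq_zero {L : AffineWeight H}
    (hV : weightSpan θ V (fun mu => IsAffineNatComb θ b (L - mu)) = ⊤) (v : V) :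
    ∃ N : ℕ, ∀ j : ℤ, N ≤ j → ∀ x : 𝔤, ⁅current θ j x, v⁆ = 0 := by
  have hv : v ∈ weightSpan θ V (fun mu => IsAffineNatComb θ b (L - mu)) := by rw [hV]; trivial
  induction hv using Submodule.span_induction with
  | zero => exact ⟨0, fun j _ x => lie_zero _⟩
  | add v w _ _ hv hw =>
    obtain ⟨N, hN⟩ := hv
    obtain ⟨N', hN'⟩ := hw
    refine ⟨max N N', fun j hj x => ?_⟩
    rw [lie_add, hN j (by omega), hN' j (by omega), add_zero]
  | smul r v _ hv =>
    obtain ⟨N, hN⟩ := hv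
    exact ⟨N, fun j hj x => by rw [lie_smul, hN j hj, smul_zero]⟩
  | mem v hv =>
    obtain ⟨mu, ⟨-, ⟨n, hn⟩, -⟩, hv⟩ := hv
    refine ⟨n + 1, fun j hj x => ?_⟩
    have key : ∀ (X : Affine θ) γ, IsRootVector X γ → γ.2.2 = j → ⁅X, v⁆ = 0 := by
      intro X γ hX hγ
      by_contra hne
      obtain ⟨-, ⟨l, hl⟩, -⟩ := (hv.lie hX).of_mem_weightSpan (by rw [hV]; trivial) hne
      rw [Prod.snd_sub, Prod.snd_sub] at hn hl
      rw [Prod.snd_add, Prod.snd_add, hγ, ← sub_sub, hn] at hl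
      have : (n : ℤ) - j = l := by exact_mod_cast hl
      push_cast at hj
      omega
    refine rootSpace_induction (H := H) (p := fun x => ⁅current θ j x, v⁆ = 0) ?_ ?_ ?_ ?_ x
    · rw [current_zero, zero_lie]
    · intro x y hx hy
      rw [current_add, add_lie, hx, hy, add_zero]
    · intro h
      exact key _ _ (Or.inr ⟨j, h, by push_cast at hj; omega, rfl, rfl⟩) rfl
    · intro α e he
      exact key _ _ (Or.inl ⟨j, α, e, he, rfl, rfl⟩) rfl

theorem lie_ofCartan_mid_eq_smul {L : AffineWeight H}
    (hV : weightSpan θ V (fun mu => IsAffineNatComb θ b (L - mu)) = ⊤) (a : ℂ) (v : V) :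
    ⁅ofCartan θ ((0 : H), a, 0), v⁆ = (L.2.1 * a) • v := by
  have hv : v ∈ weightSpan θ V (fun mu => IsAffineNatComb θ b (L - mu)) := by rw [hV]; trivial
  induction hv using Submodule.span_induction with
  | zero => simp
  | add v w _ _ hv hw => rw [lie_add, hv, hw, smul_add]
  | smul r v _ hv => rw [lie_smul, hv, smul_comm]
  | mem v hv =>
    obtain ⟨mu, ⟨h, -, -⟩, hv⟩ := hv
    rw [hv, show L.2.1 = mu.2.1 from sub_eq_zero.mp h]
    simp [evalWeight]

/-- The modes of a module whose weights are bounded above. -/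
def moduleRep {L : AffineWeight H}
    (hV : weightSpan θ V (fun mu => IsAffineNatComb θ b (L - mu)) = ⊤) : SmoothRep θ V where
  mode k :=
    { toFun x := LieModule.toEnd ℂ (Affine θ) V (current θ k x)
      map_add' x y := by rw [current_add, map_add]
      map_smul' r x := by rw [current_smul, map_smul, RingHom.id_apply] }
  level := L.2.1
  mode_mode a c x y v := by
    change ⁅current θ a x, ⁅current θ c y, v⁆⁆ = ⁅current θ c y, ⁅current θ a x, v⁆⁆ +
      ⁅current θ (a + c) ⁅x, y⁆, v⁆ + _
    rw [leibniz_lie, lie_current_current, add_lie, lie_ofCartan_mid_eq_smul hV]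
    have : (if a + c = 0 then (a : ℂ) * L.2.1 * normalizedForm θ x y else 0) =
        L.2.1 * if a + c = 0 then (a : ℂ) * normalizedForm θ x y else 0 := by
      split_ifs <;> ring
    rw [this]
    abel
  smooth := exists_lie_current_eq_zero hV

variable {L : AffineWeight H} (hV : weightSpan θ V (fun mu => IsAffineNatComb θ b (L - mu)) = ⊤)

theorem moduleRep_mode (k : ℤ) (x : 𝔤) (v : V) :
    (moduleRep hV).mode k x v = ⁅current θ k x, v⁆ := rfl

variable (H) in
/-- The degree element `d`. -/
def degreeElement : AffineCartan H := (0, 0, 1)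

theorem lie_degree_current (k : ℤ) (x : 𝔤) :
    ⁅ofCartan θ (degreeElement H), current θ k x⁆ = (k : ℂ) • current θ k x := by
  rw [lie_ofCartan_current]
  simp [degreeElement, current_zero]

theorem lie_degree_mode (k : ℤ) (x : 𝔤) (v : V) :
    ⁅ofCartan θ (degreeElement H), (moduleRep hV).mode k x v⁆ =
      (moduleRep hV).mode k x ⁅ofCartan θ (degreeElement H), v⁆ +
        (k : ℂ) • (moduleRep hV).mode k x v := by
  simp only [moduleRep_mode]
  rw [leibniz_lie, lie_degree_current, smul_lie, add_comm]

theorem ofCartan_eq (h : AffineCartan H) : ofCartan θ h = current θ 0 (h.1 : 𝔤) +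
    ofCartan θ ((0 : H), h.2.1, 0) + h.2.2 • ofCartan θ (degreeElement H) := by
  refine Affine.ext ?_ ?_ ?_ <;> simp [current, ofCartan, degreeElement]

/-- The operator `L₀ + d` of a module. -/
def degreeCasimir : Module.End ℂ V :=
  (moduleRep hV).sugawaraZero b + LieModule.toEnd ℂ (Affine θ) V (ofCartan θ (degreeElement H))

theorem degreeCasimir_apply (v : V) : degreeCasimir hV v =
    (moduleRep hV).sugawaraZero b v + ⁅ofCartan θ (degreeElement H), v⁆ := rfl

/-- The operators `L₁` and `L₋₁` have `d`-degrees `1` and `-1`, so their commutator `2 L₀` has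
degree zero. -/
theorem lie_degree_sugawaraZero (hθ : IsHighestRoot b θ) (hκ : L.2.1 + dualCoxeter θ b ≠ 0)
    (v : V) : ⁅ofCartan θ (degreeElement H), (moduleRep hV).sugawaraZero b v⁆ =
      (moduleRep hV).sugawaraZero b ⁅ofCartan θ (degreeElement H), v⁆ := by
  set D := LieModule.toEnd ℂ (Affine θ) V (ofCartan θ (degreeElement H)) with hD
  have h1 := fun p v => (moduleRep hV).map_sugawara (b := b) (X := D) (c := 1)
    (fun k x v => by rw [one_mul]; exact lie_degree_mode hV k x v) p v
  have h2 := fun v => (moduleRep hV).commutator_sugawara (b := b)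
    (A := (moduleRep hV).sugawara b 0) (fun k x v => by
      rw [(moduleRep hV).sugawara_mode hθ hκ, show 2 * 0 + 1 + k = k + 1 by ring]) v
  have h3 : (2 : ℂ) • D ((moduleRep hV).sugawaraZero b v) =
      (2 : ℂ) • (moduleRep hV).sugawaraZero b (D v) := by
    rw [← map_smul, ← h2, ← h2, map_sub, h1, h1, h1, h1, map_add, map_add, map_smul, map_smul]
    push_cast
    module
  exact smul_right_injective V (two_ne_zero (α := ℂ)) h3

/-- On `tᵏ x`, the commutators with `L₀` and with `d` are `-k tᵏ x` and `k tᵏ x`, and they cancel.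
-/
theorem degreeCasimir_lie (hθ : IsHighestRoot b θ) (hκ : L.2.1 + dualCoxeter θ b ≠ 0)
    (X : Affine θ) (v : V) : degreeCasimir hV ⁅X, v⁆ = ⁅X, degreeCasimir hV v⁆ := by
  have hcur : ∀ (k : ℤ) (x : 𝔤), degreeCasimir hV ⁅current θ k x, v⁆ =
      ⁅current θ k x, degreeCasimir hV v⁆ := fun k x => by
    have h1 := (moduleRep hV).sugawaraZero_mode (b := b) hθ hκ k x v
    have h2 := lie_degree_mode hV k x v
    simp only [moduleRep_mode] at h1 h2
    rw [degreeCasimir_apply, degreeCasimir_apply, h1, h2, lie_add]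
    abel
  refine affine_induction (p := fun X => degreeCasimir hV ⁅X, v⁆ = ⁅X, degreeCasimir hV v⁆)
    ?_ ?_ ?_ X
  · intro X Y hX hY
    rw [add_lie, add_lie, map_add, hX, hY]
  · intro h
    have hd : degreeCasimir hV ⁅ofCartan θ (degreeElement H), v⁆ =
        ⁅ofCartan θ (degreeElement H), degreeCasimir hV v⁆ := by
      rw [degreeCasimir_apply, degreeCasimir_apply, lie_add, lie_degree_sugawaraZero hV hθ hκ]
    rw [ofCartan_eq h]
    simp only [add_lie, smul_lie, map_add, map_smul, hcur, hd, lie_ofCartan_mid_eq_smul hV]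
  · rintro X γ (⟨k, α, e, he, rfl, rfl⟩ | ⟨k, h, hk, rfl, rfl⟩)
    exacts [hcur _ _, hcur _ _]

variable (θ b) in
/-- The eigenvalue of `L₀ + d` on a highest weight vector of weight `mu`. -/
def casimirScalar (mu : AffineWeight H) : ℂ :=
  weightForm θ mu (mu + 2 • rho θ b) / (2 * (mu.2.1 + dualCoxeter θ b))

/-- Only the finite Casimir part of `L₀` survives on a singular vector. The `d`-eigenvalue times
`2(k + h^∨)` is exactly the part of `(mu|mu+2ρ)` that involves `δ` and `Λ₀`. -/
theorem degreeCasimir_of_isHighestWeightVector (hκ : L.2.1 + dualCoxeter θ b ≠ 0)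
    {mu : AffineWeight H} {v : V} (hv : IsHighestWeightVector θ b mu v) :
    degreeCasimir hV v = casimirScalar θ b mu • v := by
  have hnat : IsAffineNatComb θ b (L - mu) :=
    hv.2.1.of_mem_weightSpan (by rw [hV]; trivial) hv.1
  have hlev : mu.2.1 = L.2.1 := (sub_eq_zero.mp hnat.1).symm
  have h1 : (moduleRep hV).sugawaraZero b v =
      (normalizedDual θ mu.1 (mu.1 + 2 • finiteRho b) / (2 * (mu.2.1 + dualCoxeter θ b))) • v := by
    rw [SmoothRep.sugawaraZero, LinearMap.smul_apply,
      (moduleRep hV).casimirSum_eq_pair fun k hk x => hv.2.2.2 k hk x, SmoothRep.pair_apply,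
      casimir_singular (θ := θ) b ((moduleRep hV).mode 0) (fun x y w => ?_) mu.1 v (fun h => ?_)
        (fun α hα e he => hv.2.2.1 α hα e he), smul_smul, hlev]
    · congr 1
      change 1 / (2 * (L.2.1 + dualCoxeter θ b)) * _ = _
      ring
    · have := (moduleRep hV).mode_mode 0 0 x y w
      rw [this]
      simp
    · rw [moduleRep_mode]
      refine (hv.2.1 (h, 0, 0)).trans ?_
      simp [evalWeight]
  rw [degreeCasimir_apply, h1, hv.2.1, ← add_smul]
  congr 1
  rw [← hlev] at hκ
  simp only [casimirScalar, weightForm, evalWeight, degreeElement, Prod.fst_add, Prod.snd_add,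
    Prod.smul_fst, Prod.smul_snd, rho_fst, rho_snd_snd, rho_level, map_zero]
  rw [eq_div_iff (mul_ne_zero two_ne_zero hκ), add_mul, div_mul_cancel₀ _
    (mul_ne_zero two_ne_zero hκ)]
  simp
  ring

theorem degreeCasimir_of_mem_lieSpan (hθ : IsHighestRoot b θ)
    (hκ : L.2.1 + dualCoxeter θ b ≠ 0) {mu : AffineWeight H} {v w : V}
    (hv : IsHighestWeightVector θ b mu v) (hw : w ∈ LieSubmodule.lieSpan ℂ (Affine θ) {v}) :
    degreeCasimir hV w = casimirScalar θ b mu • w := by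
  let P : LieSubmodule ℂ (Affine θ) V :=
    { LinearMap.ker (degreeCasimir hV - casimirScalar θ b mu • 1) with
      lie_mem := fun {X y} hy => by
        have hy' : degreeCasimir hV y - casimirScalar θ b mu • y = 0 := hy
        change degreeCasimir hV ⁅X, y⁆ - casimirScalar θ b mu • ⁅X, y⁆ = 0
        rw [degreeCasimir_lie hV hθ hκ, ← lie_smul, ← lie_sub, hy', lie_zero] }
  have hP : LieSubmodule.lieSpan ℂ (Affine θ) {v} ≤ P := by
    rw [LieSubmodule.lieSpan_le, Set.singleton_subset_iff]
    exact sub_eq_zero.mpr (degreeCasimir_of_isHighestWeightVector hV hκ hv)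
  exact sub_eq_zero.mp (hP hw)

end Module

/-! ### Tensor products -/

namespace SmoothRep

variable {V U : Type*} [AddCommGroup V] [Module ℂ V] [AddCommGroup U] [Module ℂ U]

variable (U) in
/-- The modes acting on the first factor of a tensor product. -/
def rTensor (R : SmoothRep θ V) : SmoothRep θ (V ⊗[ℂ] U) where
  mode k := LinearMap.rTensorHom U ∘ₗ R.mode k
  level := R.level
  mode_mode a c x y w := by
    induction w using TensorProduct.induction_on with
    | zero => simp
    | add w w' hw hw' => simp only [map_add, hw, hw', smul_add]; abel
    | tmul v v' =>
      simp only [LinearMap.comp_apply, LinearMap.coe_rTensorHom, LinearMap.rTensor_tmul,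
        R.mode_mode a c x y v, TensorProduct.add_tmul, TensorProduct.smul_tmul']
  smooth w := by
    induction w using TensorProduct.induction_on with
    | zero => exact ⟨0, fun j _ x => map_zero _⟩
    | add w w' hw hw' =>
      obtain ⟨N, hN⟩ := hw
      obtain ⟨N', hN'⟩ := hw'
      exact ⟨max N N', fun j hj x => by
        rw [map_add, hN j (by omega), hN' j (by omega), add_zero]⟩
    | tmul v v' =>
      obtain ⟨N, hN⟩ := R.smooth v
      exact ⟨N, fun j hj x => by
        simp only [LinearMap.comp_apply, LinearMap.coe_rTensorHom, LinearMap.rTensor_tmul, hN j hj,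
          TensorProduct.zero_tmul]⟩

variable (V) in
/-- The modes acting on the second factor of a tensor product. -/
def lTensor (R : SmoothRep θ U) : SmoothRep θ (V ⊗[ℂ] U) where
  mode k := LinearMap.lTensorHom V ∘ₗ R.mode k
  level := R.level
  mode_mode a c x y w := by
    induction w using TensorProduct.induction_on with
    | zero => simp
    | add w w' hw hw' => simp only [map_add, hw, hw', smul_add]; abel
    | tmul v v' =>
      simp only [LinearMap.comp_apply, LinearMap.coe_lTensorHom, LinearMap.lTensor_tmul,
        R.mode_mode a c x y v', TensorProduct.tmul_add, TensorProduct.tmul_smul]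
  smooth w := by
    induction w using TensorProduct.induction_on with
    | zero => exact ⟨0, fun j _ x => map_zero _⟩
    | add w w' hw hw' =>
      obtain ⟨N, hN⟩ := hw
      obtain ⟨N', hN'⟩ := hw'
      exact ⟨max N N', fun j hj x => by
        rw [map_add, hN j (by omega), hN' j (by omega), add_zero]⟩
    | tmul v v' =>
      obtain ⟨N, hN⟩ := R.smooth v'
      exact ⟨N, fun j hj x => by
        simp only [LinearMap.comp_apply, LinearMap.coe_lTensorHom, LinearMap.lTensor_tmul, hN j hj,
          TensorProduct.tmul_zero]⟩

theorem rTensor_mode_tmul (R : SmoothRep θ V) (k : ℤ) (x : 𝔤) (v : V) (v' : U) :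
    (R.rTensor U).mode k x (v ⊗ₜ v') = R.mode k x v ⊗ₜ v' := rfl

theorem lTensor_mode_tmul (R : SmoothRep θ U) (k : ℤ) (x : 𝔤) (v : V) (v' : U) :
    (R.lTensor V).mode k x (v ⊗ₜ v') = v ⊗ₜ R.mode k x v' := rfl

theorem rTensor_sugawaraZero_tmul (R : SmoothRep θ V) (v : V) (v' : U) :
    (R.rTensor U).sugawaraZero b (v ⊗ₜ v') = R.sugawaraZero b v ⊗ₜ v' := by
  obtain ⟨N, hN⟩ := exists_locallyFiniteSum_eq _ (R.locallyFiniteSeq_pair (-1) 1) v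
  obtain ⟨N', hN'⟩ := exists_locallyFiniteSum_eq _ ((R.rTensor U).locallyFiniteSeq_pair (-1) 1)
    (v ⊗ₜ v')
  rw [sugawaraZero, sugawaraZero, LinearMap.smul_apply, LinearMap.smul_apply, casimirSum,
    casimirSum, LinearMap.add_apply, LinearMap.add_apply, LinearMap.smul_apply,
    LinearMap.smul_apply, hN _ (le_max_left N N'), hN' _ (le_max_right N N')]
  simp only [pair_apply, rTensor_mode_tmul, ← TensorProduct.sum_tmul, TensorProduct.smul_tmul',
    ← TensorProduct.add_tmul]
  rfl

theorem lTensor_sugawaraZero_tmul (R : SmoothRep θ U) (v : V) (v' : U) :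
    (R.lTensor V).sugawaraZero b (v ⊗ₜ v') = v ⊗ₜ R.sugawaraZero b v' := by
  obtain ⟨N, hN⟩ := exists_locallyFiniteSum_eq _ (R.locallyFiniteSeq_pair (-1) 1) v'
  obtain ⟨N', hN'⟩ := exists_locallyFiniteSum_eq _ ((R.lTensor V).locallyFiniteSeq_pair (-1) 1)
    (v ⊗ₜ v')
  rw [sugawaraZero, sugawaraZero, LinearMap.smul_apply, LinearMap.smul_apply, casimirSum,
    casimirSum, LinearMap.add_apply, LinearMap.add_apply, LinearMap.smul_apply,
    LinearMap.smul_apply, hN _ (le_max_left N N'), hN' _ (le_max_right N N')]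
  simp only [pair_apply, lTensor_mode_tmul, ← TensorProduct.tmul_sum, ← TensorProduct.tmul_smul,
    ← TensorProduct.tmul_add]
  rfl

end SmoothRep

end SugawaraModules

end UntwistedAffine

namespace UntwistedAffine

open LieAlgebra LieAlgebra.IsKilling

/-! ### Highest weight vectors of the tensor product under the coset operators. -/

section CosetConstruction

variable {𝔤 : Type*} [LieRing 𝔤] [LieAlgebra ℂ 𝔤] [FiniteDimensional ℂ 𝔤] [LieAlgebra.IsSimple ℂ 𝔤]
  {H : LieSubalgebra ℂ 𝔤} [H.IsCartanSubalgebra] {θ : H.root} {b : (rootSystem H).Base}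

/-! ### The Goddard-Kent-Olive construction on `V(mρ) ⊗ V(nρ)` -/

theorem IsIrreducibleHighestWeight.weightSpan_eq_top (hθ : IsHighestRoot b θ) {V : Type*}
    [AddCommGroup V] [Module ℂ V] [LieRingModule (Affine θ) V] [LieModule ℂ (Affine θ) V]
    {L : AffineWeight H} (hV : IsIrreducibleHighestWeight θ b V L) :
    weightSpan θ V (fun mu => IsAffineNatComb θ b (L - mu)) = ⊤ := by
  obtain ⟨hirr, v, hv⟩ := hV
  exact weightSpan_eq_top_of_isIrreducible hθ hv

theorem IsIrreducibleHighestWeight.degreeCasimir_apply (hθ : IsHighestRoot b θ) {V : Type*}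
    [AddCommGroup V] [Module ℂ V] [LieRingModule (Affine θ) V] [LieModule ℂ (Affine θ) V]
    {L : AffineWeight H} (hV : IsIrreducibleHighestWeight θ b V L)
    (hκ : L.2.1 + dualCoxeter θ b ≠ 0) (v : V) :
    degreeCasimir (hV.weightSpan_eq_top hθ) v = casimirScalar θ b L • v := by
  have hV' := hV
  obtain ⟨hirr, w, hw⟩ := hV'
  refine degreeCasimir_of_mem_lieSpan _ hθ hκ hw ?_
  rw [lieSpan_eq_top_of_isIrreducible hw.1]
  trivial

theorem nsmul_rho_level (n : ℕ) : (n • rho θ b).2.1 = n * dualCoxeter θ b := by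
  rw [Prod.smul_snd, Prod.smul_fst, rho_level, nsmul_eq_mul]

theorem IsHighestRoot.dualCoxeter_ne_zero (hθ : IsHighestRoot b θ) : dualCoxeter θ b ≠ 0 := by
  obtain ⟨r, hr, h⟩ := hθ.exists_dualCoxeter
  rw [h]
  exact_mod_cast hr.ne'

theorem IsHighestRoot.nsmul_rho_level_add_ne_zero (hθ : IsHighestRoot b θ) (n : ℕ) :
    (n • rho θ b).2.1 + dualCoxeter θ b ≠ 0 := by
  rw [nsmul_rho_level, ← add_one_mul]
  exact mul_ne_zero (Nat.cast_add_one_ne_zero n) hθ.dualCoxeter_ne_zero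

theorem IsHighestRoot.add_level_add_ne_zero (hθ : IsHighestRoot b θ) (m n : ℕ) :
    (m • rho θ b + n • rho θ b).2.1 + dualCoxeter θ b ≠ 0 := by
  rw [← add_smul]
  exact hθ.nsmul_rho_level_add_ne_zero (m + n)

/-- The levels are `m h^∨`, `n h^∨` and `(m+n) h^∨`, so each denominator `2(k + h^∨)` contributes
the common factor `1/(2h^∨)`. -/
theorem gkoScalar_eq (hθ : IsHighestRoot b θ) (m n : ℕ) {mu : AffineWeight H}
    (hmu : mu.2.1 = (m + n) * dualCoxeter θ b) :
    gkoScalar θ b m n mu = casimirScalar θ b (m • rho θ b) + casimirScalar θ b (n • rho θ b) -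
      casimirScalar θ b mu := by
  have h := hθ.dualCoxeter_ne_zero
  have h1 : ((m : ℂ) + 1) ≠ 0 := Nat.cast_add_one_ne_zero m
  have h2 : ((n : ℂ) + 1) ≠ 0 := Nat.cast_add_one_ne_zero n
  have h3 : ((m : ℂ) + n + 1) ≠ 0 := by exact_mod_cast Nat.cast_add_one_ne_zero (R := ℂ) (m + n)
  rw [gkoScalar, casimirScalar, casimirScalar, casimirScalar, nsmul_rho_level, nsmul_rho_level, hmu,
    ← add_one_mul, ← add_one_mul, ← add_one_mul, ← add_smul, ← add_smul]
  field_simp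

theorem gkoScalar_add_smul_delta (hθ : IsHighestRoot b θ) (m n : ℕ) {mu : AffineWeight H}
    (hmu : mu.2.1 = (m + n) * dualCoxeter θ b) (r : ℂ) :
    gkoScalar θ b m n (mu + r • delta H) = gkoScalar θ b m n mu - r := by
  have h := hθ.dualCoxeter_ne_zero
  have h3 : ((m : ℂ) + n + 1) ≠ 0 := by exact_mod_cast Nat.cast_add_one_ne_zero (R := ℂ) (m + n)
  have h4 : weightForm θ (mu + r • delta H) (mu + r • delta H + 2 • rho θ b) =
      weightForm θ mu (mu + 2 • rho θ b) + 2 * r * (m + n + 1) * dualCoxeter θ b := by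
    simp only [weightForm, delta, Prod.fst_add, Prod.snd_add, Prod.smul_fst, Prod.smul_snd, hmu,
      rho_level, rho_snd_snd, smul_zero, add_zero, smul_eq_mul, mul_one]
    rw [nsmul_eq_mul]
    push_cast
    ring
  rw [gkoScalar, gkoScalar, h4]
  field_simp
  ring

variable {Vm Vn : Type*} [AddCommGroup Vm] [Module ℂ Vm] [LieRingModule (Affine θ) Vm]
  [LieModule ℂ (Affine θ) Vm] [AddCommGroup Vn] [Module ℂ Vn] [LieRingModule (Affine θ) Vn]
  [LieModule ℂ (Affine θ) Vn] {m n : ℕ}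

theorem weightSpan_tensor_rho_eq_top (hθ : IsHighestRoot b θ)
    (hVm : IsIrreducibleHighestWeight θ b Vm (m • rho θ b))
    (hVn : IsIrreducibleHighestWeight θ b Vn (n • rho θ b)) :
    weightSpan θ (Vm ⊗[ℂ] Vn)
      (fun mu => IsAffineNatComb θ b (m • rho θ b + n • rho θ b - mu)) = ⊤ :=
  weightSpan_tensor_eq_top (hVm.weightSpan_eq_top hθ) (hVn.weightSpan_eq_top hθ)

variable {mu : AffineWeight H} {v : Vm ⊗[ℂ] Vn}

theorem isAffineNatComb_of_isHighestWeightVector (hθ : IsHighestRoot b θ)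
    (hVm : IsIrreducibleHighestWeight θ b Vm (m • rho θ b))
    (hVn : IsIrreducibleHighestWeight θ b Vn (n • rho θ b))
    (hv : IsHighestWeightVector θ b mu v) :
    IsAffineNatComb θ b (m • rho θ b + n • rho θ b - mu) :=
  hv.2.1.of_mem_weightSpan (by rw [weightSpan_tensor_rho_eq_top hθ hVm hVn]; trivial) hv.1

theorem level_of_isHighestWeightVector (hθ : IsHighestRoot b θ)
    (hVm : IsIrreducibleHighestWeight θ b Vm (m • rho θ b))
    (hVn : IsIrreducibleHighestWeight θ b Vn (n • rho θ b))
    (hv : IsHighestWeightVector θ b mu v) :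
    mu.2.1 = (m + n) * dualCoxeter θ b := by
  have h := sub_eq_zero.mp (isAffineNatComb_of_isHighestWeightVector hθ hVm hVn hv).1
  rw [← h, Prod.snd_add, Prod.fst_add, nsmul_rho_level, nsmul_rho_level, add_mul]

/-- The simple lowering operators are locally nilpotent on each integrable factor, hence on the
tensor product. -/
theorem isDominantIntegral_tensor (hθ : IsHighestRoot b θ)
    (hVm : IsIrreducibleHighestWeight θ b Vm (m • rho θ b))
    (hVn : IsIrreducibleHighestWeight θ b Vn (n • rho θ b))
    (hv : IsHighestWeightVector θ b mu v) :
    IsDominantIntegral θ b mu :=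
  isDominantIntegral_of_isHighestWeightVector hθ (fun _ _ _ h => maxGenEigenspace_tensor_eq_top
    (h.maxGenEigenspace_eq_top hθ (isDominantIntegral_nsmul_rho m) hVm)
    (h.maxGenEigenspace_eq_top hθ (isDominantIntegral_nsmul_rho n) hVn)) hv

theorem gkoScalar_pos_of_isHighestWeightVector (hθ : IsHighestRoot b θ)
    (hVm : IsIrreducibleHighestWeight θ b Vm (m • rho θ b))
    (hVn : IsIrreducibleHighestWeight θ b Vn (n • rho θ b))
    (hm : 0 < m) (hn : 0 < n)
    (hv : IsHighestWeightVector θ b mu v) : 0 < gkoScalar θ b m n mu :=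
  gkoScalar_pos hθ hm hn (isDominantIntegral_tensor hθ hVm hVn hv)
    (isAffineNatComb_of_isHighestWeightVector hθ hVm hVn hv)

/-- Highest weight vectors of `V(mρ) ⊗ V(nρ)` generate irreducible submodules. -/
theorem isComponent_of_isHighestWeightVector (hθ : IsHighestRoot b θ)
    (hVm : IsIrreducibleHighestWeight θ b Vm (m • rho θ b))
    (hVn : IsIrreducibleHighestWeight θ b Vn (n • rho θ b))
    (hv : IsHighestWeightVector θ b mu v) :
    IsComponent θ b (Vm ⊗[ℂ] Vn) mu := by
  have htop := weightSpan_tensor_rho_eq_top hθ hVm hVn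
  have hvmem : v ∈ (LieSubmodule.lieSpan ℂ (Affine θ) {v} : LieSubmodule ℂ (Affine θ) (Vm ⊗[ℂ] Vn)) :=
    LieSubmodule.subset_lieSpan rfl
  refine ⟨LieSubmodule.lieSpan ℂ (Affine θ) {v}, ?_, ⟨v, hvmem⟩, ?_⟩
  · have : Nontrivial (LieSubmodule.lieSpan ℂ (Affine θ) {v} :
        LieSubmodule ℂ (Affine θ) (Vm ⊗[ℂ] Vn)) :=
      ⟨⟨v, hvmem⟩, 0, fun h => hv.1 (congrArg Subtype.val h)⟩
    refine LieModule.IsIrreducible.mk fun N hN => ?_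
    let N' := N.map (LieSubmodule.incl _)
    have hN' : N' ≠ ⊥ := by
      intro h
      refine hN ((LieSubmodule.eq_bot_iff N).mpr fun y hy => ?_)
      have h1 : (y : Vm ⊗[ℂ] Vn) ∈ N' := LieSubmodule.mem_map_of_mem hy
      rw [h] at h1
      exact Subtype.ext (by simpa using h1)
    -- This highest weight vector lies in the span of `v`, so it has the same Casimir value.
    -- Dominance then forces `nu = mu`, and `y` is a multiple of `v`.
    obtain ⟨nu, y, hyN, hy⟩ := exists_isHighestWeightVector_mem hθ htop N' hN'
    obtain ⟨y', hy'N, rfl⟩ := (LieSubmodule.mem_map _).mp hyN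
    have hmem : (y' : Vm ⊗[ℂ] Vn) ∈ LieSubmodule.lieSpan ℂ (Affine θ) {v} := y'.2
    have hκ := hθ.add_level_add_ne_zero (b := b) m n
    have h1 := degreeCasimir_of_mem_lieSpan htop hθ hκ hv hmem
    have h2 := degreeCasimir_of_isHighestWeightVector htop hκ hy
    have h3 : casimirScalar θ b mu = casimirScalar θ b nu :=
      smul_left_injective ℂ hy.1 (h1.symm.trans h2)
    have hlev := level_of_isHighestWeightVector hθ hVm hVn hv
    have hlev' := level_of_isHighestWeightVector hθ hVm hVn hy
    have h4 : mu = nu := by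
      refine eq_of_weightForm_eq (isDominantIntegral_tensor hθ hVm hVn hv)
        (isDominantIntegral_tensor hθ hVm hVn hy) ?_ ?_
      · exact hy.2.1.of_mem_weightSpan (lieSpan_le_weightSpan hθ hv hmem) hy.1
      · rw [casimirScalar, casimirScalar, hlev, hlev', div_left_inj'] at h3
        · exact h3
        · refine mul_ne_zero two_ne_zero ?_
          rw [← add_one_mul]
          exact mul_ne_zero (by exact_mod_cast Nat.cast_add_one_ne_zero (R := ℂ) (m + n))
            hθ.dualCoxeter_ne_zero
    subst h4
    obtain ⟨r, hr⟩ := exists_smul_eq_of_mem_lieSpan hθ hv hy.2.1 hmem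
    have hr0 : r ≠ 0 := by
      rintro rfl
      exact hy.1 (by rw [← hr, zero_smul])
    have hvN : v ∈ N' := by
      rw [← hr] at hyN
      exact (N'.smul_mem_iff hr0).mp hyN
    have hle : LieSubmodule.lieSpan ℂ (Affine θ) {v} ≤ N' := by
      rw [LieSubmodule.lieSpan_le, Set.singleton_subset_iff]
      exact hvN
    rw [eq_top_iff]
    rintro z -
    obtain ⟨z', hz', h5⟩ := (LieSubmodule.mem_map _).mp (hle z.2)
    rwa [← show z' = z from Subtype.ext h5]
  · refine ⟨fun h => hv.1 (congrArg Subtype.val h), fun h => Subtype.ext (hv.2.1 h),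
      fun α hα e he => Subtype.ext (hv.2.2.1 α hα e he),
      fun k hk x => Subtype.ext (hv.2.2.2 k hk x)⟩

/-- The representations on the factors of `V(mρ) ⊗ V(nρ)` and on the tensor product. -/
def gkoData (hθ : IsHighestRoot b θ) (hVm : IsIrreducibleHighestWeight θ b Vm (m • rho θ b))
    (hVn : IsIrreducibleHighestWeight θ b Vn (n • rho θ b)) : GKOData θ b (Vm ⊗[ℂ] Vn) where
  fst := (moduleRep (hVm.weightSpan_eq_top hθ)).rTensor Vn
  snd := (moduleRep (hVn.weightSpan_eq_top hθ)).lTensor Vm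
  diag := moduleRep (weightSpan_tensor_rho_eq_top hθ hVm hVn)
  comm k l x y w := by
    induction w using TensorProduct.induction_on with
    | zero => simp
    | add w w' hw hw' => simp only [map_add, hw, hw']
    | tmul v v' => simp only [SmoothRep.rTensor_mode_tmul, SmoothRep.lTensor_mode_tmul]
  mode_eq k x w := by
    induction w using TensorProduct.induction_on with
    | zero => simp
    | add w w' hw hw' => simp only [map_add, hw, hw']; abel
    | tmul v v' =>
      rw [SmoothRep.rTensor_mode_tmul, SmoothRep.lTensor_mode_tmul, moduleRep_mode,
        TensorProduct.LieModule.lie_tmul_right]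
      rfl
  isHighestRoot := hθ
  fst_ne := hθ.nsmul_rho_level_add_ne_zero m
  snd_ne := hθ.nsmul_rho_level_add_ne_zero n
  diag_ne := hθ.add_level_add_ne_zero m n

variable (hθ : IsHighestRoot b θ) (hVm : IsIrreducibleHighestWeight θ b Vm (m • rho θ b))
  (hVn : IsIrreducibleHighestWeight θ b Vn (n • rho θ b))

theorem gkoL0_eq (w : Vm ⊗[ℂ] Vn) :
    gkoL0 θ b Vm Vn (m • rho θ b).2.1 (n • rho θ b).2.1 w = (gkoData hθ hVm hVn).gkoZero w := by
  have h1 := (gkoData hθ hVm hVn).fst.sugawaraL0_eq (b := b)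
    (fun X => (LieModule.toEnd ℂ (Affine θ) Vm X).rTensor Vn) (fun _ _ => rfl) w
  have h2 := (gkoData hθ hVm hVn).snd.sugawaraL0_eq (b := b)
    (fun X => (LieModule.toEnd ℂ (Affine θ) Vn X).lTensor Vm) (fun _ _ => rfl) w
  have h3 := (gkoData hθ hVm hVn).diag.sugawaraL0_eq (b := b)
    (fun X => LieModule.toEnd ℂ (Affine θ) (Vm ⊗[ℂ] Vn) X) (fun _ _ => rfl) w
  rw [GKOData.gkoZero, LinearMap.sub_apply, LinearMap.add_apply, ← h1, ← h2, ← h3]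
  rfl

/-- On each irreducible factor `L₀ + d` is a scalar, and `d` acts on the tensor product as the sum
of its actions on the factors. -/
theorem sugawaraZero_factors_add_lie (w : Vm ⊗[ℂ] Vn) :
    (gkoData hθ hVm hVn).fst.sugawaraZero b w + (gkoData hθ hVm hVn).snd.sugawaraZero b w +
      ⁅ofCartan θ (degreeElement H), w⁆ =
        (casimirScalar θ b (m • rho θ b) + casimirScalar θ b (n • rho θ b)) • w := by
  induction w using TensorProduct.induction_on with
  | zero => simp
  | add w w' hw hw' =>
    rw [smul_add, ← hw, ← hw', map_add, map_add, lie_add]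
    abel
  | tmul v v' =>
    have h1 := hVm.degreeCasimir_apply hθ (hθ.nsmul_rho_level_add_ne_zero m) v
    have h2 := hVn.degreeCasimir_apply hθ (hθ.nsmul_rho_level_add_ne_zero n) v'
    rw [UntwistedAffine.degreeCasimir_apply, ← eq_sub_iff_add_eq] at h1 h2
    have h3 : (gkoData hθ hVm hVn).fst.sugawaraZero b (v ⊗ₜ v') = _ :=
      SmoothRep.rTensor_sugawaraZero_tmul _ v v'
    have h4 : (gkoData hθ hVm hVn).snd.sugawaraZero b (v ⊗ₜ v') = _ :=
      SmoothRep.lTensor_sugawaraZero_tmul _ v v'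
    rw [h3, h4, h1, h2, TensorProduct.LieModule.lie_tmul_right, TensorProduct.sub_tmul,
      TensorProduct.tmul_sub, add_smul, ← TensorProduct.smul_tmul', TensorProduct.tmul_smul]
    abel

/-- Both the sum of the factors' `L₀` and the diagonal `L₀` become scalars here after adding the
same `d`, which cancels in the difference. -/
theorem gkoZero_of_mem_lieSpan (hv : IsHighestWeightVector θ b mu v) {w : Vm ⊗[ℂ] Vn}
    (hw : w ∈ LieSubmodule.lieSpan ℂ (Affine θ) {v}) :
    (gkoData hθ hVm hVn).gkoZero w = gkoScalar θ b m n mu • w := by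
  have h1 := degreeCasimir_of_mem_lieSpan (weightSpan_tensor_rho_eq_top hθ hVm hVn) hθ
    (hθ.add_level_add_ne_zero m n) hv hw
  have h2 := sugawaraZero_factors_add_lie hθ hVm hVn w
  rw [gkoScalar_eq hθ m n (level_of_isHighestWeightVector hθ hVm hVn hv), sub_smul, ← h1, ← h2,
    degreeCasimir_apply, GKOData.gkoZero, LinearMap.sub_apply, LinearMap.add_apply,
    add_sub_add_right_eq_sub]
  rfl

theorem lie_degree_gko (p : ℤ) (w : Vm ⊗[ℂ] Vn) :
    ⁅ofCartan θ (degreeElement H), (gkoData hθ hVm hVn).gko p w⁆ =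
      (gkoData hθ hVm hVn).gko p ⁅ofCartan θ (degreeElement H), w⁆ +
        (2 * p + 1 : ℂ) • (gkoData hθ hVm hVn).gko p w := by
  have h := (gkoData hθ hVm hVn).map_gko (c := 1)
    (X := LieModule.toEnd ℂ (Affine θ) (Vm ⊗[ℂ] Vn) (ofCartan θ (degreeElement H))) ?_ ?_ p w
  · rw [one_mul] at h
    exact h
  · intro k x w
    rw [one_mul]
    induction w using TensorProduct.induction_on with
    | zero => simp
    | add w w' hw hw' => simp only [map_add, smul_add, hw, hw']; abel
    | tmul v v' =>
      change ⁅ofCartan θ (degreeElement H), ((moduleRep (hVm.weightSpan_eq_top hθ)).mode k x v) ⊗ₜ[ℂ]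
        v'⁆ = ((moduleRep (hVm.weightSpan_eq_top hθ)).rTensor Vn).mode k x
          ⁅ofCartan θ (degreeElement H), v ⊗ₜ[ℂ] v'⁆ +
            (k : ℂ) • (((moduleRep (hVm.weightSpan_eq_top hθ)).mode k x v) ⊗ₜ[ℂ] v')
      rw [TensorProduct.LieModule.lie_tmul_right, TensorProduct.LieModule.lie_tmul_right,
        lie_degree_mode, map_add, SmoothRep.rTensor_mode_tmul, SmoothRep.rTensor_mode_tmul,
        TensorProduct.add_tmul, TensorProduct.smul_tmul']
      abel
  · intro k x w
    rw [one_mul]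
    induction w using TensorProduct.induction_on with
    | zero => simp
    | add w w' hw hw' => simp only [map_add, smul_add, hw, hw']; abel
    | tmul v v' =>
      change ⁅ofCartan θ (degreeElement H), v ⊗ₜ[ℂ]
        ((moduleRep (hVn.weightSpan_eq_top hθ)).mode k x v')⁆ =
          ((moduleRep (hVn.weightSpan_eq_top hθ)).lTensor Vm).mode k x
          ⁅ofCartan θ (degreeElement H), v ⊗ₜ[ℂ] v'⁆ +
            (k : ℂ) • (v ⊗ₜ[ℂ] ((moduleRep (hVn.weightSpan_eq_top hθ)).mode k x v'))
      rw [TensorProduct.LieModule.lie_tmul_right, TensorProduct.LieModule.lie_tmul_right,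
        lie_degree_mode, map_add, SmoothRep.lTensor_mode_tmul, SmoothRep.lTensor_mode_tmul,
        TensorProduct.tmul_add, TensorProduct.tmul_smul]
      abel

theorem lie_current_gko (p k : ℤ) (x : 𝔤) (w : Vm ⊗[ℂ] Vn) :
    ⁅current θ k x, (gkoData hθ hVm hVn).gko p w⁆ =
      (gkoData hθ hVm hVn).gko p ⁅current θ k x, w⁆ :=
  ((gkoData hθ hVm hVn).gko_diag_mode p k x w).symm

/-- The operators `L₁` and `L₋₁` shift the weights of highest weight vectors by `±δ`. -/
theorem isHighestWeightVector_gko (p : ℤ) (hv : IsHighestWeightVector θ b mu v)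
    (h0 : (gkoData hθ hVm hVn).gko p v ≠ 0) :
    IsHighestWeightVector θ b (mu + (2 * p + 1 : ℂ) • delta H) ((gkoData hθ hVm hVn).gko p v) := by
  refine ⟨h0, fun h => ?_, fun α hα e he => ?_, fun k hk x => ?_⟩
  · have h1 : ⁅current θ 0 (h.1 : 𝔤), v⁆ = mu.1 h.1 • v := by
      refine (hv.2.1 (h.1, 0, 0)).trans ?_
      simp [evalWeight]
    have h2 : ⁅ofCartan θ (degreeElement H), v⁆ = mu.2.2 • v := by
      refine (hv.2.1 _).trans ?_
      simp [evalWeight, degreeElement]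
    have hlev := level_of_isHighestWeightVector hθ hVm hVn hv
    have hlev' : (m • rho θ b + n • rho θ b).2.1 = mu.2.1 := by
      rw [hlev, Prod.snd_add, Prod.fst_add, nsmul_rho_level, nsmul_rho_level, add_mul]
    rw [ofCartan_eq, add_lie, add_lie, smul_lie, lie_current_gko, lie_degree_gko, h1, h2,
      lie_ofCartan_mid_eq_smul (weightSpan_tensor_rho_eq_top hθ hVm hVn), hlev']
    simp only [map_smul, ← add_smul, smul_smul]
    congr 1
    simp only [evalWeight, delta, Prod.fst_add, Prod.snd_add, Prod.smul_fst, Prod.smul_snd,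
      smul_zero, add_zero, smul_eq_mul, mul_one]
    ring
  · rw [lie_current_gko, hv.2.2.1 α hα e he, map_zero]
  · rw [lie_current_gko, hv.2.2.2 k hk x, map_zero]

theorem gkoZero_of_isHighestWeightVector (hv : IsHighestWeightVector θ b mu v) :
    (gkoData hθ hVm hVn).gkoZero v = gkoScalar θ b m n mu • v :=
  gkoZero_of_mem_lieSpan hθ hVm hVn hv (LieSubmodule.subset_lieSpan rfl)

/-- The operator `L₋₁` does not kill highest weight vectors. -/
theorem gko_neg_one_ne_zero (hm : 0 < m) (hn : 0 < n) (hv : IsHighestWeightVector θ b mu v) :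
    (gkoData hθ hVm hVn).gko (-1) v ≠ 0 := by
  intro hzero
  set D := gkoData hθ hVm hVn with hD
  set s := gkoScalar θ b m n mu with hs
  have hlev := level_of_isHighestWeightVector hθ hVm hVn hv
  -- The coset `L₁` commutes with the currents and raises the weight by `δ`, so its nonzero iterates
  -- on `v` are again highest weight vectors.
  have hx : ∀ j : ℕ, (D.gko 0 ^ j) v ≠ 0 →
      IsHighestWeightVector θ b (mu + (j : ℂ) • delta H) ((D.gko 0 ^ j) v) := by
    intro j
    induction j with
    | zero => intro _; simpa using hv
    | succ j ih =>
      intro h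
      rw [pow_succ', Module.End.mul_apply] at h ⊢
      have h1 := isHighestWeightVector_gko hθ hVm hVn 0
        (ih fun h' => h (by rw [h', map_zero])) h
      convert h1 using 1
      rw [add_assoc, ← add_smul]
      push_cast
      ring_nf
  have hz : ∀ j : ℕ, D.gkoZero ((D.gko 0 ^ j) v) = (s - j) • (D.gko 0 ^ j) v := by
    intro j
    by_cases h : (D.gko 0 ^ j) v = 0
    · rw [h, map_zero, smul_zero]
    · rw [gkoZero_of_isHighestWeightVector hθ hVm hVn (hx j h),
        gkoScalar_add_smul_delta hθ m n hlev]
  -- Lowest weight string for `L₋₁, L₀, L₁`, started by `L₋₁ v = 0`. The coefficient is minus the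
  -- sum of `2(s - i)` for `0 ≤ i ≤ j`.
  have hlow : ∀ j : ℕ, D.gko (-1) ((D.gko 0 ^ (j + 1)) v) =
      (-((j + 1) * (2 * s - j)) : ℂ) • (D.gko 0 ^ j) v := by
    intro j
    induction j with
    | zero =>
      have h1 := D.commutator_gko v
      have h2 := hz 0
      rw [pow_zero, Module.End.one_apply] at h2
      rw [hzero, map_zero, zero_sub, h2, neg_eq_iff_eq_neg] at h1
      rw [zero_add, pow_one, h1, pow_zero, Module.End.one_apply]
      push_cast
      module
    | succ j ih =>
      have h1 := D.commutator_gko ((D.gko 0 ^ (j + 1)) v)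
      rw [ih, map_smul, hz, sub_eq_iff_eq_add', ← sub_eq_iff_eq_add] at h1
      rw [pow_succ' _ (j + 1), Module.End.mul_apply, ← h1, ← Module.End.mul_apply (D.gko 0),
        ← pow_succ']
      push_cast
      module
  -- The weight of `v` lies `k` levels of `δ` below the top, so `k + 1` raisings would leave the set
  -- of weights.
  have hex : ∃ j : ℕ, (D.gko 0 ^ j) v = 0 := by
    by_contra! hne
    obtain ⟨-, ⟨k, hk⟩, -⟩ := isAffineNatComb_of_isHighestWeightVector hθ hVm hVn hv
    obtain ⟨-, ⟨l, hl⟩, -⟩ :=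
      isAffineNatComb_of_isHighestWeightVector hθ hVm hVn (hx (k + 1) (hne (k + 1)))
    rw [← sub_sub, Prod.snd_sub, Prod.snd_sub, hk] at hl
    have h1 : ((k : ℂ) - ((k + 1 : ℕ) : ℂ)) = l := by
      rw [← hl]
      simp [delta]
    have h2 : (k : ℤ) - (k + 1 : ℕ) = l := by exact_mod_cast h1
    omega
  obtain ⟨N, hN, hN'⟩ := Nat.exists_not_and_succ_of_not_zero_of_exists
    (p := fun j => (D.gko 0 ^ j) v = 0) hv.1 hex
  have h1 := hlow N
  rw [hN', map_zero, eq_comm, smul_eq_zero_iff_left hN, neg_eq_zero, mul_eq_zero, sub_eq_zero] at h1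
  -- At the last nonzero vector of the string the coefficient must vanish, so `2s = N` and the coset
  -- eigenvalue there is `s - N = -N/2`, contradicting positivity.
  have h2 := h1.resolve_left (Nat.cast_add_one_ne_zero N)
  have h3 := gkoScalar_pos_of_isHighestWeightVector hθ hVm hVn hm hn (hx N hN)
  rw [gkoScalar_add_smul_delta hθ m n hlev] at h3
  have h4 : s - (N : ℂ) = ((-(N : ℝ) / 2 : ℝ) : ℂ) := by
    push_cast
    linear_combination h2 / 2
  rw [← hs, h4, Complex.zero_lt_real] at h3
  have : (0 : ℝ) ≤ N := Nat.cast_nonneg N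
  linarith

end CosetConstruction

/-! ### From a component back to a highest weight vector of the ambient module. -/

section Components

variable {𝔤 : Type*} [LieRing 𝔤] [LieAlgebra ℂ 𝔤] [FiniteDimensional ℂ 𝔤] [LieAlgebra.IsSimple ℂ 𝔤]
  {H : LieSubalgebra ℂ 𝔤} [H.IsCartanSubalgebra] {θ : H.root} {b : (rootSystem H).Base}
  {V : Type*} [AddCommGroup V] [Module ℂ V] [LieRingModule (Affine θ) V]
  [LieModule ℂ (Affine θ) V]

/-- Irreducibility makes the highest weight vector generate `W`, so the scalar computed on its span
applies to all of `W`. -/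
theorem IsIrreducibleHighestWeight.exists_isHighestWeightVector {W : LieSubmodule ℂ (Affine θ) V}
    {lam : AffineWeight H} (hW : IsIrreducibleHighestWeight θ b W lam) :
    ∃ v : V, IsHighestWeightVector θ b lam v ∧ W ≤ LieSubmodule.lieSpan ℂ (Affine θ) {v} := by
  obtain ⟨hirr, v, hv⟩ := hW
  refine ⟨v, ⟨fun h => hv.1 (Subtype.ext h), fun h => congrArg Subtype.val (hv.2.1 h),
    fun α hα e he => congrArg Subtype.val (hv.2.2.1 α hα e he),
    fun k hk x => congrArg Subtype.val (hv.2.2.2 k hk x)⟩, fun w hw => ?_⟩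
  have h1 : (⊤ : LieSubmodule ℂ (Affine θ) W) ≤
      (LieSubmodule.lieSpan ℂ (Affine θ) {(v : V)}).comap W.incl := by
    rw [← lieSpan_eq_top_of_isIrreducible hv.1, LieSubmodule.lieSpan_le, Set.singleton_subset_iff]
    exact LieSubmodule.subset_lieSpan rfl
  exact h1 (show (⟨w, hw⟩ : W) ∈ ⊤ from trivial)

end Components

end UntwistedAffine

end

/-! ### The main theorem. -/

open UntwistedAffine in
theorem mainTheorem3 {𝔤 : Type*} [LieRing 𝔤] [LieAlgebra ℂ 𝔤] [FiniteDimensional ℂ 𝔤]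
    [LieAlgebra.IsSimple ℂ 𝔤] (H : LieSubalgebra ℂ 𝔤) [H.IsCartanSubalgebra]
    (b : (LieAlgebra.IsKilling.rootSystem H).Base) (θ : H.root) (hθ : IsHighestRoot b θ)
    (m n : ℕ) (hm : 0 < m) (hn : 0 < n)
    (Vm : Type*) [AddCommGroup Vm] [Module ℂ Vm] [LieRingModule (Affine θ) Vm]
    [LieModule ℂ (Affine θ) Vm] (hVm : IsIrreducibleHighestWeight θ b Vm (m • rho θ b))
    (Vn : Type*) [AddCommGroup Vn] [Module ℂ Vn] [LieRingModule (Affine θ) Vn]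
    [LieModule ℂ (Affine θ) Vn] (hVn : IsIrreducibleHighestWeight θ b Vn (n • rho θ b)) :
    (∀ β lam : AffineWeight H, IsWeight θ Vn β → lam = m • rho θ b + β →
      IsDominantIntegral θ b lam → 0 < gkoScalar θ b m n lam) ∧
    (∀ (lam : AffineWeight H) (W : LieSubmodule ℂ (Affine θ) (Vm ⊗[ℂ] Vn)),
      IsIrreducibleHighestWeight θ b W lam →
        0 < gkoScalar θ b m n lam ∧
        ∀ w ∈ W, gkoL0 θ b Vm Vn (m • rho θ b).2.1 (n • rho θ b).2.1 w =
          gkoScalar θ b m n lam • w) ∧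
    (∀ lam : AffineWeight H, IsComponent θ b (Vm ⊗[ℂ] Vn) lam →
      ∀ k : ℕ, IsComponent θ b (Vm ⊗[ℂ] Vn) (lam - k • delta H)) := by
  refine ⟨?_, ?_, ?_⟩
  · rintro β lam ⟨v, hv0, hv⟩ rfl hlam
    refine gkoScalar_pos hθ hm hn hlam ?_
    -- The difference `mρ + nρ - (mρ + β)` is `nρ - β`, a nonnegative combination because `β` is a
    -- weight of `V(nρ)`.
    rw [add_sub_add_left_eq_sub]
    exact hv.of_mem_weightSpan (by rw [hVn.weightSpan_eq_top hθ]; trivial) hv0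
  · intro lam W hW
    obtain ⟨v, hv, hle⟩ := hW.exists_isHighestWeightVector
    refine ⟨gkoScalar_pos_of_isHighestWeightVector hθ hVm hVn hm hn hv, fun w hw => ?_⟩
    rw [gkoL0_eq hθ hVm hVn]
    exact gkoZero_of_mem_lieSpan hθ hVm hVn hv (hle hw)
  · intro lam hlam k
    induction k with
    | zero => simpa using hlam
    | succ k ih =>
      obtain ⟨W, hW⟩ := ih
      obtain ⟨v, hv, -⟩ := hW.exists_isHighestWeightVector
      -- For `p = -1` the shift `(2p + 1)δ` is `-δ`, so each application of `L₋₁` gives the next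
      -- component.
      have h := isHighestWeightVector_gko hθ hVm hVn (-1) hv
        (gko_neg_one_ne_zero hθ hVm hVn hm hn hv)
      convert isComponent_of_isHighestWeightVector hθ hVm hVn h using 1
      rw [succ_nsmul]
      push_cast
      module
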